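/- **Setting.** Let $A$ be a complex $2\times 2$ matrix. Its conformal range (real Davis--Wielandt shell) is $$\mathrm{DW}^{\mathbb R}_{\mathrm{BCK}}(A)=\left\{\left(\frac{2\,\mathrm{Re}\langle y,x\rangle}{|y|^2+|x|^2},\frac{|y|^2-|x|^2}{|y|^2+|x|^2}\right): y=Ax,\ x\in\mathbb C^2\setminus\{0\}\right\},$$ a subset of the closed unit disk, which is viewed as the asymptotically closed hyperbolic plane in the Beltrami--Cayley--Klein (BCK) model: interior points are ordinary, boundary points are asymptotic, chords are lines, and the distance of ordinary points is $$d(p,q)=\operatorname{arcosh}\frac{1-p\cdot q}{\sqrt{1-|p|^2}\sqrt{1-|q|^2}},$$ while an asymptotic point has distance $+\infty$ from every other point. Put $$D_A=\det A-\tfrac14(\mathrm{tr} A)^2,\qquad U_A=\tfrac12\mathrm{tr}(A^*A)-\tfrac14|\mathrm{tr} A|^2,\qquad E_A=\left(\tfrac12\mathrm{Im}\,\mathrm{tr} A\right)^2+\tfrac12\left(|D_A|-\mathrm{Re}\,D_A\right).$$ **Semi-axes.** The major and minor semi-axis lengths $s^\pm\in[0,\infty]$ of $K=\mathrm{DW}^{\mathbb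 R}_{\mathrm{BCK}}(A)$ are half of the hyperbolic lengths of the major and minor axes, defined as follows. (1) If $K$ has no asymptotic point, the major axis is a segment contained in $K$ that is a diameter of a hyperbolic disk containing $K$ (the smallest one), and the minor axis is the intersection of $K$ with the perpendicular bisector of the major axis (for $K$ a single point both lengths are $0$). (2) If $K$ has two asymptotic points, the major axis is the line contained in $K$, and the minor axes are the intersections of $K$ with the lines perpendicular to it. (3) If $K$ has exactly one asymptotic point and also other points, the major axis is the intersection of $K$ with a symmetry axis, and the length of the minor axis is by definition the supremum of the lengths of the intersections of $K$ with the lines perpendicular to this symmetry axis. (4) If $K$ is a single asymptotic point, then $s^+=s^-=0$. **Characteristic BCK values.** By an applicable real Möbius transformation $A\mapsto (aA+b)(cA+d)^{-1}$ ($a,b,c,d\in\mathbb R$, $ad-bc\ne0$, $cA+d$ invertible) and a unitary conjugation, $A$ can be brought to one of the canonical forms $$\mathbf 0_2,\qquad S_\beta=\begin{bmatrix}0&\cos\beta\\0&\mathrm i\sin\beta\end{bmatrix},\qquad L^{\pm}_{\alpha,t}=\begin{bmatrix}\cos\alpha+\mathrm i\sin\alpha&2t\\0&-\cos\alpha\pm\mathrm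 i\sin\alpha\end{bmatrix}\qquad(\alpha,\beta\in[0,\tfrac\pi2],\ t\ge0).$$ The characteristic BCK values $(\chi^+,\chi^-)$ of $A$ are those of its canonical form, which are $(0,0)$ for $\mathbf 0_2$; $(1,\cos\beta)$ for $S_\beta$; and $\left(\frac{\sqrt{\cos^2\alpha+t^2}}{\sqrt{1+t^2}},\frac{t}{\sqrt{1+t^2}}\right)$ for $L^\pm_{\alpha,t}$ (in the last case these are the Euclidean semi-axes of the conformal range, an ellipse centered at the origin). **Theorem.** The characteristic BCK values and the semi-axis lengths of $A$ are well defined, $s^\pm=\operatorname{artanh}\chi^\pm$ (with $\operatorname{artanh}1=+\infty$), $\chi^+\ge\chi^-$, $s^+\ge s^-$, and they are given as follows. Here the convention $\frac00=0$ is used in the formulas for $\chi^\pm$; in the formulas for $s^\pm$ the conventions are $\frac00=1$, $\frac x0=+\infty$ for $x>0$, and $\operatorname{arcosh}(+\infty)=+\infty$. (a) If $E_A\ge|D_A|$, then $$\chi^+=\sqrt{\frac{U_A+|D_A|}{U_A-|D_A|+2E_A}},\qquad \chi^-=\sqrt{\frac{U_A-|D_A|}{U_A-|D_A|+2E_A}},$$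 $$s^+=\tfrac12\operatorname{arcosh}\frac{U_A+E_A}{E_A-|D_A|},\qquad s^-=\tfrac12\operatorname{arcosh}\frac{U_A-|D_A|+E_A}{E_A}.$$ Moreover $E_A>|D_A|$ holds exactly if $A$ has a double non-real eigenvalue, or two distinct eigenvalues $\lambda_1,\lambda_2$ with $(\mathrm{Im}\,\lambda_1)(\mathrm{Im}\,\lambda_2)>0$. (b) If $|D_A|\ge E_A$, then $$\chi^+=\sqrt{\frac{U_A-|D_A|+2E_A}{U_A+|D_A|}},\qquad \chi^-=\sqrt{\frac{U_A-|D_A|}{U_A+|D_A|}},$$ $$s^+=\tfrac12\operatorname{arcosh}\frac{U_A+E_A}{|D_A|-E_A},\qquad s^-=\tfrac12\operatorname{arcosh}\frac{U_A}{|D_A|}.$$ Moreover $|D_A|>E_A$ holds exactly if $A$ has two conjugate non-real eigenvalues, or two non-conjugate eigenvalues $\lambda_1,\lambda_2$ with $(\mathrm{Im}\,\lambda_1)(\mathrm{Im}\,\lambda_2)<0$. (c) If $E_A=|D_A|$ and $A$ is not a real multiple of the identity, then $$\chi^+=1,\qquad \chi^-=\sqrt{\frac{U_A-|D_A|}{U_A+|D_A|}}=\sqrt{\frac{U_A-E_A}{U_A+E_A}},$$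 $$s^+=+\infty,\qquad s^-=\tfrac12\operatorname{arcosh}\frac{U_A}{|D_A|}=\tfrac12\operatorname{arcosh}\frac{U_A}{E_A}.$$ If $A$ is a real multiple of the identity, then $E_A=|D_A|$ and $\chi^+=\chi^-=0$, $s^+=s^-=0$. Moreover $E_A=|D_A|$ holds exactly if $A$ has a real eigenvalue, that is, if it has a double real eigenvalue, two distinct real eigenvalues, or a real and a non-real eigenvalue. -/

import Mathlib

open Matrix
open scoped ENNReal ComplexConjugate

noncomputable section

/-! ### Invariants of a complex `2 × 2` matrix -/

/-- The spectral discriminant `D_A = det A - (tr A)² / 4`. -/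
def discD (A : Matrix (Fin 2) (Fin 2) ℂ) : ℂ := A.det - A.trace ^ 2 / 4

/-- The metric discriminant `U_A = tr (A^* A) / 2 - |tr A|² / 4`. -/
def discU (A : Matrix (Fin 2) (Fin 2) ℂ) : ℝ := (Aᴴ * A).trace.re / 2 - ‖A.trace‖ ^ 2 / 4

/-- `E_A = (Im (tr A) / 2)² + (|D_A| - Re D_A) / 2`. -/
def discE (A : Matrix (Fin 2) (Fin 2) ℂ) : ℝ :=
  (A.trace.im / 2) ^ 2 + (‖discD A‖ - (discD A).re) / 2

/-- `A` is a real multiple of the identity. -/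
def IsRealScalar (A : Matrix (Fin 2) (Fin 2) ℂ) : Prop := ∃ r : ℝ, A = (r : ℂ) • 1

/-! ### Spectral types -/

/-- `x, y` are the eigenvalues of `A`, listed with algebraic multiplicity. -/
def EigenvaluesAre (A : Matrix (Fin 2) (Fin 2) ℂ) (x y : ℂ) : Prop := A.charpoly.roots = {x, y}

/-- Two conjugate, non-real eigenvalues. -/
def IsRealElliptic (A : Matrix (Fin 2) (Fin 2) ℂ) : Prop :=
  ∃ x : ℂ, x.im ≠ 0 ∧ EigenvaluesAre A x (conj x)

/-- Two equal real eigenvalues. -/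
def IsRealParabolic (A : Matrix (Fin 2) (Fin 2) ℂ) : Prop :=
  ∃ x : ℝ, EigenvaluesAre A x x

/-- Two distinct real eigenvalues. -/
def IsRealHyperbolic (A : Matrix (Fin 2) (Fin 2) ℂ) : Prop :=
  ∃ x y : ℝ, x ≠ y ∧ EigenvaluesAre A x y

/-- Two equal non-real eigenvalues. -/
def IsNonrealParabolic (A : Matrix (Fin 2) (Fin 2) ℂ) : Prop :=
  ∃ x : ℂ, x.im ≠ 0 ∧ EigenvaluesAre A x x

/-- A real and a non-real eigenvalue. -/
def IsSemiRealType (A : Matrix (Fin 2) (Fin 2) ℂ) : Prop :=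
  ∃ (x : ℝ) (y : ℂ), y.im ≠ 0 ∧ EigenvaluesAre A x y

/-- Two non-conjugate eigenvalues, strictly on different sides of the real axis. -/
def IsQuasielliptic (A : Matrix (Fin 2) (Fin 2) ℂ) : Prop :=
  ∃ x y : ℂ, y ≠ conj x ∧ x.im * y.im < 0 ∧ EigenvaluesAre A x y

/-- Two distinct eigenvalues, strictly on the same side of the real axis. -/
def IsQuasihyperbolic (A : Matrix (Fin 2) (Fin 2) ℂ) : Prop :=
  ∃ x y : ℂ, x ≠ y ∧ 0 < x.im * y.im ∧ EigenvaluesAre A x y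

/-! ### The asymptotically closed hyperbolic plane, Beltrami--Cayley--Klein model

Points are the points `(x, z)` of the closed Euclidean unit disk. -/

/-- Ordinary `h`-points. -/
def IsOrdinary (p : ℝ × ℝ) : Prop := p.1 ^ 2 + p.2 ^ 2 < 1

/-- Asymptotic `h`-points. -/
def IsAsymptotic (p : ℝ × ℝ) : Prop := p.1 ^ 2 + p.2 ^ 2 = 1

open Classical in
/-- The hyperbolic distance (curvature `-1`), extended to asymptotic points: an asymptotic point is
at distance `∞` from every other point. -/
def hDist (p q : ℝ × ℝ) : ℝ≥0∞ :=
  if p = q then 0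
  else if IsOrdinary p ∧ IsOrdinary q then
    ENNReal.ofReal (Real.arcosh ((1 - p.1 * q.1 - p.2 * q.2) /
      (√(1 - p.1 ^ 2 - p.2 ^ 2) * √(1 - q.1 ^ 2 - q.2 ^ 2))))
  else ⊤

/-- The length of a part of an `h`-line: the supremum of the distances of its points
(`0` for the empty set). -/
def hLength (S : Set (ℝ × ℝ)) : ℝ≥0∞ := ⨆ p ∈ S, ⨆ q ∈ S, hDist p q

/-- An `h`-line, given by an equation `a x + b z = c` which has a solution in the open unit disk. -/
structure HLine where
  a : ℝ
  b : ℝ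
  c : ℝ
  meets : c ^ 2 < a ^ 2 + b ^ 2

/-- The points of the asymptotically closed `h`-line. -/
def HLine.carrier (l : HLine) : Set (ℝ × ℝ) :=
  {p | p.1 ^ 2 + p.2 ^ 2 ≤ 1 ∧ l.a * p.1 + l.b * p.2 = l.c}

/-- Hyperbolic perpendicularity: orthogonality of the normals `(a, b, c)` with respect to the
Lorentz form `x² + z² - w²` defining the model. -/
def HLine.Perp (l m : HLine) : Prop := l.a * m.a + l.b * m.b - l.c * m.c = 0

/-- The `h`-reflection in the line `l`: the projective map induced by the Lorentz reflection
`v ↦ v - 2 ⟨v, n⟩ / ⟨n, n⟩ n` with `v = (x, z, 1)` and `n = (a, b, c)`. -/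
def HLine.reflect (l : HLine) (p : ℝ × ℝ) : ℝ × ℝ :=
  let k := 2 * (l.a * p.1 + l.b * p.2 - l.c) / (l.a ^ 2 + l.b ^ 2 - l.c ^ 2)
  ((p.1 - k * l.a) / (1 - k * l.c), (p.2 - k * l.b) / (1 - k * l.c))

/-- `l` is a symmetry axis of `K`. -/
def HLine.IsSymmetryAxis (l : HLine) (K : Set (ℝ × ℝ)) : Prop := l.reflect '' K = K

/-- The perpendicular bisector of two ordinary points (all ordinary points, if these coincide). -/
def hBisector (P Q : ℝ × ℝ) : Set (ℝ × ℝ) := {x | IsOrdinary x ∧ hDist x P = hDist x Q}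

/-- The closed `h`-disk with center `M` through `P`. -/
def hDisk (M P : ℝ × ℝ) : Set (ℝ × ℝ) := {x | IsOrdinary x ∧ hDist M x ≤ hDist M P}

/-- The supremum of the lengths of the intersections of `K` with the lines perpendicular to `l`. -/
def hWidthAlong (K : Set (ℝ × ℝ)) (l : HLine) : ℝ≥0∞ :=
  ⨆ (m : HLine) (_ : l.Perp m), hLength (K ∩ m.carrier)

/-- `HasSemiAxes K s⁺ s⁻`: the set `K` (a possibly degenerate `h`-elliptic disk, `h`-elliptic
parabolic disk, `h`-distance band or horodisk, asymptotically closed) has major semi-axis length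
`s⁺` and minor semi-axis length `s⁻`. -/
inductive HasSemiAxes (K : Set (ℝ × ℝ)) : ℝ≥0∞ → ℝ≥0∞ → Prop
  /-- An asymptotic point: both lengths are `0` by declaration. -/
  | asymptoticPoint (P : ℝ × ℝ) (hP : IsAsymptotic P) (hK : K = {P}) : HasSemiAxes K 0 0
  /-- No asymptotic points: the major axis is a segment `[P, Q]` contained in `K` which is a
  diameter of an `h`-disk containing `K` (this is then the smallest `h`-disk containing `K`);
  the minor axis is the intersection of `K` with the perpendicular bisector of the major axis. -/
  | bounded (hK : ∀ p ∈ K, IsOrdinary p) (P Q M : ℝ × ℝ) (hPQ : segment ℝ P Q ⊆ K)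
      (hM : M ∈ segment ℝ P Q) (hMPQ : hDist M P = hDist M Q) (hdisk : K ⊆ hDisk M P) :
      HasSemiAxes K (hLength (segment ℝ P Q) / 2) (hLength (K ∩ hBisector P Q) / 2)
  /-- Two asymptotic points: the major axis is the asymptotically closed `h`-line contained in `K`;
  the minor axes are the intersections of `K` with the lines perpendicular to it. -/
  | twoAsymptotic (B C : ℝ × ℝ) (hB : IsAsymptotic B) (hC : IsAsymptotic C) (hBC : B ≠ C)
      (hBK : B ∈ K) (hCK : C ∈ K) (l : HLine) (hl : l.carrier ⊆ K) :
      HasSemiAxes K (hLength l.carrier / 2) (hWidthAlong K l / 2)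
  /-- One asymptotic point, and other points: the major axis is the intersection of `K` with a
  symmetry axis; the (asymptotic) length of the minor axis is the supremum of the lengths of the
  intersections of `K` with the lines perpendicular to the symmetry axis. -/
  | oneAsymptotic (B : ℝ × ℝ) (hB : IsAsymptotic B) (hBK : B ∈ K)
      (huniq : ∀ p ∈ K, IsAsymptotic p → p = B) (hne : K ≠ {B})
      (l : HLine) (hl : l.IsSymmetryAxis K) :
      HasSemiAxes K (hLength (K ∩ l.carrier) / 2) (hWidthAlong K l / 2)

/-! ### The conformal range -/

/-- The conformal range (real Davis--Wielandt shell) of `A` in the Beltrami--Cayley--Klein model. -/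
def conformalRange (A : Matrix (Fin 2) (Fin 2) ℂ) : Set (ℝ × ℝ) :=
  {p | ∃ x y : EuclideanSpace ℂ (Fin 2), x ≠ 0 ∧ Matrix.toEuclideanLin A x = y ∧
    p = (2 * (inner ℂ x y).re / (‖y‖ ^ 2 + ‖x‖ ^ 2),
      (‖y‖ ^ 2 - ‖x‖ ^ 2) / (‖y‖ ^ 2 + ‖x‖ ^ 2))}

/-! ### Characteristic BCK values -/

/-- `S_β`. -/
def canonS (β : ℝ) : Matrix (Fin 2) (Fin 2) ℂ :=
  !![0, (Real.cos β : ℂ); 0, Complex.I * (Real.sin β : ℂ)]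

/-- `L⁺_{α,t}`. -/
def canonLPlus (α t : ℝ) : Matrix (Fin 2) (Fin 2) ℂ :=
  !![(Real.cos α : ℂ) + Complex.I * (Real.sin α : ℂ), 2 * (t : ℂ);
    0, -(Real.cos α : ℂ) + Complex.I * (Real.sin α : ℂ)]

/-- `L⁻_{α,t}`. -/
def canonLMinus (α t : ℝ) : Matrix (Fin 2) (Fin 2) ℂ :=
  !![(Real.cos α : ℂ) + Complex.I * (Real.sin α : ℂ), 2 * (t : ℂ);
    0, -(Real.cos α : ℂ) - Complex.I * (Real.sin α : ℂ)]

/-- The characteristic BCK values `χ⁺, χ⁻` assigned to the canonical representatives. For `L^±_{α,t}`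
these are the Euclidean semi-axes of the conformal range, which is an ellipse centered at the
origin. -/
inductive CanonicalBCK : Matrix (Fin 2) (Fin 2) ℂ → ℝ → ℝ → Prop
  | zero : CanonicalBCK 0 0 0
  | S (β : ℝ) (hβ : β ∈ Set.Icc 0 (Real.pi / 2)) : CanonicalBCK (canonS β) 1 (Real.cos β)
  | LPlus (α t : ℝ) (hα : α ∈ Set.Icc 0 (Real.pi / 2)) (ht : 0 ≤ t) :
      CanonicalBCK (canonLPlus α t) (√(Real.cos α ^ 2 + t ^ 2) / √(1 + t ^ 2)) (t / √(1 + t ^ 2))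
  | LMinus (α t : ℝ) (hα : α ∈ Set.Icc 0 (Real.pi / 2)) (ht : 0 ≤ t) :
      CanonicalBCK (canonLMinus α t) (√(Real.cos α ^ 2 + t ^ 2) / √(1 + t ^ 2)) (t / √(1 + t ^ 2))

/-- `B` arises from `A` by an applicable real Möbius transformation and a unitary conjugation. -/
def RealMoebiusEquiv (A B : Matrix (Fin 2) (Fin 2) ℂ) : Prop :=
  ∃ a b c d : ℝ, a * d - b * c ≠ 0 ∧
    ((c : ℂ) • A + (d : ℂ) • 1).det ≠ 0 ∧
    ∃ V ∈ Matrix.unitaryGroup (Fin 2) ℂ,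
      B = V * (((a : ℂ) • A + (b : ℂ) • 1) * ((c : ℂ) • A + (d : ℂ) • 1)⁻¹) * Vᴴ

/-- `p, m` are characteristic BCK values `χ⁺, χ⁻` of `A`: those of a canonical representative which
is equivalent to `A`. -/
def IsCharBCK (A : Matrix (Fin 2) (Fin 2) ℂ) (p m : ℝ) : Prop :=
  ∃ B, RealMoebiusEquiv A B ∧ CanonicalBCK B p m

/-! ### Extended-valued functions in the formulas -/

/-- The quotient of nonnegative reals in `[0, ∞]`, with `0 / 0 = 1` and `x / 0 = ∞` for `x > 0`. -/
def extDiv (x y : ℝ) : ℝ≥0∞ :=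
  if x = 0 ∧ y = 0 then 1 else ENNReal.ofReal x / ENNReal.ofReal y

/-- `arcosh` on `[1, ∞]`, with `arcosh ∞ = ∞`. -/
def extArcosh (x : ℝ≥0∞) : ℝ≥0∞ :=
  if x = ⊤ then ⊤ else ENNReal.ofReal (Real.arcosh x.toReal)

/-- `artanh` on `[0, 1]`, with `artanh 1 = ∞`. -/
def extArtanh (u : ℝ) : ℝ≥0∞ :=
  if u = 1 then ⊤ else ENNReal.ofReal (Real.artanh u)

/-- The pair of characteristic BCK values of `A` is `(p, m)`, and that of the major and minor
semi-axis lengths of the conformal range of `A` is `(sp, sm)`; the latter are the `artanh`s of the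
former; and `p ≥ m`, `sp ≥ sm`. -/
structure AxisData (A : Matrix (Fin 2) (Fin 2) ℂ) (p m : ℝ) (sp sm : ℝ≥0∞) : Prop where
  charBCK : ∀ p' m', IsCharBCK A p' m' ↔ p' = p ∧ m' = m
  semiAxes : ∀ s s', HasSemiAxes (conformalRange A) s s' ↔ s = sp ∧ s' = sm
  major_eq : sp = extArtanh p
  minor_eq : sm = extArtanh m
  char_le : m ≤ p
  semi_le : sm ≤ sp

end

/-! The argument combines invariance under real Möbius transformations with a computation on the
canonical forms.

Invariance of the range. For `y = Ax` the vector `(2 Re⟨y,x⟩, |y|² - |x|², |y|² + |x|²)` lies in the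
closed forward light cone and projects to a point of the conformal range. A real Möbius
transformation mixes `x` and `y` with real coefficients, so it acts on these vectors by a linear map
which scales the Lorentz form by `(ad - bc)²`; unitary conjugation only moves the test vector. Hence
equivalent matrices have conformal ranges which differ by a hyperbolic isometry
(`conformalRange_moebius`), and every ingredient of `HasSemiAxes` is isometry invariant
(`LorentzSim.hasSemiAxes_image_iff`).

Invariance of the formulas. If `x, y` are the eigenvalues and `τ` is the corner entry of a Schur
form, then `|D| = |x - y|²/4`, `E - |D| = Im x · Im y` and `U - |D| = τ²/2`. The second identity
yields all the spectral characterizations. An equivalence multiplies `U`, `|D|`, `E` by one common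
positive factor (`RealMoebiusEquiv.invariants`), so quotients homogeneous of degree zero are
invariant. `majorChar` and `minorChar` are such quotients, with the cases (a) and (b) merged by the
minimum and maximum of `E` and `|D|`. They take the prescribed values on the canonical forms, and
every matrix reaches a canonical form (`exists_isCharBCK`), so the characteristic values are well
defined.

Semi-axes. The canonical ranges are a centered ellipse with semi-axes `χ±`, a region touching the
boundary circle at one point, or one asymptotic point. Chord lengths are differences of `artanh`
(`hDist_chordPoint`), whence `s± = artanh χ±`. The harder half is that every admissible choice of
axes gives the same lengths: the smallest enclosing disk is centered at the origin
(`eq_zero_of_disk_bounds`), a band contains one line only, and the many symmetry axes of a horodisk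
are permuted by parabolic isometries. Finally `extArtanh_sqrt_div` turns `artanh` of the quotients
into halved `arcosh`. -/

/-! ### Isometries of the hyperbolic plane induced by Lorentz similarities -/

/-- The Lorentz form `x² + z² - w²`, polarized. -/
def lor (u v : ℝ × ℝ × ℝ) : ℝ := u.1 * v.1 + u.2.1 * v.2.1 - u.2.2 * v.2.2

/-- The vector in the affine plane `w = 1` over a point. -/
def homog (p : ℝ × ℝ) : ℝ × ℝ × ℝ := (p.1, p.2, 1)

/-- The point of the affine plane represented by a vector. -/
noncomputable def dehomog (v : ℝ × ℝ × ℝ) : ℝ × ℝ := (v.1 / v.2.2, v.2.1 / v.2.2)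

/-- The closed unit disk. -/
def closedDisk : Set (ℝ × ℝ) := {p | p.1 ^ 2 + p.2 ^ 2 ≤ 1}

theorem eq_smul_homog {v : ℝ × ℝ × ℝ} (h : v.2.2 ≠ 0) : v = v.2.2 • homog (dehomog v) := by
  ext <;> simp [homog, dehomog] <;> field_simp

theorem dehomog_smul {k : ℝ} (hk : k ≠ 0) (v : ℝ × ℝ × ℝ) : dehomog (k • v) = dehomog v := by
  ext <;> simp [dehomog, mul_div_mul_left _ _ hk]

@[simp] theorem dehomog_homog (p : ℝ × ℝ) : dehomog (homog p) = p := by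
  simp [dehomog, homog]

theorem lor_smul_left (k : ℝ) (u v : ℝ × ℝ × ℝ) : lor (k • u) v = k * lor u v := by
  simp [lor]; ring

theorem lor_smul_right (k : ℝ) (u v : ℝ × ℝ × ℝ) : lor u (k • v) = k * lor u v := by
  simp [lor]; ring

theorem lor_homog (p q : ℝ × ℝ) : lor (homog p) (homog q) = -(1 - p.1 * q.1 - p.2 * q.2) := by
  simp [lor, homog]; ring

theorem lor_homog_self (p : ℝ × ℝ) : lor (homog p) (homog p) = -(1 - p.1 ^ 2 - p.2 ^ 2) := by
  simp [lor, homog]; ring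

theorem mem_closedDisk_iff_lor {p : ℝ × ℝ} : p ∈ closedDisk ↔ lor (homog p) (homog p) ≤ 0 := by
  rw [lor_homog_self]
  constructor
  · intro h
    have : p.1 ^ 2 + p.2 ^ 2 ≤ 1 := h
    linarith
  · intro h
    show p.1 ^ 2 + p.2 ^ 2 ≤ 1
    linarith

theorem dehomog_mem_closedDisk {v : ℝ × ℝ × ℝ} (h : v.2.2 ≠ 0) (hv : lor v v ≤ 0) :
    dehomog v ∈ closedDisk := by
  rw [mem_closedDisk_iff_lor]
  rw [eq_smul_homog h, lor_smul_left, lor_smul_right, ← mul_assoc] at hv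
  have : 0 < v.2.2 * v.2.2 := mul_self_pos.2 h
  by_contra! hc
  nlinarith [mul_pos this hc]

/-- The form is positive definite on the plane `w = 0`. -/
theorem snd_snd_ne_zero_of_lor_nonpos {v : ℝ × ℝ × ℝ} (h : v ≠ 0) (hv : lor v v ≤ 0) :
    v.2.2 ≠ 0 := by
  intro h0
  apply h
  have h1 : v.1 * v.1 + v.2.1 * v.2.1 ≤ 0 := by simpa [lor, h0] using hv
  have a : v.1 = 0 := by nlinarith [mul_self_nonneg v.1, mul_self_nonneg v.2.1]
  have b : v.2.1 = 0 := by nlinarith [mul_self_nonneg v.1, mul_self_nonneg v.2.1]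
  ext <;> simp [a, b, h0]

/-- A linear automorphism of `ℝ³` which scales the Lorentz form by a positive factor and preserves
the forward light cone. -/
structure LorentzSim where
  toEquiv : (ℝ × ℝ × ℝ) ≃ₗ[ℝ] (ℝ × ℝ × ℝ)
  factor : ℝ
  factor_pos : 0 < factor
  lor_map : ∀ u v, lor (toEquiv u) (toEquiv v) = factor * lor u v
  forward : ∀ p ∈ closedDisk, 0 < (toEquiv (homog p)).2.2

namespace LorentzSim

variable (G : LorentzSim)

/-- The inverse of a Lorentz similarity. -/
noncomputable def symm : LorentzSim where
  toEquiv := G.toEquiv.symm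
  factor := G.factor⁻¹
  factor_pos := inv_pos.2 G.factor_pos
  lor_map u v := by
    have h := G.lor_map (G.toEquiv.symm u) (G.toEquiv.symm v)
    simp only [LinearEquiv.apply_symm_apply] at h
    rw [h, inv_mul_cancel_left₀ G.factor_pos.ne']
  forward p hp := by
    set u := G.toEquiv.symm (homog p) with hu
    have hGu : G.toEquiv u = homog p := by simp [hu]
    have h1 : lor u u ≤ 0 := by
      have h := G.lor_map u u
      rw [hGu] at h
      have hp' := mem_closedDisk_iff_lor.1 hp
      rw [h] at hp'
      by_contra! hc
      nlinarith [mul_pos G.factor_pos hc]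
    have h0 : u ≠ 0 := by
      intro h0
      rw [h0, map_zero] at hGu
      have := congrArg (fun v => v.2.2) hGu
      simp [homog] at this
    have h2 := snd_snd_ne_zero_of_lor_nonpos h0 h1
    -- The preimage `u` is a multiple of a vector over a point of the disk, which `G` sends forward;
    -- since `G u` is forward too, the multiple is positive.
    have h3 := G.forward _ (dehomog_mem_closedDisk h2 h1)
    rw [eq_smul_homog h2, map_smul] at hGu
    have h4 := congrArg (fun v => v.2.2) hGu
    simp only [homog, Prod.smul_snd, smul_eq_mul] at h4
    simp only [homog] at h3
    by_contra! hc
    nlinarith [mul_nonneg (neg_nonneg.2 hc) h3.le]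

/-- The induced map of the closed disk. -/
noncomputable def act (p : ℝ × ℝ) : ℝ × ℝ := dehomog (G.toEquiv (homog p))

/-- The homogeneity factor of the induced map. -/
def weight (p : ℝ × ℝ) : ℝ := (G.toEquiv (homog p)).2.2

variable {G}

theorem weight_pos {p : ℝ × ℝ} (hp : p ∈ closedDisk) : 0 < G.weight p := G.forward p hp

theorem apply_homog {p : ℝ × ℝ} (hp : p ∈ closedDisk) :
    G.toEquiv (homog p) = G.weight p • homog (G.act p) :=
  eq_smul_homog (G.forward p hp).ne'

theorem act_eq_of_smul {p q : ℝ × ℝ} {k : ℝ} (hk : k ≠ 0)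
    (h : G.toEquiv (homog p) = k • homog q) : G.act p = q := by
  rw [act, h, dehomog_smul hk, dehomog_homog]

theorem symm_act_act {p : ℝ × ℝ} (hp : p ∈ closedDisk) : G.symm.act (G.act p) = p := by
  apply act_eq_of_smul (k := (G.weight p)⁻¹) (inv_ne_zero (weight_pos hp).ne')
  show G.toEquiv.symm _ = _
  rw [LinearEquiv.symm_apply_eq, map_smul, apply_homog hp, smul_smul,
    inv_mul_cancel₀ (weight_pos hp).ne', one_smul]

theorem symm_symm : G.symm.symm = G := by
  cases G
  simp [symm]

theorem act_symm_act {p : ℝ × ℝ} (hp : p ∈ closedDisk) : G.act (G.symm.act p) = p := by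
  have := symm_act_act (G := G.symm) hp
  rwa [symm_symm] at this

/-- The scaling of the Lorentz form, read in the affine chart `w = 1`. All metric invariance below
comes from this identity. -/
theorem weight_mul_form {p q : ℝ × ℝ} (hp : p ∈ closedDisk) (hq : q ∈ closedDisk) :
    G.weight p * G.weight q * (1 - (G.act p).1 * (G.act q).1 - (G.act p).2 * (G.act q).2) =
      G.factor * (1 - p.1 * q.1 - p.2 * q.2) := by
  have h := G.lor_map (homog p) (homog q)
  rw [apply_homog hp, apply_homog hq, lor_smul_left, lor_smul_right, lor_homog, lor_homog] at h
  linarith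

theorem weight_mul_form_self {p : ℝ × ℝ} (hp : p ∈ closedDisk) :
    G.weight p ^ 2 * (1 - (G.act p).1 ^ 2 - (G.act p).2 ^ 2) =
      G.factor * (1 - p.1 ^ 2 - p.2 ^ 2) := by
  have := weight_mul_form (G := G) hp hp
  simp only [pow_two]
  linarith

theorem form_self_act {p : ℝ × ℝ} (hp : p ∈ closedDisk) :
    1 - (G.act p).1 ^ 2 - (G.act p).2 ^ 2 =
      G.factor / G.weight p ^ 2 * (1 - p.1 ^ 2 - p.2 ^ 2) := by
  have := weight_mul_form_self (G := G) hp
  have hw := weight_pos (G := G) hp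
  field_simp
  linarith

theorem act_mem {p : ℝ × ℝ} (hp : p ∈ closedDisk) : G.act p ∈ closedDisk := by
  have h := form_self_act (G := G) hp
  have h1 : 0 ≤ 1 - p.1 ^ 2 - p.2 ^ 2 := by
    have : p.1 ^ 2 + p.2 ^ 2 ≤ 1 := hp
    linarith
  have h2 : 0 < G.factor / G.weight p ^ 2 :=
    div_pos G.factor_pos (pow_pos (weight_pos hp) 2)
  show (G.act p).1 ^ 2 + (G.act p).2 ^ 2 ≤ 1
  nlinarith [mul_nonneg h2.le h1]

theorem isOrdinary_act {p : ℝ × ℝ} (hp : p ∈ closedDisk) :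
    IsOrdinary (G.act p) ↔ IsOrdinary p := by
  have h := form_self_act (G := G) hp
  have h2 : 0 < G.factor / G.weight p ^ 2 :=
    div_pos G.factor_pos (pow_pos (weight_pos hp) 2)
  have h3 : 0 < 1 - (G.act p).1 ^ 2 - (G.act p).2 ^ 2 ↔ 0 < 1 - p.1 ^ 2 - p.2 ^ 2 := by
    rw [h, mul_pos_iff_of_pos_left h2]
  unfold IsOrdinary
  constructor
  · intro a
    have := h3.1 (by linarith)
    linarith
  · intro a
    have := h3.2 (by linarith)
    linarith

end LorentzSim

theorem isAsymptotic_iff {p : ℝ × ℝ} (hp : p ∈ closedDisk) : IsAsymptotic p ↔ ¬ IsOrdinary p := by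
  have : p.1 ^ 2 + p.2 ^ 2 ≤ 1 := hp
  unfold IsAsymptotic IsOrdinary
  constructor
  · intro h
    linarith
  · intro h
    linarith

theorem IsOrdinary.mem {p : ℝ × ℝ} (hp : IsOrdinary p) : p ∈ closedDisk := le_of_lt hp

theorem IsAsymptotic.mem {p : ℝ × ℝ} (hp : IsAsymptotic p) : p ∈ closedDisk := le_of_eq hp

theorem HLine.carrier_subset (l : HLine) : l.carrier ⊆ closedDisk := fun _ h => h.1

theorem convex_closedDisk : Convex ℝ closedDisk := by
  intro p hp q hq s t hs ht hst
  have h1 : p.1 ^ 2 + p.2 ^ 2 ≤ 1 := hp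
  have h2 : q.1 ^ 2 + q.2 ^ 2 ≤ 1 := hq
  show (s • p + t • q).1 ^ 2 + (s • p + t • q).2 ^ 2 ≤ 1
  simp only [Prod.fst_add, Prod.snd_add, Prod.smul_fst, Prod.smul_snd, smul_eq_mul]
  obtain rfl : t = 1 - s := by linarith
  nlinarith [mul_nonneg hs ht, mul_nonneg (mul_nonneg hs ht) (sq_nonneg (p.1 - q.1)),
    mul_nonneg (mul_nonneg hs ht) (sq_nonneg (p.2 - q.2)),
    mul_le_mul_of_nonneg_left h1 hs, mul_le_mul_of_nonneg_left h2 ht]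

namespace LorentzSim

variable {G : LorentzSim}

theorem isAsymptotic_act {p : ℝ × ℝ} (hp : p ∈ closedDisk) :
    IsAsymptotic (G.act p) ↔ IsAsymptotic p := by
  rw [isAsymptotic_iff hp, isAsymptotic_iff (act_mem hp), isOrdinary_act hp]

theorem act_inj {p q : ℝ × ℝ} (hp : p ∈ closedDisk) (hq : q ∈ closedDisk) :
    G.act p = G.act q ↔ p = q :=
  ⟨fun h => by rw [← symm_act_act (G := G) hp, h, symm_act_act hq], fun h => by rw [h]⟩

/-- The weights and the square root of the similarity factor cancel between the numerator and the
two square roots of the distance formula. -/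
theorem hDist_act {p q : ℝ × ℝ} (hp : p ∈ closedDisk) (hq : q ∈ closedDisk) :
    hDist (G.act p) (G.act q) = hDist p q := by
  suffices key : (1 - (G.act p).1 * (G.act q).1 - (G.act p).2 * (G.act q).2) /
      (√(1 - (G.act p).1 ^ 2 - (G.act p).2 ^ 2) * √(1 - (G.act q).1 ^ 2 - (G.act q).2 ^ 2)) =
      (1 - p.1 * q.1 - p.2 * q.2) / (√(1 - p.1 ^ 2 - p.2 ^ 2) * √(1 - q.1 ^ 2 - q.2 ^ 2)) by
    classical
    unfold hDist
    refine if_congr (act_inj hp hq) rfl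
      (if_congr (and_congr (isOrdinary_act hp) (isOrdinary_act hq)) (by rw [key]) rfl)
  have hwp := weight_pos (G := G) hp
  have hwq := weight_pos (G := G) hq
  have e : 1 - (G.act p).1 * (G.act q).1 - (G.act p).2 * (G.act q).2 =
      G.factor / (G.weight p * G.weight q) * (1 - p.1 * q.1 - p.2 * q.2) := by
    have := weight_mul_form (G := G) hp hq
    field_simp
    linarith
  have hk := G.factor_pos
  have hs : √G.factor ^ 2 = G.factor := Real.sq_sqrt hk.le
  have hs0 : 0 < √G.factor := Real.sqrt_pos.2 hk
  have r : ∀ {x : ℝ × ℝ}, x ∈ closedDisk → √(1 - (G.act x).1 ^ 2 - (G.act x).2 ^ 2) =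
      √G.factor / G.weight x * √(1 - x.1 ^ 2 - x.2 ^ 2) := by
    intro x hx
    have hw := weight_pos (G := G) hx
    rw [form_self_act hx, Real.sqrt_mul (by positivity), Real.sqrt_div hk.le, Real.sqrt_sq hw.le]
  rw [e, r hp, r hq]
  have : G.factor / (G.weight p * G.weight q) =
      (√G.factor / G.weight p) * (√G.factor / G.weight q) := by
    rw [div_mul_div_comm, ← pow_two, hs]
  rw [this, show √G.factor / G.weight p * √(1 - p.1 ^ 2 - p.2 ^ 2) *
    (√G.factor / G.weight q * √(1 - q.1 ^ 2 - q.2 ^ 2)) =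
    (√G.factor / G.weight p) * (√G.factor / G.weight q) *
      (√(1 - p.1 ^ 2 - p.2 ^ 2) * √(1 - q.1 ^ 2 - q.2 ^ 2)) by ring]
  exact mul_div_mul_left _ _ (by positivity)

theorem hLength_image {S : Set (ℝ × ℝ)} (hS : S ⊆ closedDisk) :
    hLength (G.act '' S) = hLength S := by
  unfold hLength
  rw [iSup_image]
  refine iSup_congr fun p => iSup_congr fun hp => ?_
  rw [iSup_image]
  exact iSup_congr fun q => iSup_congr fun hq => hDist_act (hS hp) (hS hq)

theorem symm_image_image {S : Set (ℝ × ℝ)} (hS : S ⊆ closedDisk) :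
    G.symm.act '' (G.act '' S) = S := by
  rw [Set.image_image]
  exact (Set.image_congr fun p hp => symm_act_act (hS hp)).trans (Set.image_id' S)

theorem image_symm_image {S : Set (ℝ × ℝ)} (hS : S ⊆ closedDisk) :
    G.act '' (G.symm.act '' S) = S := by
  have := symm_image_image (G := G.symm) hS
  rwa [symm_symm] at this

theorem image_subset_closedDisk {S : Set (ℝ × ℝ)} (hS : S ⊆ closedDisk) :
    G.act '' S ⊆ closedDisk := by
  rintro _ ⟨p, hp, rfl⟩
  exact act_mem (hS hp)

theorem image_segment_subset {p q : ℝ × ℝ} (hp : p ∈ closedDisk) (hq : q ∈ closedDisk) :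
    G.act '' segment ℝ p q ⊆ segment ℝ (G.act p) (G.act q) := by
  rintro _ ⟨_, ⟨s, t, hs, ht, hst, rfl⟩, rfl⟩
  have hx : s • p + t • q ∈ closedDisk := convex_closedDisk hp hq hs ht hst
  have e : homog (s • p + t • q) = s • homog p + t • homog q := by
    ext <;> simp [homog, hst]
  have hw := weight_pos (G := G) hx
  have hwp := weight_pos (G := G) hp
  have hwq := weight_pos (G := G) hq
  have e2 := apply_homog (G := G) hx
  rw [e, map_add, map_smul, map_smul, apply_homog hp, apply_homog hq] at e2
  have c1 := congrArg (fun v => v.1) e2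
  have c2 := congrArg (fun v => v.2.1) e2
  have c3 := congrArg (fun v => v.2.2) e2
  simp only [homog, Prod.fst_add, Prod.snd_add, Prod.smul_fst, Prod.smul_snd, smul_eq_mul,
    mul_one] at c1 c2 c3
  -- A projective map multiplies barycentric coordinates by the weights of the endpoints; positivity
  -- of the weights keeps the point inside the segment.
  refine ⟨s * G.weight p / G.weight (s • p + t • q), t * G.weight q / G.weight (s • p + t • q),
    by positivity, by positivity, ?_, ?_⟩
  · rw [← add_div, c3, div_self hw.ne']
  · ext
    · simp only [Prod.fst_add, Prod.smul_fst, smul_eq_mul]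
      field_simp
      linarith
    · simp only [Prod.snd_add, Prod.smul_snd, smul_eq_mul]
      field_simp
      linarith

theorem image_segment {p q : ℝ × ℝ} (hp : p ∈ closedDisk) (hq : q ∈ closedDisk) :
    G.act '' segment ℝ p q = segment ℝ (G.act p) (G.act q) := by
  refine (image_segment_subset hp hq).antisymm ?_
  have h := image_segment_subset (G := G.symm) (act_mem (G := G) hp) (act_mem (G := G) hq)
  rw [symm_act_act hp, symm_act_act hq] at h
  have h2 := Set.image_mono (f := G.act) h
  rwa [image_symm_image (convex_closedDisk.segment_subset (act_mem hp) (act_mem hq))] at h2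

theorem hBisector_subset (p q : ℝ × ℝ) : hBisector p q ⊆ closedDisk := fun _ h => h.1.mem

theorem image_hBisector {p q : ℝ × ℝ} (hp : p ∈ closedDisk) (hq : q ∈ closedDisk) :
    G.act '' hBisector p q = hBisector (G.act p) (G.act q) := by
  ext x
  constructor
  · rintro ⟨y, ⟨hy, h⟩, rfl⟩
    exact ⟨(isOrdinary_act hy.mem).2 hy, by rwa [hDist_act hy.mem hp, hDist_act hy.mem hq]⟩
  · rintro ⟨hx, h⟩
    have hx' := act_mem (G := G.symm) hx.mem
    refine ⟨G.symm.act x, ⟨(isOrdinary_act hx.mem).2 hx, ?_⟩, act_symm_act hx.mem⟩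
    rwa [← hDist_act (G := G) hx' hp, ← hDist_act (G := G) hx' hq, act_symm_act hx.mem]

theorem image_hDisk {p q : ℝ × ℝ} (hp : p ∈ closedDisk) (hq : q ∈ closedDisk) :
    G.act '' hDisk p q = hDisk (G.act p) (G.act q) := by
  ext x
  constructor
  · rintro ⟨y, ⟨hy, h⟩, rfl⟩
    exact ⟨(isOrdinary_act hy.mem).2 hy, by rwa [hDist_act hp hy.mem, hDist_act hp hq]⟩
  · rintro ⟨hx, h⟩
    have hx' := act_mem (G := G.symm) hx.mem
    refine ⟨G.symm.act x, ⟨(isOrdinary_act hx.mem).2 hx, ?_⟩, act_symm_act hx.mem⟩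
    rwa [← hDist_act (G := G) hp hx', ← hDist_act (G := G) hp hq, act_symm_act hx.mem]

end LorentzSim

/-! ### Lines and reflections through their Lorentz normals -/

/-- The normal vector of a line. -/
def HLine.normal (l : HLine) : ℝ × ℝ × ℝ := (l.a, l.b, l.c)

theorem HLine.lor_normal_pos (l : HLine) : 0 < lor l.normal l.normal := by
  have := l.meets
  simp only [lor, HLine.normal]
  nlinarith

theorem HLine.mem_carrier_iff (l : HLine) {p : ℝ × ℝ} :
    p ∈ l.carrier ↔ p ∈ closedDisk ∧ lor l.normal (homog p) = 0 := by
  simp [HLine.carrier, closedDisk, lor, HLine.normal, homog, sub_eq_zero]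

theorem HLine.perp_iff (l m : HLine) : l.Perp m ↔ lor l.normal m.normal = 0 := Iff.rfl

/-- The Lorentz reflection. -/
noncomputable def lorReflect (n v : ℝ × ℝ × ℝ) : ℝ × ℝ × ℝ := v - (2 * lor n v / lor n n) • n

theorem HLine.reflect_eq (l : HLine) (p : ℝ × ℝ) :
    l.reflect p = dehomog (lorReflect l.normal (homog p)) := by
  simp [HLine.reflect, dehomog, lorReflect, HLine.normal, homog, lor, pow_two]

theorem lor_lorReflect {n : ℝ × ℝ × ℝ} (hn : lor n n ≠ 0) (v : ℝ × ℝ × ℝ) :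
    lor (lorReflect n v) (lorReflect n v) = lor v v := by
  have : ∀ k : ℝ, lor (v - k • n) (v - k • n) = lor v v - 2 * k * lor n v + k ^ 2 * lor n n := by
    intro k
    simp [lor]
    ring
  rw [lorReflect, this]
  field_simp
  ring

theorem lorReflect_ne_zero {n v : ℝ × ℝ × ℝ} (hn : lor n n ≠ 0) (hv : v ≠ 0) :
    lorReflect n v ≠ 0 := by
  intro h
  have h1 : v = (2 * lor n v / lor n n) • n := sub_eq_zero.1 h
  have h2 : lor n v = 2 * lor n v := by
    nth_rw 1 [h1]
    rw [lor_smul_right]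
    field_simp
  have h3 : lor n v = 0 := by linarith
  rw [h3] at h1
  simp at h1
  exact hv h1

theorem homog_ne_zero (p : ℝ × ℝ) : homog p ≠ 0 := fun h => by
  have := congrArg (fun v => v.2.2) h
  simp [homog] at this

theorem lorReflect_smul (n v : ℝ × ℝ × ℝ) (k : ℝ) :
    lorReflect n (k • v) = k • lorReflect n v := by
  simp only [lorReflect, lor_smul_right, smul_sub, smul_smul]
  congr 2
  ring

theorem HLine.lorReflect_snd_snd_ne_zero (l : HLine) {p : ℝ × ℝ} (hp : p ∈ closedDisk) :
    (lorReflect l.normal (homog p)).2.2 ≠ 0 :=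
  snd_snd_ne_zero_of_lor_nonpos (lorReflect_ne_zero l.lor_normal_pos.ne' (homog_ne_zero p))
    ((lor_lorReflect l.lor_normal_pos.ne' _).trans_le (mem_closedDisk_iff_lor.1 hp))

theorem HLine.isAsymptotic_reflect (l : HLine) {p : ℝ × ℝ} (hp : IsAsymptotic p) :
    IsAsymptotic (l.reflect p) := by
  have h1 := l.lorReflect_snd_snd_ne_zero hp.mem
  have h2 := lor_lorReflect l.lor_normal_pos.ne' (homog p)
  have h3 : p.1 ^ 2 + p.2 ^ 2 = 1 := hp
  rw [eq_smul_homog h1, lor_smul_left, lor_smul_right, ← l.reflect_eq, lor_homog_self,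
    lor_homog_self, show -(1 - p.1 ^ 2 - p.2 ^ 2) = 0 by linarith] at h2
  have h4 := (mul_eq_zero.1 ((mul_eq_zero.1 h2).resolve_left h1)).resolve_left h1
  show (l.reflect p).1 ^ 2 + (l.reflect p).2 ^ 2 = 1
  linarith

namespace LorentzSim

variable (G : LorentzSim)

/-- The image of a line. -/
def mapLine (l : HLine) : HLine where
  a := (G.toEquiv l.normal).1
  b := (G.toEquiv l.normal).2.1
  c := (G.toEquiv l.normal).2.2
  meets := by
    have h := G.lor_map l.normal l.normal
    have h2 := mul_pos G.factor_pos l.lor_normal_pos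
    rw [← h] at h2
    simp only [lor] at h2
    nlinarith

variable {G}

theorem mapLine_normal (l : HLine) : (G.mapLine l).normal = G.toEquiv l.normal := rfl

theorem mapLine_symm_mapLine (l : HLine) : G.mapLine (G.symm.mapLine l) = l := by
  have h : (G.mapLine (G.symm.mapLine l)).normal = l.normal := by
    rw [mapLine_normal, mapLine_normal]
    exact G.toEquiv.apply_symm_apply _
  cases l
  rw [HLine.mk.injEq]
  simpa only [HLine.normal, Prod.mk.injEq] using h

theorem perp_mapLine (l m : HLine) : (G.mapLine l).Perp (G.mapLine m) ↔ l.Perp m := by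
  rw [HLine.perp_iff, HLine.perp_iff, mapLine_normal, mapLine_normal, G.lor_map, mul_eq_zero,
    or_iff_right G.factor_pos.ne']

theorem act_mem_mapLine {l : HLine} {p : ℝ × ℝ} (hp : p ∈ closedDisk) :
    G.act p ∈ (G.mapLine l).carrier ↔ p ∈ l.carrier := by
  rw [HLine.mem_carrier_iff, HLine.mem_carrier_iff, mapLine_normal]
  have h := G.lor_map l.normal (homog p)
  rw [apply_homog hp, lor_smul_right] at h
  simp only [hp, act_mem hp, true_and]
  constructor
  · intro h0
    rw [h0, mul_zero] at h
    exact (mul_eq_zero.1 h.symm).resolve_left G.factor_pos.ne'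
  · intro h0
    rw [h0, mul_zero] at h
    exact (mul_eq_zero.1 h).resolve_left (weight_pos hp).ne'

theorem image_carrier (l : HLine) : G.act '' l.carrier = (G.mapLine l).carrier := by
  ext x
  constructor
  · rintro ⟨y, hy, rfl⟩
    exact (act_mem_mapLine (l.carrier_subset hy)).2 hy
  · intro hx
    have hx' := (G.mapLine l).carrier_subset hx
    refine ⟨G.symm.act x, ?_, act_symm_act hx'⟩
    rw [← act_mem_mapLine (G := G) (act_mem hx'), act_symm_act hx']
    exact hx

theorem image_inter_carrier {K : Set (ℝ × ℝ)} (hK : K ⊆ closedDisk) (l : HLine) :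
    G.act '' (K ∩ l.carrier) = G.act '' K ∩ (G.mapLine l).carrier := by
  rw [← image_carrier]
  exact Set.InjOn.image_inter (s := K) (t := l.carrier) (u := closedDisk)
    (fun p hp q hq h => (act_inj hp hq).1 h) hK l.carrier_subset

/-- The Lorentz reflection involves the form only through a quotient, so the similarity factor drops
out and `G` intertwines the reflections in `l` and in its image. -/
theorem reflect_act (l : HLine) {p : ℝ × ℝ} (hp : p ∈ closedDisk) :
    (G.mapLine l).reflect (G.act p) = G.act (l.reflect p) := by
  have key : ∀ v, G.toEquiv (lorReflect l.normal v) =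
      lorReflect (G.mapLine l).normal (G.toEquiv v) := by
    intro v
    simp only [lorReflect, mapLine_normal, map_sub, map_smul, G.lor_map]
    congr 2
    rw [mul_left_comm, mul_div_mul_left _ _ G.factor_pos.ne']
  have h1 := l.lorReflect_snd_snd_ne_zero hp
  have h2 : G.toEquiv (lorReflect l.normal (homog p)) =
      (lorReflect l.normal (homog p)).2.2 • G.toEquiv (homog (l.reflect p)) := by
    rw [← map_smul, l.reflect_eq, ← eq_smul_homog h1]
  rw [key, apply_homog hp, lorReflect_smul] at h2
  have h3 := congrArg dehomog h2
  rwa [dehomog_smul (weight_pos hp).ne', dehomog_smul h1, ← HLine.reflect_eq] at h3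

theorem isSymmetryAxis_mapLine {K : Set (ℝ × ℝ)} (hK : K ⊆ closedDisk) {l : HLine}
    (hl : l.IsSymmetryAxis K) : (G.mapLine l).IsSymmetryAxis (G.act '' K) := by
  unfold HLine.IsSymmetryAxis at *
  nth_rw 2 [← hl]
  rw [Set.image_image, Set.image_image]
  exact Set.image_congr fun p hp => reflect_act l (hK hp)

/-- Each perpendicular of `l` is mapped to a perpendicular of the image line, with a section of the
same length. Applied to `G.symm`, this also gives the reverse inequality. -/
theorem hWidthAlong_le {K : Set (ℝ × ℝ)} (hK : K ⊆ closedDisk) (l : HLine) :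
    hWidthAlong K l ≤ hWidthAlong (G.act '' K) (G.mapLine l) := by
  refine iSup₂_le fun m hm => ?_
  rw [← hLength_image (G := G) (fun p hp => hK hp.1), image_inter_carrier hK]
  exact le_iSup₂_of_le (G.mapLine m) ((perp_mapLine l m).2 hm) le_rfl

theorem hWidthAlong_image {K : Set (ℝ × ℝ)} (hK : K ⊆ closedDisk) (l : HLine) :
    hWidthAlong (G.act '' K) (G.mapLine l) = hWidthAlong K l := by
  refine le_antisymm ?_ (hWidthAlong_le hK l)
  have h := hWidthAlong_le (G := G.symm) (image_subset_closedDisk (G := G) hK) (G.mapLine l)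
  have e := mapLine_symm_mapLine (G := G.symm) l
  rw [symm_symm] at e
  rwa [symm_image_image hK, e] at h

theorem hasSemiAxes_image {K : Set (ℝ × ℝ)} (hK : K ⊆ closedDisk) {s t : ℝ≥0∞}
    (h : HasSemiAxes K s t) : HasSemiAxes (G.act '' K) s t := by
  cases h with
  | asymptoticPoint P hP hKP =>
    exact .asymptoticPoint (G.act P) ((isAsymptotic_act hP.mem).2 hP) (by rw [hKP]; simp)
  | bounded hord P Q M hPQ hM hMPQ hdisk =>
    have hP := hK (hPQ (left_mem_segment ℝ P Q))
    have hQ := hK (hPQ (right_mem_segment ℝ P Q))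
    have hM' := hK (hPQ hM)
    rw [← hLength_image (G := G) (fun p hp => hK (hPQ hp)), image_segment hP hQ,
      ← hLength_image (G := G) (S := K ∩ hBisector P Q) (fun p hp => hK hp.1),
      Set.InjOn.image_inter (u := closedDisk) (fun p hp q hq h => (act_inj hp hq).1 h) hK
        (hBisector_subset P Q), image_hBisector hP hQ]
    refine .bounded ?_ _ _ (G.act M) ?_ ?_ ?_ ?_
    · rintro _ ⟨p, hp, rfl⟩
      exact (isOrdinary_act (hK hp)).2 (hord p hp)
    · rw [← image_segment hP hQ]
      exact Set.image_mono hPQ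
    · rw [← image_segment hP hQ]
      exact Set.mem_image_of_mem _ hM
    · rwa [hDist_act hM' hP, hDist_act hM' hQ]
    · rw [← image_hDisk hM' hP]
      exact Set.image_mono hdisk
  | twoAsymptotic B C hB hC hBC hBK hCK l hl =>
    rw [← hLength_image (G := G) l.carrier_subset, image_carrier, ← hWidthAlong_image (G := G) hK]
    refine .twoAsymptotic (G.act B) (G.act C) ((isAsymptotic_act hB.mem).2 hB)
      ((isAsymptotic_act hC.mem).2 hC) (fun h => hBC ((act_inj hB.mem hC.mem).1 h))
      (Set.mem_image_of_mem _ hBK) (Set.mem_image_of_mem _ hCK) _ ?_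
    rw [← image_carrier]
    exact Set.image_mono hl
  | oneAsymptotic B hB hBK huniq hne l hl =>
    rw [← hLength_image (G := G) (fun p hp => hK hp.1), image_inter_carrier hK,
      ← hWidthAlong_image (G := G) hK]
    refine .oneAsymptotic (G.act B) ((isAsymptotic_act hB.mem).2 hB) (Set.mem_image_of_mem _ hBK)
      ?_ ?_ _ (isSymmetryAxis_mapLine hK hl)
    · rintro _ ⟨p, hp, rfl⟩ ha
      rw [huniq p hp ((isAsymptotic_act (hK hp)).1 ha)]
    · intro h
      apply hne
      rw [← symm_image_image (G := G) hK, h, Set.image_singleton, symm_act_act hB.mem]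

theorem hasSemiAxes_image_iff {K : Set (ℝ × ℝ)} (hK : K ⊆ closedDisk) {s t : ℝ≥0∞} :
    HasSemiAxes (G.act '' K) s t ↔ HasSemiAxes K s t := by
  refine ⟨fun h => ?_, hasSemiAxes_image hK⟩
  have := hasSemiAxes_image (G := G.symm) (image_subset_closedDisk hK) h
  rwa [symm_image_image hK] at this

end LorentzSim

/-! ### The conformal range and real Möbius transformations -/

/-- The vector whose dehomogenization is the point of the conformal range belonging to `x`, `y`. -/
noncomputable def shellVec (x y : Fin 2 → ℂ) : ℝ × ℝ × ℝ :=
  (2 * (star x ⬝ᵥ y).re, (star y ⬝ᵥ y).re - (star x ⬝ᵥ x).re,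
    (star y ⬝ᵥ y).re + (star x ⬝ᵥ x).re)

theorem star_dotProduct_self_re (x : Fin 2 → ℂ) :
    (star x ⬝ᵥ x).re = ‖x 0‖ ^ 2 + ‖x 1‖ ^ 2 := by
  simp only [dotProduct, Fin.sum_univ_two, Pi.star_apply, Complex.add_re, Complex.sq_norm,
    Complex.normSq_apply, Complex.mul_re, RCLike.star_def, Complex.conj_re, Complex.conj_im]
  ring

theorem mem_conformalRange_iff {A : Matrix (Fin 2) (Fin 2) ℂ} {p : ℝ × ℝ} :
    p ∈ conformalRange A ↔ ∃ x : Fin 2 → ℂ, x ≠ 0 ∧ p = dehomog (shellVec x (A *ᵥ x)) := by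
  have key : ∀ x : EuclideanSpace ℂ (Fin 2),
      (2 * (inner ℂ x (Matrix.toEuclideanLin A x)).re /
        (‖Matrix.toEuclideanLin A x‖ ^ 2 + ‖x‖ ^ 2),
      (‖Matrix.toEuclideanLin A x‖ ^ 2 - ‖x‖ ^ 2) /
        (‖Matrix.toEuclideanLin A x‖ ^ 2 + ‖x‖ ^ 2)) =
      dehomog (shellVec x.ofLp (A *ᵥ x.ofLp)) := by
    intro x
    simp only [dehomog, shellVec, star_dotProduct_self_re, EuclideanSpace.norm_sq_eq,
      Fin.sum_univ_two, EuclideanSpace.inner_eq_star_dotProduct, Matrix.toLpLin_apply,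
      dotProduct_comm (star x.ofLp) (A *ᵥ x.ofLp)]
  constructor
  · rintro ⟨x, y, hx, rfl, rfl⟩
    exact ⟨x.ofLp, fun h => hx (by ext i; simp [h]), key x⟩
  · rintro ⟨x, hx, rfl⟩
    refine ⟨WithLp.toLp 2 x, _, fun h => hx ?_, rfl, (key (WithLp.toLp 2 x)).symm⟩
    have := congrArg WithLp.ofLp h
    simpa using this

theorem shellVec_snd_snd_pos {x y : Fin 2 → ℂ} (hx : x ≠ 0) : 0 < (shellVec x y).2.2 := by
  simp only [shellVec, star_dotProduct_self_re]
  have : 0 < ‖x 0‖ ^ 2 + ‖x 1‖ ^ 2 := by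
    by_contra! h
    apply hx
    have h0 : ‖x 0‖ = 0 := by nlinarith [sq_nonneg ‖x 0‖, sq_nonneg ‖x 1‖]
    have h1 : ‖x 1‖ = 0 := by nlinarith [sq_nonneg ‖x 0‖, sq_nonneg ‖x 1‖]
    ext i
    fin_cases i
    · simpa using h0
    · simpa using h1
  positivity

/-- Cauchy--Schwarz in `ℂ² = ℝ⁴`; the six squares are the `2 × 2` minors in Lagrange's identity. -/
theorem lor_shellVec_nonpos (x y : Fin 2 → ℂ) : lor (shellVec x y) (shellVec x y) ≤ 0 := by
  simp only [lor, shellVec, dotProduct, Fin.sum_univ_two, Pi.star_apply, Complex.add_re,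
    Complex.mul_re, RCLike.star_def, Complex.conj_re, Complex.conj_im]
  nlinarith [sq_nonneg ((x 0).re * (y 0).im - (x 0).im * (y 0).re),
    sq_nonneg ((x 0).re * (y 1).re - (x 1).re * (y 0).re),
    sq_nonneg ((x 0).re * (y 1).im - (x 1).im * (y 0).re),
    sq_nonneg ((x 0).im * (y 1).re - (x 1).re * (y 0).im),
    sq_nonneg ((x 0).im * (y 1).im - (x 1).im * (y 0).im),
    sq_nonneg ((x 1).re * (y 1).im - (x 1).im * (y 1).re)]

theorem conformalRange_subset (A : Matrix (Fin 2) (Fin 2) ℂ) : conformalRange A ⊆ closedDisk := by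
  intro p hp
  obtain ⟨x, hx, rfl⟩ := mem_conformalRange_iff.1 hp
  exact dehomog_mem_closedDisk (shellVec_snd_snd_pos hx).ne' (lor_shellVec_nonpos _ _)

/-- The action of `[a, b; c, d]` on the vectors `shellVec x y`. -/
noncomputable def moebiusFun (a b c d : ℝ) (v : ℝ × ℝ × ℝ) : ℝ × ℝ × ℝ :=
  (a * c * (v.2.2 + v.2.1) + b * d * (v.2.2 - v.2.1) + (a * d + b * c) * v.1,
    (a ^ 2 - c ^ 2) * (v.2.2 + v.2.1) / 2 + (b ^ 2 - d ^ 2) * (v.2.2 - v.2.1) / 2 +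
      (a * b - c * d) * v.1,
    (a ^ 2 + c ^ 2) * (v.2.2 + v.2.1) / 2 + (b ^ 2 + d ^ 2) * (v.2.2 - v.2.1) / 2 +
      (a * b + c * d) * v.1)

/-- The action is quadratic in the matrix (its symmetric square), so the adjugate inverts it up to
the squared determinant. -/
theorem moebiusFun_inverse {a b c d : ℝ} (h : a * d - b * c ≠ 0) (v : ℝ × ℝ × ℝ) :
    ((a * d - b * c) ^ 2)⁻¹ • moebiusFun d (-b) (-c) a (moebiusFun a b c d v) = v := by
  have : moebiusFun d (-b) (-c) a (moebiusFun a b c d v) = (a * d - b * c) ^ 2 • v := by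
    ext <;> simp only [moebiusFun, Prod.smul_fst, Prod.smul_snd, smul_eq_mul] <;> ring
  rw [this, smul_smul, inv_mul_cancel₀ (pow_ne_zero 2 h), one_smul]

theorem moebiusFun_smul (a b c d k : ℝ) (v : ℝ × ℝ × ℝ) :
    moebiusFun a b c d (k • v) = k • moebiusFun a b c d v := by
  ext <;> simp only [moebiusFun, Prod.smul_fst, Prod.smul_snd, smul_eq_mul] <;> ring

/-- The Lorentz similarity induced by a real Möbius transformation. -/
noncomputable def moebiusSim (a b c d : ℝ) (h : a * d - b * c ≠ 0) : LorentzSim where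
  toEquiv :=
    { toFun := moebiusFun a b c d
      map_add' := fun u v => by
        ext <;> simp only [moebiusFun, Prod.fst_add, Prod.snd_add] <;> ring
      map_smul' := fun k v => moebiusFun_smul a b c d k v
      invFun := fun v => ((a * d - b * c) ^ 2)⁻¹ • moebiusFun d (-b) (-c) a v
      left_inv := moebiusFun_inverse h
      right_inv := fun v => by
        have h' : d * a - -b * -c ≠ 0 := by
          convert h using 1
          ring
        have := moebiusFun_inverse h' v
        rw [neg_neg, neg_neg, ← moebiusFun_smul] at this
        rw [show a * d - b * c = d * a - -b * -c by ring]
        exact this }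
  factor := (a * d - b * c) ^ 2
  factor_pos := by positivity
  lor_map u v := by
    show lor (moebiusFun a b c d u) (moebiusFun a b c d v) = _
    simp only [lor, moebiusFun]
    ring
  forward p hp := by
    have h1 : p.1 ^ 2 + p.2 ^ 2 ≤ 1 := hp
    have hd : 0 < (a * d - b * c) ^ 2 := by positivity
    show 0 < (moebiusFun a b c d (homog p)).2.2
    simp only [moebiusFun, homog]
    set α := a ^ 2 + c ^ 2
    set β := b ^ 2 + d ^ 2
    set γ := a * b + c * d
    -- With `(x, z) = p`, twice the last coordinate is `α(1+z) + β(1-z) + 2γx`. Multiplied by `1 +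
    -- z`, with `1 - z² ≥ x²`, it dominates a binary quadratic form in `1 + z` and `x` that this
    -- determinant makes positive definite. The point `z = -1` is treated separately.
    have hdet : α * β - γ ^ 2 = (a * d - b * c) ^ 2 := by ring
    have hαβ : 0 < α * β := by nlinarith [sq_nonneg γ]
    have hα : 0 < α := lt_of_le_of_ne (by positivity) fun h0 => by rw [← h0] at hαβ; simp at hαβ
    have hβ : 0 < β := lt_of_le_of_ne (by positivity) fun h0 => by rw [← h0] at hαβ; simp at hαβ
    have hz : 0 ≤ 1 + p.2 := by nlinarith [sq_nonneg p.1]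
    rcases hz.eq_or_lt with h0 | h0
    · have hp2 : p.2 = -1 := by linarith
      have hp1 : p.1 = 0 := by
        rw [hp2] at h1
        nlinarith [sq_nonneg p.1]
      rw [hp1, hp2]
      linarith
    · have e1 : 0 < α * (1 + p.2) ^ 2 + 2 * γ * (1 + p.2) * p.1 + β * p.1 ^ 2 := by
        have e2 : α * (α * (1 + p.2) ^ 2 + 2 * γ * (1 + p.2) * p.1 + β * p.1 ^ 2) =
            (α * (1 + p.2) + γ * p.1) ^ 2 + (α * β - γ ^ 2) * p.1 ^ 2 := by ring
        refine pos_of_mul_pos_right (a := α) ?_ hα.le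
        rw [e2, hdet]
        by_cases hx : p.1 = 0
        · rw [hx]
          have : 0 < (α * (1 + p.2)) ^ 2 := by positivity
          simpa using this
        · positivity
      refine pos_of_mul_pos_right (a := 1 + p.2) ?_ h0.le
      nlinarith [mul_le_mul_of_nonneg_left h1 hβ.le]

/-- Since the coefficients are real, `|x|²`, `|y|²` and `Re⟨x,y⟩` transform among themselves; the
imaginary part of the inner product never enters. -/
theorem shellVec_moebius (a b c d : ℝ) (x y : Fin 2 → ℂ) :
    shellVec ((c : ℂ) • y + (d : ℂ) • x) ((a : ℂ) • y + (b : ℂ) • x) =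
      moebiusFun a b c d (shellVec x y) := by
  ext <;> simp [moebiusFun, shellVec, dotProduct, Fin.sum_univ_two] <;> ring

theorem shellVec_unitary {V : Matrix (Fin 2) (Fin 2) ℂ} (hV : V ∈ Matrix.unitaryGroup (Fin 2) ℂ)
    (x y : Fin 2 → ℂ) : shellVec (V *ᵥ x) (V *ᵥ y) = shellVec x y := by
  have : ∀ u v : Fin 2 → ℂ, star (V *ᵥ u) ⬝ᵥ (V *ᵥ v) = star u ⬝ᵥ v := by
    intro u v
    rw [star_mulVec, ← dotProduct_mulVec, mulVec_mulVec, ← star_eq_conjTranspose,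
      (Matrix.mem_unitaryGroup_iff').1 hV, one_mulVec]
  simp only [shellVec, this]

/-- Substitute `x = V(cA+d)u` for the test vector: then the image is `V(aA+b)u`, and no inverse is
left in the pair. -/
theorem conformalRange_moebius {A : Matrix (Fin 2) (Fin 2) ℂ} {a b c d : ℝ}
    (h : a * d - b * c ≠ 0) (hdet : ((c : ℂ) • A + (d : ℂ) • 1).det ≠ 0)
    {V : Matrix (Fin 2) (Fin 2) ℂ} (hV : V ∈ Matrix.unitaryGroup (Fin 2) ℂ) :
    conformalRange (V * (((a : ℂ) • A + (b : ℂ) • 1) * ((c : ℂ) • A + (d : ℂ) • 1)⁻¹) * Vᴴ) =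
      (moebiusSim a b c d h).act '' conformalRange A := by
  set N := (c : ℂ) • A + (d : ℂ) • (1 : Matrix (Fin 2) (Fin 2) ℂ) with hN
  set M := (a : ℂ) • A + (b : ℂ) • (1 : Matrix (Fin 2) (Fin 2) ℂ) with hM
  have hNu : IsUnit N.det := hdet.isUnit
  have hVV : Vᴴ * V = 1 := (Matrix.mem_unitaryGroup_iff').1 hV
  have hVV' : V * Vᴴ = 1 := (Matrix.mem_unitaryGroup_iff).1 hV
  have e1 : ∀ u, (V * (M * N⁻¹) * Vᴴ) *ᵥ (V *ᵥ (N *ᵥ u)) = V *ᵥ (M *ᵥ u) := by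
    intro u
    simp only [mulVec_mulVec]
    congr 1
    calc V * (M * N⁻¹) * Vᴴ * (V * N) = V * M * (N⁻¹ * ((Vᴴ * V) * N)) := by
          simp only [Matrix.mul_assoc]
      _ = V * M := by rw [hVV, Matrix.one_mul, Matrix.nonsing_inv_mul _ hNu, Matrix.mul_one]
  have e2 : ∀ u, shellVec (V *ᵥ (N *ᵥ u)) ((V * (M * N⁻¹) * Vᴴ) *ᵥ (V *ᵥ (N *ᵥ u))) =
      moebiusFun a b c d (shellVec u (A *ᵥ u)) := by
    intro u
    rw [e1, shellVec_unitary hV, ← shellVec_moebius, hN, hM]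
    simp only [add_mulVec, smul_mulVec, one_mulVec]
  have e3 : ∀ u : Fin 2 → ℂ, u ≠ 0 →
      (moebiusSim a b c d h).act (dehomog (shellVec u (A *ᵥ u))) =
        dehomog (moebiusFun a b c d (shellVec u (A *ᵥ u))) := by
    intro u hu
    have hp := shellVec_snd_snd_pos (y := A *ᵥ u) hu
    conv_rhs => rw [eq_smul_homog hp.ne', moebiusFun_smul, dehomog_smul hp.ne']
    rfl
  ext p
  rw [mem_conformalRange_iff]
  constructor
  · rintro ⟨x, hx, rfl⟩
    have hxu : V *ᵥ (N *ᵥ (N⁻¹ *ᵥ (Vᴴ *ᵥ x))) = x := by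
      simp only [mulVec_mulVec]
      rw [Matrix.mul_nonsing_inv_cancel_left _ _ hNu, hVV', one_mulVec]
    have hu : N⁻¹ *ᵥ (Vᴴ *ᵥ x) ≠ 0 := by
      intro h0
      rw [h0, mulVec_zero, mulVec_zero] at hxu
      exact hx hxu.symm
    refine ⟨_, mem_conformalRange_iff.2 ⟨_, hu, rfl⟩, ?_⟩
    rw [e3 _ hu, ← e2, hxu]
  · rintro ⟨_, hq, rfl⟩
    obtain ⟨u, hu, rfl⟩ := mem_conformalRange_iff.1 hq
    refine ⟨V *ᵥ (N *ᵥ u), fun h0 => hu ?_, ?_⟩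
    · have : N⁻¹ *ᵥ (Vᴴ *ᵥ (V *ᵥ (N *ᵥ u))) = u := by
        simp only [mulVec_mulVec]
        rw [← Matrix.mul_assoc Vᴴ, hVV, Matrix.one_mul, Matrix.nonsing_inv_mul _ hNu, one_mulVec]
      rw [← this, h0, mulVec_zero, mulVec_zero]
    · rw [e2, e3 u hu]

theorem RealMoebiusEquiv.exists_image {A B : Matrix (Fin 2) (Fin 2) ℂ} (h : RealMoebiusEquiv A B) :
    ∃ G : LorentzSim, conformalRange B = G.act '' conformalRange A := by
  obtain ⟨a, b, c, d, h, hdet, V, hV, rfl⟩ := h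
  exact ⟨_, conformalRange_moebius h hdet hV⟩

theorem RealMoebiusEquiv.hasSemiAxes_iff {A B : Matrix (Fin 2) (Fin 2) ℂ}
    (h : RealMoebiusEquiv A B) {s t : ℝ≥0∞} :
    HasSemiAxes (conformalRange B) s t ↔ HasSemiAxes (conformalRange A) s t := by
  obtain ⟨G, hG⟩ := h.exists_image
  rw [hG, LorentzSim.hasSemiAxes_image_iff (conformalRange_subset A)]

/-! ### Invariants -/

theorem eigenvaluesAre_iff {A : Matrix (Fin 2) (Fin 2) ℂ} {x y : ℂ} :
    EigenvaluesAre A x y ↔ A.trace = x + y ∧ A.det = x * y := by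
  have hprod : (Polynomial.X - Polynomial.C x) * (Polynomial.X - Polynomial.C y) =
      Polynomial.X ^ 2 - Polynomial.C (x + y) * Polynomial.X + Polynomial.C (x * y) := by
    simp only [map_add, map_mul]
    ring
  unfold EigenvaluesAre
  constructor
  · intro h
    have hs : A.charpoly.Splits := IsAlgClosed.splits _
    have h1 := hs.eq_prod_roots_of_monic A.charpoly_monic
    rw [h] at h1
    simp only [Multiset.insert_eq_cons, Multiset.map_cons, Multiset.map_singleton,
      Multiset.prod_cons, Multiset.prod_singleton] at h1
    rw [hprod, Matrix.charpoly_fin_two] at h1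
    have c0 := congrArg (fun p => Polynomial.coeff p 0) h1
    have c1 := congrArg (fun p => Polynomial.coeff p 1) h1
    simp [Polynomial.coeff_X_pow] at c0 c1
    exact ⟨by linear_combination -c1, c0⟩
  · rintro ⟨h1, h2⟩
    rw [Matrix.charpoly_fin_two, h1, h2, ← hprod, Polynomial.roots_mul, Polynomial.roots_X_sub_C,
      Polynomial.roots_X_sub_C]
    · rfl
    · exact mul_ne_zero (Polynomial.X_sub_C_ne_zero _) (Polynomial.X_sub_C_ne_zero _)

theorem EigenvaluesAre.symm {A : Matrix (Fin 2) (Fin 2) ℂ} {x y : ℂ} (h : EigenvaluesAre A x y) :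
    EigenvaluesAre A y x := by
  rw [eigenvaluesAre_iff] at *
  rwa [add_comm, mul_comm]

theorem exists_eigenvaluesAre (A : Matrix (Fin 2) (Fin 2) ℂ) : ∃ x y, EigenvaluesAre A x y := by
  obtain ⟨r, hr⟩ := IsAlgClosed.exists_pow_nat_eq (-discD A) two_pos
  refine ⟨A.trace / 2 + r, A.trace / 2 - r, eigenvaluesAre_iff.2 ⟨by ring, ?_⟩⟩
  unfold discD at hr
  linear_combination hr

theorem EigenvaluesAre.discD_eq {A : Matrix (Fin 2) (Fin 2) ℂ} {x y : ℂ}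
    (h : EigenvaluesAre A x y) : discD A = -((x - y) / 2) ^ 2 := by
  obtain ⟨h1, h2⟩ := eigenvaluesAre_iff.1 h
  rw [discD, h1, h2]
  ring

theorem EigenvaluesAre.norm_discD {A : Matrix (Fin 2) (Fin 2) ℂ} {x y : ℂ}
    (h : EigenvaluesAre A x y) : ‖discD A‖ = ((x.re - y.re) ^ 2 + (x.im - y.im) ^ 2) / 4 := by
  rw [h.discD_eq, norm_neg, norm_pow, Complex.sq_norm, Complex.normSq_apply]
  have e1 : ((x - y) / 2).re = (x.re - y.re) / 2 := by simp
  have e2 : ((x - y) / 2).im = (x.im - y.im) / 2 := by simp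
  rw [e1, e2]
  ring

/-- As `D = -((x-y)/2)²`, the term `(|D| - Re D)/2` is the square of `Re (x-y)/2`. It cancels
against the same square in `|D|`, and a difference of squares of imaginary parts remains. -/
theorem EigenvaluesAre.discE_sub {A : Matrix (Fin 2) (Fin 2) ℂ} {x y : ℂ}
    (h : EigenvaluesAre A x y) : discE A - ‖discD A‖ = x.im * y.im := by
  have hr : (discD A).re = -((x.re - y.re) ^ 2 - (x.im - y.im) ^ 2) / 4 := by
    rw [h.discD_eq, pow_two, Complex.neg_re, Complex.mul_re]
    have e1 : ((x - y) / 2).re = (x.re - y.re) / 2 := by simp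
    have e2 : ((x - y) / 2).im = (x.im - y.im) / 2 := by simp
    rw [e1, e2]
    ring
  rw [discE, h.norm_discD, hr, (eigenvaluesAre_iff.1 h).1, Complex.add_im]
  ring

theorem discE_lt_iff (A : Matrix (Fin 2) (Fin 2) ℂ) :
    discE A < ‖discD A‖ ↔ IsRealElliptic A ∨ IsQuasielliptic A := by
  constructor
  · intro hlt
    obtain ⟨x, y, h⟩ := exists_eigenvaluesAre A
    have h1 := h.discE_sub
    have h2 : x.im * y.im < 0 := by linarith
    by_cases hxy : y = conj x
    · left
      refine ⟨x, fun h0 => ?_, hxy ▸ h⟩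
      rw [h0, zero_mul] at h2
      exact lt_irrefl _ h2
    · exact Or.inr ⟨x, y, hxy, h2, h⟩
  · rintro (⟨x, hx, h⟩ | ⟨x, y, _, hxy, h⟩)
    · have h1 := h.discE_sub
      rw [Complex.conj_im] at h1
      nlinarith [mul_self_pos.2 hx]
    · have := h.discE_sub
      linarith

theorem lt_discE_iff (A : Matrix (Fin 2) (Fin 2) ℂ) :
    ‖discD A‖ < discE A ↔ IsNonrealParabolic A ∨ IsQuasihyperbolic A := by
  constructor
  · intro hlt
    obtain ⟨x, y, h⟩ := exists_eigenvaluesAre A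
    have h1 := h.discE_sub
    have h2 : 0 < x.im * y.im := by linarith
    by_cases hxy : x = y
    · left
      subst hxy
      exact ⟨x, mul_self_pos.1 h2, h⟩
    · exact Or.inr ⟨x, y, hxy, h2, h⟩
  · rintro (⟨x, hx, h⟩ | ⟨x, y, _, hxy, h⟩)
    · have h1 := h.discE_sub
      have := mul_self_pos.2 hx
      linarith
    · have := h.discE_sub
      linarith

theorem exists_ofReal_of_im_eq_zero {x : ℂ} (h : x.im = 0) : ∃ r : ℝ, x = r :=
  ⟨x.re, by apply Complex.ext <;> simp [h]⟩

theorem discE_eq_iff (A : Matrix (Fin 2) (Fin 2) ℂ) :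
    discE A = ‖discD A‖ ↔ IsRealParabolic A ∨ IsRealHyperbolic A ∨ IsSemiRealType A := by
  constructor
  · intro heq
    obtain ⟨x, y, h⟩ := exists_eigenvaluesAre A
    have h1 := h.discE_sub
    rw [heq, sub_self, eq_comm, mul_eq_zero] at h1
    wlog hx : x.im = 0 generalizing x y
    · exact this y x h.symm h1.symm (h1.resolve_left hx)
    obtain ⟨r, rfl⟩ := exists_ofReal_of_im_eq_zero hx
    by_cases hy : y.im = 0
    · obtain ⟨s, rfl⟩ := exists_ofReal_of_im_eq_zero hy
      by_cases hrs : r = s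
      · subst hrs
        exact Or.inl ⟨r, h⟩
      · exact Or.inr (Or.inl ⟨r, s, hrs, h⟩)
    · exact Or.inr (Or.inr ⟨r, y, hy, h⟩)
  · rintro (⟨x, h⟩ | ⟨x, y, _, h⟩ | ⟨x, y, _, h⟩) <;>
    · have h1 := h.discE_sub
      rw [Complex.ofReal_im] at h1
      linarith

/-- `U` is half the squared Frobenius norm of the traceless part of the matrix. -/
theorem discU_smul_add (A : Matrix (Fin 2) (Fin 2) ℂ) (k l : ℂ) :
    discU (k • A + l • 1) = ‖k‖ ^ 2 * discU A := by
  simp only [discU, Complex.sq_norm, Complex.normSq_apply, Matrix.trace_fin_two, Matrix.mul_apply,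
    Fin.sum_univ_two, Matrix.conjTranspose_apply, Matrix.add_apply, Matrix.smul_apply,
    Matrix.one_apply, smul_eq_mul, RCLike.star_def, Complex.add_re, Complex.add_im,
    Complex.mul_re, Complex.mul_im, Complex.conj_re, Complex.conj_im]
  simp
  ring

theorem discU_conj {V : Matrix (Fin 2) (Fin 2) ℂ} (hV : V ∈ Matrix.unitaryGroup (Fin 2) ℂ)
    (A : Matrix (Fin 2) (Fin 2) ℂ) : discU (V * A * Vᴴ) = discU A := by
  have hVV : Vᴴ * V = 1 := (Matrix.mem_unitaryGroup_iff').1 hV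
  have e : (V * A * Vᴴ)ᴴ * (V * A * Vᴴ) = V * (Aᴴ * A) * Vᴴ := by
    simp only [conjTranspose_mul, conjTranspose_conjTranspose]
    calc V * (Aᴴ * Vᴴ) * (V * A * Vᴴ) = V * (Aᴴ * ((Vᴴ * V) * A)) * Vᴴ := by
          simp only [Matrix.mul_assoc]
      _ = _ := by rw [hVV, Matrix.one_mul]
  have t : ∀ B : Matrix (Fin 2) (Fin 2) ℂ, (V * B * Vᴴ).trace = B.trace := by
    intro B
    rw [Matrix.trace_mul_comm, ← Matrix.mul_assoc, hVV, Matrix.one_mul]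
  rw [discU, discU, e, t, t]

theorem EigenvaluesAre.conj_unitary {V : Matrix (Fin 2) (Fin 2) ℂ}
    (hV : V ∈ Matrix.unitaryGroup (Fin 2) ℂ) {A : Matrix (Fin 2) (Fin 2) ℂ} {x y : ℂ}
    (h : EigenvaluesAre A x y) : EigenvaluesAre (V * A * Vᴴ) x y := by
  have hVV : Vᴴ * V = 1 := (Matrix.mem_unitaryGroup_iff').1 hV
  have hd : Vᴴ.det * V.det = 1 := by rw [← Matrix.det_mul, hVV, Matrix.det_one]
  rw [eigenvaluesAre_iff] at *
  refine ⟨?_, ?_⟩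
  · rw [Matrix.trace_mul_comm, ← Matrix.mul_assoc, hVV, Matrix.one_mul, h.1]
  · rw [Matrix.det_mul, Matrix.det_mul, ← h.2]
    linear_combination A.det * hd

theorem det_smul_add_smul_one {A : Matrix (Fin 2) (Fin 2) ℂ} {x y : ℂ} (h : EigenvaluesAre A x y)
    (c d : ℂ) : (c • A + d • 1).det = (c * x + d) * (c * y + d) := by
  obtain ⟨h1, h2⟩ := eigenvaluesAre_iff.1 h
  rw [Matrix.trace_fin_two] at h1
  rw [Matrix.det_fin_two] at *
  simp
  linear_combination c ^ 2 * h2 + c * d * h1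

/-- By Cayley--Hamilton a fractional linear function of a `2 × 2` matrix is an affine function of
it; the coefficients interpolate at the eigenvalues. -/
theorem moebius_eq_affine {A : Matrix (Fin 2) (Fin 2) ℂ} {x y : ℂ} (h : EigenvaluesAre A x y)
    (a b c d : ℂ) (hdet : (c * x + d) * (c * y + d) ≠ 0) :
    (a • A + b • 1) * (c • A + d • 1)⁻¹ =
      ((a * d - b * c) / ((c * x + d) * (c * y + d))) • A +
        ((a * c * (x * y) + b * c * (x + y) + b * d) / ((c * x + d) * (c * y + d))) • 1 := by
  have hu : IsUnit (c • A + d • (1 : Matrix (Fin 2) (Fin 2) ℂ)).det := by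
    rw [det_smul_add_smul_one h]
    exact hdet.isUnit
  have hch : A * A = (x + y) • A - (x * y) • 1 := by
    obtain ⟨h1, h2⟩ := eigenvaluesAre_iff.1 h
    rw [← h1, ← h2, Matrix.trace_fin_two, Matrix.det_fin_two]
    ext i j
    fin_cases i <;> fin_cases j <;> simp [Matrix.mul_apply, Fin.sum_univ_two] <;> ring
  set δ := (c * x + d) * (c * y + d) with hδ
  suffices h1 : a • A + b • (1 : Matrix (Fin 2) (Fin 2) ℂ) = (((a * d - b * c) / δ) • A +
      ((a * c * (x * y) + b * c * (x + y) + b * d) / δ) • 1) * (c • A + d • 1) by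
    rw [h1, Matrix.mul_nonsing_inv_cancel_right _ _ hu]
  simp only [add_mul, mul_add, smul_mul_assoc, mul_smul_comm, Matrix.mul_one, Matrix.one_mul, hch,
    smul_smul, smul_sub]
  have e : ∀ p q r s : ℂ, p = r → q = s → p • A + q • (1 : Matrix (Fin 2) (Fin 2) ℂ) =
      r • A + s • 1 := by
    rintro p q _ _ rfl rfl
    rfl
  trans (((a * d - b * c) / δ * c * (x + y) + (a * d - b * c) / δ * d +
      (a * c * (x * y) + b * c * (x + y) + b * d) / δ * c)) • A +
      ((a * c * (x * y) + b * c * (x + y) + b * d) / δ * d -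
        (a * d - b * c) / δ * c * (x * y)) • 1
  · apply e
    · field_simp
      rw [hδ]
      ring
    · field_simp
      rw [hδ]
      ring
  · module

theorem EigenvaluesAre.smul_add {A : Matrix (Fin 2) (Fin 2) ℂ} {x y : ℂ}
    (h : EigenvaluesAre A x y) (k l : ℂ) :
    EigenvaluesAre (k • A + l • 1) (k * x + l) (k * y + l) := by
  have hd := det_smul_add_smul_one h k l
  rw [eigenvaluesAre_iff] at *
  refine ⟨?_, hd⟩
  rw [Matrix.trace_add, Matrix.trace_smul, Matrix.trace_smul, h.1, Matrix.trace_one]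
  simp
  ring

theorem EigenvaluesAre.moebius {A : Matrix (Fin 2) (Fin 2) ℂ} {x y : ℂ}
    (h : EigenvaluesAre A x y) (a b c d : ℂ) (hx : c * x + d ≠ 0) (hy : c * y + d ≠ 0) :
    EigenvaluesAre ((a • A + b • 1) * (c • A + d • 1)⁻¹)
      ((a * x + b) / (c * x + d)) ((a * y + b) / (c * y + d)) := by
  rw [moebius_eq_affine h a b c d (mul_ne_zero hx hy)]
  convert h.smul_add _ _ using 1
  · field_simp
    ring
  · field_simp
    ring

theorem im_moebius (a b c d : ℝ) (z : ℂ) :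
    (((a : ℂ) * z + b) / (c * z + d)).im =
      (a * d - b * c) / ‖(c : ℂ) * z + d‖ ^ 2 * z.im := by
  rw [Complex.div_im, Complex.sq_norm]
  simp
  ring

/-- The common factor is `(ad-bc)² / |(cx+d)(cy+d)|²`: the squared modulus of the linear coefficient
of `moebius_eq_affine` for `U`, the squared ratio of eigenvalue differences for `|D|`, and the
product of the scalings of the two imaginary parts for `E - |D|`. -/
theorem RealMoebiusEquiv.invariants {A B : Matrix (Fin 2) (Fin 2) ℂ}
    (h : RealMoebiusEquiv A B) : ∃ μ : ℝ, 0 < μ ∧ discU B = μ * discU A ∧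
      ‖discD B‖ = μ * ‖discD A‖ ∧ discE B = μ * discE A := by
  obtain ⟨a, b, c, d, hΔ, hdet, V, hV, rfl⟩ := h
  obtain ⟨x, y, h⟩ := exists_eigenvaluesAre A
  rw [det_smul_add_smul_one h] at hdet
  have hx := left_ne_zero_of_mul hdet
  have hy := right_ne_zero_of_mul hdet
  have hB := (h.moebius a b c d hx hy).conj_unitary hV
  have nx : 0 < ‖(c : ℂ) * x + d‖ := norm_pos_iff.2 hx
  have ny : 0 < ‖(c : ℂ) * y + d‖ := norm_pos_iff.2 hy
  have hD : ‖discD (V * (((a : ℂ) • A + (b : ℂ) • 1) * ((c : ℂ) • A + (d : ℂ) • 1)⁻¹) * Vᴴ)‖ =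
      (a * d - b * c) ^ 2 / (‖(c : ℂ) * x + d‖ * ‖(c : ℂ) * y + d‖) ^ 2 * ‖discD A‖ := by
    have e : ((a : ℂ) * x + b) / (c * x + d) - (a * y + b) / (c * y + d) =
        ((a * d - b * c : ℝ) : ℂ) / ((c * x + d) * (c * y + d)) * (x - y) := by
      push_cast
      rw [div_sub_div _ _ hx hy, div_mul_eq_mul_div]
      congr 1
      ring
    rw [hB.discD_eq, h.discD_eq, e]
    simp only [norm_neg, norm_pow, norm_div, norm_mul, Complex.norm_real, Real.norm_eq_abs]
    rw [div_pow, mul_pow, div_pow, sq_abs]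
    ring
  refine ⟨(a * d - b * c) ^ 2 / (‖(c : ℂ) * x + d‖ * ‖(c : ℂ) * y + d‖) ^ 2, by positivity,
    ?_, hD, ?_⟩
  · rw [discU_conj hV, moebius_eq_affine h _ _ _ _ hdet, discU_smul_add]
    congr 1
    rw [norm_div, div_pow, norm_mul]
    congr 1
    rw [show (a : ℂ) * d - b * c = ((a * d - b * c : ℝ) : ℂ) by push_cast; rfl, Complex.norm_real,
      Real.norm_eq_abs, sq_abs]
  · have h1 := hB.discE_sub
    have h2 := h.discE_sub
    rw [im_moebius, im_moebius, hD] at h1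
    have h3 : discE A = ‖discD A‖ + x.im * y.im := by linarith
    rw [eq_add_of_sub_eq h1, h3]
    field_simp
    ring

/-! ### Canonical forms -/

/-- Schur triangularization with prescribed order of the eigenvalues. The free phase of the second
basis vector makes the corner entry nonnegative. -/
theorem exists_unitary_triangular {A : Matrix (Fin 2) (Fin 2) ℂ} {x y : ℂ}
    (h : EigenvaluesAre A x y) :
    ∃ V ∈ Matrix.unitaryGroup (Fin 2) ℂ, ∃ τ : ℝ, 0 ≤ τ ∧ V * A * Vᴴ = !![x, (τ : ℂ); 0, y] := by
  obtain ⟨h1, h2⟩ := eigenvaluesAre_iff.1 h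
  have hdet : (A - x • (1 : Matrix (Fin 2) (Fin 2) ℂ)).det = 0 := by
    have := det_smul_add_smul_one h 1 (-x)
    rw [one_smul, neg_smul, ← sub_eq_add_neg] at this
    rw [this]
    ring
  obtain ⟨v, hv0, hv⟩ := Matrix.exists_mulVec_eq_zero_iff.2 hdet
  have hn : 0 < ‖v 0‖ ^ 2 + ‖v 1‖ ^ 2 := by
    by_contra! hc
    apply hv0
    have e0 : ‖v 0‖ = 0 := by nlinarith [sq_nonneg ‖v 0‖, sq_nonneg ‖v 1‖]
    have e1 : ‖v 1‖ = 0 := by nlinarith [sq_nonneg ‖v 0‖, sq_nonneg ‖v 1‖]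
    ext i
    fin_cases i
    · simpa using e0
    · simpa using e1
  set N : ℝ := √(‖v 0‖ ^ 2 + ‖v 1‖ ^ 2) with hN
  have hN0 : (N : ℂ) ≠ 0 := by
    rw [Complex.ofReal_ne_zero]
    exact (Real.sqrt_pos.2 hn).ne'
  have hNN : (N : ℂ) ^ 2 = conj (v 0) * v 0 + conj (v 1) * v 1 := by
    rw [← Complex.ofReal_pow, hN, Real.sq_sqrt hn.le, ← Complex.normSq_eq_conj_mul_self,
      ← Complex.normSq_eq_conj_mul_self, Complex.normSq_eq_norm_sq, Complex.normSq_eq_norm_sq]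
    push_cast
    rfl
  obtain ⟨p, hp⟩ : ∃ p, p = v 0 / N := ⟨_, rfl⟩
  obtain ⟨q, hq⟩ : ∃ q, q = v 1 / N := ⟨_, rfl⟩
  have hunit : conj p * p + conj q * q = 1 := by
    rw [hp, hq, map_div₀, map_div₀, Complex.conj_ofReal]
    field_simp
    rw [hNN]
  have hv' := congrFun hv 0
  have hv'' := congrFun hv 1
  simp [Matrix.mulVec, dotProduct, Fin.sum_univ_two] at hv' hv''
  have ev0 : A 0 0 * p + A 0 1 * q = x * p := by
    rw [hp, hq]
    field_simp
    linear_combination hv'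
  have ev1 : A 1 0 * p + A 1 1 * q = x * q := by
    rw [hp, hq]
    field_simp
    linear_combination hv''
  -- The corner entry in the basis `(p, q)`, `(-conj q, conj p)`, before the phase `ω` is applied.
  obtain ⟨z, hz⟩ : ∃ z, z = conj p * (A 0 0 * (-conj q) + A 0 1 * conj p) +
    conj q * (A 1 0 * (-conj q) + A 1 1 * conj p) := ⟨_, rfl⟩
  obtain ⟨ω, hω, hzω⟩ : ∃ ω : ℂ, conj ω * ω = 1 ∧ z * ω = (‖z‖ : ℂ) := by
    by_cases hz0 : z = 0
    · exact ⟨1, by simp, by simp [hz0]⟩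
    · have hz1 : (‖z‖ : ℂ) ≠ 0 := by simpa using hz0
      have hzz : conj z * z = (‖z‖ : ℂ) ^ 2 := by
        rw [← Complex.normSq_eq_conj_mul_self, Complex.normSq_eq_norm_sq]
        push_cast
        rfl
      refine ⟨conj z / ‖z‖, ?_, ?_⟩
      · rw [map_div₀, Complex.conj_ofReal, Complex.conj_conj]
        field_simp
        rw [← hzz]
        ring
      · field_simp
        rw [← hzz]
        ring
  have htr : A 0 0 + A 1 1 = x + y := by rw [← h1, Matrix.trace_fin_two]
  refine ⟨!![conj p, conj q; -q * conj ω, p * conj ω], ?_, ‖z‖, norm_nonneg _, ?_⟩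
  · rw [Matrix.mem_unitaryGroup_iff]
    ext i j
    fin_cases i <;> fin_cases j <;>
      simp [Matrix.mul_apply, Fin.sum_univ_two, Matrix.star_apply]
    · linear_combination hunit
    · ring
    · ring
    · linear_combination (conj ω * ω) * hunit + hω
  · have hct : (!![conj p, conj q; -q * conj ω, p * conj ω] : Matrix (Fin 2) (Fin 2) ℂ)ᴴ =
        !![p, -conj q * ω; q, conj p * ω] := by
      ext i j
      fin_cases i <;> fin_cases j <;> simp [Matrix.conjTranspose_apply]
    rw [hct]
    ext i j
    fin_cases i <;> fin_cases j <;>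
      simp [Matrix.mul_apply, Fin.sum_univ_two, Matrix.vecMul, dotProduct]
    · linear_combination conj p * ev0 + conj q * ev1 + x * hunit
    · rw [← hzω, hz]
      ring
    · linear_combination (-q * conj ω) * ev0 + (p * conj ω) * ev1
    · linear_combination (conj ω * ω) * (conj p * p + conj q * q) * htr +
        (-conj ω * ω) * (conj p * ev0 + conj q * ev1) + y * (conj ω * ω * hunit + hω)

theorem eigenvaluesAre_triangular (x y z : ℂ) : EigenvaluesAre !![x, z; 0, y] x y := by
  rw [eigenvaluesAre_iff]
  simp

/-- `U - |D|` measures the departure from normality; in particular it is nonnegative. -/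
theorem discU_triangular (x y : ℂ) (τ : ℝ) :
    discU !![x, (τ : ℂ); 0, y] = ‖discD !![x, (τ : ℂ); 0, y]‖ + τ ^ 2 / 2 := by
  rw [(eigenvaluesAre_triangular x y τ).norm_discD]
  simp only [discU, Complex.sq_norm, Complex.normSq_apply, Matrix.trace_fin_two, Matrix.mul_apply,
    Fin.sum_univ_two, Matrix.conjTranspose_apply]
  simp
  ring

theorem norm_discD_le_discU (A : Matrix (Fin 2) (Fin 2) ℂ) : ‖discD A‖ ≤ discU A := by
  obtain ⟨x, y, h⟩ := exists_eigenvaluesAre A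
  obtain ⟨V, hV, τ, hτ, e⟩ := exists_unitary_triangular h
  have h1 := discU_triangular x y τ
  rw [← e, discU_conj hV, (h.conj_unitary hV).norm_discD, ← h.norm_discD] at h1
  rw [h1]
  linarith [sq_nonneg τ]

theorem discE_nonneg (A : Matrix (Fin 2) (Fin 2) ℂ) : 0 ≤ discE A := by
  have := Complex.re_le_norm (discD A)
  unfold discE
  positivity [sub_nonneg.2 this]

theorem isRealScalar_iff (A : Matrix (Fin 2) (Fin 2) ℂ) :
    IsRealScalar A ↔ discU A = 0 ∧ discE A = 0 := by
  constructor
  · rintro ⟨r, rfl⟩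
    have hU : discU ((r : ℂ) • (1 : Matrix (Fin 2) (Fin 2) ℂ)) = 0 := by
      have := discU_smul_add 0 0 (r : ℂ)
      simpa using this
    have hD : discD ((r : ℂ) • (1 : Matrix (Fin 2) (Fin 2) ℂ)) = 0 := by
      have h1 := norm_discD_le_discU ((r : ℂ) • (1 : Matrix (Fin 2) (Fin 2) ℂ))
      rw [hU] at h1
      exact norm_le_zero_iff.1 h1
    refine ⟨hU, ?_⟩
    rw [discE, hD]
    simp
  · rintro ⟨hU, hE⟩
    have hD : discD A = 0 := norm_le_zero_iff.1 ((norm_discD_le_discU A).trans_eq hU)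
    have ht : A.trace.im = 0 := by
      rw [discE, hD] at hE
      simpa using hE
    have e : discU A = (‖A 0 0 - A 1 1‖ ^ 2 / 2 + ‖A 0 1‖ ^ 2 + ‖A 1 0‖ ^ 2) / 2 := by
      simp only [discU, Complex.sq_norm, Complex.normSq_apply, Matrix.trace_fin_two,
        Matrix.mul_apply, Fin.sum_univ_two, Matrix.conjTranspose_apply]
      simp
      ring
    have n0 := sq_nonneg ‖A 0 0 - A 1 1‖
    have n1 := sq_nonneg ‖A 0 1‖
    have n2 := sq_nonneg ‖A 1 0‖
    have z0 : A 0 0 - A 1 1 = 0 := norm_eq_zero.1 (pow_eq_zero_iff two_ne_zero |>.1 (by linarith))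
    have z1 : A 0 1 = 0 := norm_eq_zero.1 (pow_eq_zero_iff two_ne_zero |>.1 (by linarith))
    have z2 : A 1 0 = 0 := norm_eq_zero.1 (pow_eq_zero_iff two_ne_zero |>.1 (by linarith))
    rw [Matrix.trace_fin_two, ← sub_eq_zero.1 z0] at ht
    obtain ⟨r, hr⟩ := exists_ofReal_of_im_eq_zero (x := A 0 0) (by
      rw [Complex.add_im] at ht
      linarith)
    refine ⟨r, ?_⟩
    ext i j
    fin_cases i <;> fin_cases j <;> simp [z1, z2, hr, ← sub_eq_zero.1 z0]

/-! ### Moving the eigenvalues to canonical positions -/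

/-- A real Möbius transformation with prescribed values at the eigenvalues brings a matrix to
triangular form. -/
theorem exists_realMoebiusEquiv_triangular {A : Matrix (Fin 2) (Fin 2) ℂ} {x y u v : ℂ}
    (h : EigenvaluesAre A x y) {a b c d : ℝ} (hΔ : a * d - b * c ≠ 0)
    (hx : (c : ℂ) * x + d ≠ 0) (hy : (c : ℂ) * y + d ≠ 0)
    (hu : (a : ℂ) * x + b = u * (c * x + d)) (hv : (a : ℂ) * y + b = v * (c * y + d)) :
    ∃ τ : ℝ, 0 ≤ τ ∧ τ ^ 2 = 2 * ((a * d - b * c) ^ 2 /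
      (‖(c : ℂ) * x + d‖ * ‖(c : ℂ) * y + d‖) ^ 2 * (discU A - ‖discD A‖)) ∧
      RealMoebiusEquiv A !![u, (τ : ℂ); 0, v] := by
  have hB := h.moebius a b c d hx hy
  rw [hu, hv, mul_div_cancel_right₀ _ hx, mul_div_cancel_right₀ _ hy] at hB
  obtain ⟨V, hV, τ, hτ, e⟩ := exists_unitary_triangular hB
  have hdet : (c * x + d) * (c * y + d) ≠ 0 := mul_ne_zero hx hy
  refine ⟨τ, hτ, ?_, a, b, c, d, hΔ, by rwa [det_smul_add_smul_one h], V, hV, e.symm⟩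
  have h1 := discU_triangular u v τ
  have hD : ‖discD !![u, (τ : ℂ); 0, v]‖ = (a * d - b * c) ^ 2 /
      (‖(c : ℂ) * x + d‖ * ‖(c : ℂ) * y + d‖) ^ 2 * ‖discD A‖ := by
    have e1 : u - v = ((a * d - b * c : ℝ) : ℂ) / ((c * x + d) * (c * y + d)) * (x - y) := by
      rw [← mul_div_cancel_right₀ u hx, ← mul_div_cancel_right₀ v hy, ← hu, ← hv]
      push_cast
      rw [div_sub_div _ _ hx hy, div_mul_eq_mul_div]
      congr 1
      ring
    rw [(eigenvaluesAre_triangular u v τ).discD_eq, h.discD_eq, e1]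
    simp only [norm_neg, norm_pow, norm_div, norm_mul, Complex.norm_real, Real.norm_eq_abs]
    rw [div_pow, mul_pow, div_pow, sq_abs]
    ring
  have hU : discU !![u, (τ : ℂ); 0, v] = (a * d - b * c) ^ 2 /
      (‖(c : ℂ) * x + d‖ * ‖(c : ℂ) * y + d‖) ^ 2 * discU A := by
    rw [← e, discU_conj hV, moebius_eq_affine h _ _ _ _ hdet, discU_smul_add]
    congr 1
    rw [norm_div, div_pow, norm_mul]
    congr 1
    rw [show (a : ℂ) * d - b * c = ((a * d - b * c : ℝ) : ℂ) by push_cast; rfl, Complex.norm_real,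
      Real.norm_eq_abs, sq_abs]
  rw [hU, hD] at h1
  linarith

/-- The normal form `S_β` is reached as soon as the eigenvalues are sent to `0` and `iη`. -/
theorem exists_canonS {A : Matrix (Fin 2) (Fin 2) ℂ} {x y : ℂ} {η : ℝ}
    (h : EigenvaluesAre A x y) {a b c d : ℝ} (hΔ : a * d - b * c ≠ 0)
    (hx : (c : ℂ) * x + d ≠ 0) (hy : (c : ℂ) * y + d ≠ 0)
    (hu : (a : ℂ) * x + b = 0) (hv : (a : ℂ) * y + b = (Complex.I * η) * (c * y + d))
    (hpos : η ≠ 0 ∨ 0 < discU A - ‖discD A‖) :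
    ∃ β ∈ Set.Icc 0 (Real.pi / 2), RealMoebiusEquiv A (canonS β) := by
  wlog hη : 0 ≤ η generalizing a b η
  · refine this (a := -a) (b := -b) (η := -η) ?_ ?_ ?_ ?_ (by linarith)
    · intro h0
      apply hΔ
      linarith
    · push_cast
      linear_combination -hu
    · push_cast
      linear_combination -hv
    · rwa [neg_ne_zero]
  have nx : 0 < ‖(c : ℂ) * x + d‖ := norm_pos_iff.2 hx
  have ny : 0 < ‖(c : ℂ) * y + d‖ := norm_pos_iff.2 hy
  have hT : 0 ≤ discU A - ‖discD A‖ := sub_nonneg.2 (norm_discD_le_discU A)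
  set μ := (a * d - b * c) ^ 2 / (‖(c : ℂ) * x + d‖ * ‖(c : ℂ) * y + d‖) ^ 2 with hμ
  have hμ0 : 0 < μ := by positivity
  have hN : 0 < 2 * (μ * (discU A - ‖discD A‖)) + η ^ 2 := by
    rcases hpos with h0 | h0 <;> positivity
  -- The form `S_β` requires `τ² + η² = 1`. Multiplying the numerator of the transformation by `k`
  -- scales `τ` and `η` alike, which achieves this normalization; `hpos` keeps the quantity under
  -- the root positive.
  set k := (√(2 * (μ * (discU A - ‖discD A‖)) + η ^ 2))⁻¹ with hk
  have hk0 : 0 < k := inv_pos.2 (Real.sqrt_pos.2 hN)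
  have hk2 : k ^ 2 * (2 * (μ * (discU A - ‖discD A‖)) + η ^ 2) = 1 := by
    rw [hk, inv_pow, Real.sq_sqrt hN.le, inv_mul_cancel₀ hN.ne']
  obtain ⟨τ, hτ, hτ2, hR⟩ := exists_realMoebiusEquiv_triangular (u := 0)
    (v := Complex.I * ((k * η : ℝ) : ℂ)) h (a := k * a) (b := k * b) (c := c) (d := d)
    (by
      rw [mul_assoc, mul_assoc, ← mul_sub]
      exact mul_ne_zero hk0.ne' hΔ) hx hy
    (by
      push_cast
      linear_combination k * hu)
    (by
      push_cast
      linear_combination k * hv)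
  have hτ3 : τ ^ 2 + (k * η) ^ 2 = 1 := by
    rw [hτ2, ← hk2, hμ]
    ring
  have hle : k * η ≤ 1 := by nlinarith [sq_nonneg τ]
  have hkη : 0 ≤ k * η := by positivity
  refine ⟨Real.arcsin (k * η), ⟨Real.arcsin_nonneg.2 hkη, Real.arcsin_le_pi_div_two _⟩, ?_⟩
  have hs : Real.sin (Real.arcsin (k * η)) = k * η := Real.sin_arcsin (by linarith) hle
  have hc : Real.cos (Real.arcsin (k * η)) = τ := by
    rw [Real.cos_arcsin, ← hτ3, add_sub_cancel_right, Real.sqrt_sq hτ]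
  rwa [canonS, hs, hc]

theorem ofReal_mul_add_ne_zero {a b c d : ℝ} (hΔ : a * d - b * c ≠ 0) {z : ℂ} (hz : z.im ≠ 0) :
    (c : ℂ) * z + d ≠ 0 := by
  intro h
  have h1 := congrArg Complex.im h
  have h2 := congrArg Complex.re h
  simp at h1 h2
  have hc : c = 0 := h1.resolve_right hz
  rw [hc] at h2
  have hd : d = 0 := by simpa using h2
  apply hΔ
  rw [hc, hd]
  ring

/-- Two points on the same side of the real line can be moved to the imaginary axis. -/
theorem exists_moebius_imaginary {z w : ℂ} (hz : z.im ≠ 0) (hw : w.im ≠ 0) :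
    ∃ a b c d r s : ℝ, a * d - b * c ≠ 0 ∧
      (a : ℂ) * z + b = Complex.I * r * (c * z + d) ∧
      (a : ℂ) * w + b = Complex.I * s * (c * w + d) := by
  by_cases hre : z.re = w.re
  · refine ⟨1, -z.re, 0, 1, z.im, w.im, by norm_num, ?_, ?_⟩
    · apply Complex.ext <;> simp
    · apply Complex.ext <;> simp [hre]
  · have hre' : z.re - w.re ≠ 0 := sub_ne_zero.2 hre
    -- Center of the circle through `z` and `w` orthogonal to the real axis. The map `u ↦ (u - (m -
    -- R)) / ((m + R) - u)` sends its real endpoints to `0` and `∞`, hence the circle to the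
    -- imaginary axis.
    set m := (z.re ^ 2 + z.im ^ 2 - (w.re ^ 2 + w.im ^ 2)) / (2 * (z.re - w.re)) with hm
    set R := √((z.re - m) ^ 2 + z.im ^ 2) with hR
    have hR2 : R ^ 2 = (z.re - m) ^ 2 + z.im ^ 2 := Real.sq_sqrt (by positivity)
    have hR2' : R ^ 2 = (w.re - m) ^ 2 + w.im ^ 2 := by
      rw [hR2, hm]
      field_simp
      ring
    have hR0 : 0 < R := Real.sqrt_pos.2 (by positivity)
    have key : ∀ u : ℂ, u.im ≠ 0 → R ^ 2 = (u.re - m) ^ 2 + u.im ^ 2 →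
        ((1 : ℝ) : ℂ) * u + ((R - m : ℝ) : ℂ) =
          Complex.I * ((u.im / (R - (u.re - m)) : ℝ) : ℂ) *
            (((-1 : ℝ) : ℂ) * u + ((m + R : ℝ) : ℂ)) := by
      intro u hu h2
      have h3 : R - (u.re - m) ≠ 0 := by
        intro h0
        rw [show u.re - m = R by linarith] at h2
        have : 0 < u.im ^ 2 := by positivity
        linarith
      set r := u.im / (R - (u.re - m)) with hr
      have e1 : r * (R - (u.re - m)) = u.im := div_mul_cancel₀ _ h3
      have e2 : r * u.im = R + (u.re - m) := by
        rw [hr]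
        field_simp
        linarith
      apply Complex.ext
      · simp
        linarith
      · simp
        linarith
    refine ⟨1, R - m, -1, m + R, _, _, ?_, key z hz hR2, key w hw hR2'⟩
    have : 1 * (m + R) - (R - m) * -1 = 2 * R := by ring
    rw [this]
    positivity

/-- Two points on the same side of the real line can be moved to points of the unit circle which
are symmetric to each other with respect to the imaginary axis. -/
theorem exists_moebius_unit {z w : ℂ} (hzw : 0 < z.im * w.im) :
    ∃ a b c d C S : ℝ, a * d - b * c ≠ 0 ∧ 0 ≤ C ∧ 0 ≤ S ∧ C ^ 2 + S ^ 2 = 1 ∧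
      (a : ℂ) * z + b = (C + Complex.I * S) * (c * z + d) ∧
      (a : ℂ) * w + b = (-C + Complex.I * S) * (c * w + d) := by
  have hz : z.im ≠ 0 := left_ne_zero_of_mul hzw.ne'
  have hw : w.im ≠ 0 := right_ne_zero_of_mul hzw.ne'
  obtain ⟨a, b, c, d, r, s, hΔ, h1, h2⟩ := exists_moebius_imaginary hz hw
  have him : ∀ {u : ℂ} {t : ℝ}, u.im ≠ 0 → (a : ℂ) * u + b = Complex.I * t * (c * u + d) →
      t = (a * d - b * c) / ‖(c : ℂ) * u + d‖ ^ 2 * u.im := by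
    intro u t hu h
    rw [← im_moebius, h, mul_div_cancel_right₀ _ (ofReal_mul_add_ne_zero hΔ hu)]
    simp
  have hrs : 0 < r * s := by
    have nz : 0 < ‖(c : ℂ) * z + d‖ := norm_pos_iff.2 (ofReal_mul_add_ne_zero hΔ hz)
    have nw : 0 < ‖(c : ℂ) * w + d‖ := norm_pos_iff.2 (ofReal_mul_add_ne_zero hΔ hw)
    rw [him hz h1, him hw h2]
    have : (a * d - b * c) / ‖(c : ℂ) * z + d‖ ^ 2 * z.im *
        ((a * d - b * c) / ‖(c : ℂ) * w + d‖ ^ 2 * w.im) =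
        (a * d - b * c) ^ 2 / (‖(c : ℂ) * z + d‖ ^ 2 * ‖(c : ℂ) * w + d‖ ^ 2) *
          (z.im * w.im) := by
      field_simp
    rw [this]
    positivity
  clear him
  wlog hr : 0 < r generalizing a b r s
  · refine this (-a) (-b) (-r) (-s) ?_ ?_ ?_ (by linarith) ?_
    · intro h0
      apply hΔ
      linarith
    · push_cast
      linear_combination -h1
    · push_cast
      linear_combination -h2
    · have : r ≠ 0 := left_ne_zero_of_mul hrs.ne'
      have := lt_of_le_of_ne (not_lt.1 hr) this
      linarith
  have hs : 0 < s := pos_of_mul_pos_right hrs hr.le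
  -- Scaling the imaginary axis so that the two points become `iρ` and `i/ρ`. The Cayley transform
  -- `u ↦ (u-1)/(u+1)` then sends them to unit points with opposite real parts and equal imaginary
  -- parts.
  set k := (√(r * s))⁻¹ with hk
  have hk0 : 0 < k := inv_pos.2 (Real.sqrt_pos.2 hrs)
  have hk2 : k ^ 2 * (r * s) = 1 := by
    rw [hk, inv_pow, Real.sq_sqrt hrs.le, inv_mul_cancel₀ hrs.ne']
  set ρ := k * r with hρ
  have hρ0 : 0 < ρ := by positivity
  have hρs : ρ * (k * s) = 1 := by
    rw [← hk2]
    ring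
  have hρs' : (ρ : ℂ) * (k * s) = 1 := by exact_mod_cast hρs
  have hN : 0 < 1 + ρ ^ 2 := by positivity
  have hN' : (1 : ℂ) + ρ ^ 2 ≠ 0 := by exact_mod_cast hN.ne'
  have e1 : ((k * a - c : ℝ) : ℂ) * z + ((k * b - d : ℝ) : ℂ) =
      ((((ρ ^ 2 - 1) / (1 + ρ ^ 2) : ℝ) : ℂ) +
        Complex.I * ((2 * ρ / (1 + ρ ^ 2) : ℝ) : ℂ)) *
        (((k * a + c : ℝ) : ℂ) * z + ((k * b + d : ℝ) : ℂ)) := by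
    push_cast
    rw [show ((k : ℂ) * a - c) * z + (k * b - d) = (Complex.I * ρ - 1) * (c * z + d) by
        rw [hρ]; push_cast; linear_combination (k : ℂ) * h1,
      show ((k : ℂ) * a + c) * z + (k * b + d) = (Complex.I * ρ + 1) * (c * z + d) by
        rw [hρ]; push_cast; linear_combination (k : ℂ) * h1, ← mul_assoc]
    congr 1
    field_simp
    linear_combination (-2 * (ρ : ℂ) ^ 2) * Complex.I_sq
  have e2 : ((k * a - c : ℝ) : ℂ) * w + ((k * b - d : ℝ) : ℂ) =
      (-(((ρ ^ 2 - 1) / (1 + ρ ^ 2) : ℝ) : ℂ) +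
        Complex.I * ((2 * ρ / (1 + ρ ^ 2) : ℝ) : ℂ)) *
        (((k * a + c : ℝ) : ℂ) * w + ((k * b + d : ℝ) : ℂ)) := by
    have hρ' : (ρ : ℂ) ≠ 0 := by exact_mod_cast hρ0.ne'
    have hks : (k : ℂ) * s = 1 / ρ := by
      rw [eq_div_iff hρ']
      linear_combination hρs'
    have h2' : (k : ℂ) * (a * w + b) = Complex.I * (1 / ρ) * (c * w + d) := by
      rw [← hks]
      linear_combination (k : ℂ) * h2
    push_cast
    rw [show ((k : ℂ) * a - c) * w + (k * b - d) = (Complex.I * (1 / ρ) - 1) * (c * w + d) by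
        linear_combination h2',
      show ((k : ℂ) * a + c) * w + (k * b + d) = (Complex.I * (1 / ρ) + 1) * (c * w + d) by
        linear_combination h2', ← mul_assoc]
    congr 1
    field_simp
    linear_combination (-2 * (ρ : ℂ)) * Complex.I_sq
  have hCS : ((ρ ^ 2 - 1) / (1 + ρ ^ 2)) ^ 2 + (2 * ρ / (1 + ρ ^ 2)) ^ 2 = 1 := by
    field_simp
    ring
  have hS0 : 0 ≤ 2 * ρ / (1 + ρ ^ 2) := by positivity
  have hΔ2 : (k * a - c) * (k * b + d) - (k * b - d) * (k * a + c) ≠ 0 := by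
    rw [show (k * a - c) * (k * b + d) - (k * b - d) * (k * a + c) = 2 * k * (a * d - b * c) by
      ring]
    exact mul_ne_zero (by positivity) hΔ
  generalize (ρ ^ 2 - 1) / (1 + ρ ^ 2) = C at *
  generalize 2 * ρ / (1 + ρ ^ 2) = S at *
  have hCS' : (C : ℂ) ^ 2 + (S : ℂ) ^ 2 = 1 := by exact_mod_cast hCS
  by_cases hC : 0 ≤ C
  · exact ⟨_, _, _, _, C, S, hΔ2, hC, hS0, hCS, e1, e2⟩
  -- Composition with `u ↦ -1/u`, which on the unit circle is reflection in the imaginary axis,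
  -- changes the sign of `C`.
  · refine ⟨-(k * a + c), -(k * b + d), k * a - c, k * b - d, -C, S, ?_, by linarith, hS0,
      by rwa [neg_sq], ?_, ?_⟩
    · intro h0
      apply hΔ2
      linarith
    · rw [e1]
      push_cast
      linear_combination ((k * a + c) * z + (k * b + d) : ℂ) * (hCS' - (S : ℂ) ^ 2 * Complex.I_sq)
    · rw [e2]
      push_cast
      linear_combination ((k * a + c) * w + (k * b + d) : ℂ) * (hCS' - (S : ℂ) ^ 2 * Complex.I_sq)

/-- The sign of `Im x · Im y` decides: negative leads to `L⁻`, positive to `L⁺`. If a real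
eigenvalue occurs, the form is `0`, `S_β`, or, for two distinct real eigenvalues, `L⁺` with `α = 0`.
-/
theorem exists_isCharBCK (A : Matrix (Fin 2) (Fin 2) ℂ) : ∃ p m, IsCharBCK A p m := by
  obtain ⟨x, y, h⟩ := exists_eigenvaluesAre A
  rcases lt_trichotomy (x.im * y.im) 0 with hneg | hzero | hpos
  · have hx : x.im ≠ 0 := left_ne_zero_of_mul hneg.ne
    have hy : y.im ≠ 0 := right_ne_zero_of_mul hneg.ne
    -- `x` and `conj y` lie on the same side of the real axis; conjugating the relation for `conj y`
    -- places `y` at `-C - iS`, because the coefficients are real.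
    obtain ⟨a, b, c, d, C, S, hΔ, hC, hS, hCS, e1, e2⟩ :=
      exists_moebius_unit (z := x) (w := conj y) (by rw [Complex.conj_im]; linarith)
    have e3 : (a : ℂ) * y + b = (-C - Complex.I * S) * (c * y + d) := by
      have := congrArg conj e2
      simp at this
      linear_combination this
    obtain ⟨τ, hτ, -, hR⟩ := exists_realMoebiusEquiv_triangular h hΔ
      (ofReal_mul_add_ne_zero hΔ hx) (ofReal_mul_add_ne_zero hΔ hy) e1 e3
    have hs1 : S ≤ 1 := by nlinarith [sq_nonneg C]
    have es : Real.sin (Real.arcsin S) = S := Real.sin_arcsin (by linarith) hs1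
    have ec : Real.cos (Real.arcsin S) = C := by
      rw [Real.cos_arcsin, ← hCS, add_sub_cancel_right, Real.sqrt_sq hC]
    refine ⟨_, _, _, ?_, .LMinus (Real.arcsin S) (τ / 2)
      ⟨Real.arcsin_nonneg.2 hS, Real.arcsin_le_pi_div_two _⟩ (by positivity)⟩
    rw [canonLMinus, es, ec]
    convert hR using 4
    push_cast
    ring_nf
  · wlog hx : x.im = 0 generalizing x y
    · rw [mul_eq_zero] at hzero
      exact this y x h.symm (by rw [hzero.resolve_left hx, zero_mul]) (hzero.resolve_left hx)
    obtain ⟨r, rfl⟩ := exists_ofReal_of_im_eq_zero hx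
    have main : ∀ {c d η : ℝ}, (1 : ℝ) * d - -r * c ≠ 0 → (c : ℂ) * r + d ≠ 0 →
        (c : ℂ) * y + d ≠ 0 → y - r = (Complex.I * η) * (c * y + d) →
        (η ≠ 0 ∨ 0 < discU A - ‖discD A‖) → ∃ p m, IsCharBCK A p m := by
      intro c d η h1 h2 h3 h4 h5
      obtain ⟨β, hβ, hR⟩ := exists_canonS h h1 h2 h3 (by push_cast; ring)
        (by push_cast; linear_combination h4) h5
      exact ⟨_, _, _, hR, .S β hβ⟩
    by_cases hy : y.im = 0
    · obtain ⟨s, rfl⟩ := exists_ofReal_of_im_eq_zero hy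
      by_cases hrs : r = s
      · subst hrs
        by_cases hA : IsRealScalar A
        · obtain ⟨k, rfl⟩ := hA
          refine ⟨0, 0, 0, ⟨1, -k, 0, 1, by norm_num, by simp, 1, Submonoid.one_mem _, ?_⟩, .zero⟩
          simp
        · have hD : ‖discD A‖ = 0 := by
            rw [h.norm_discD]
            simp
          have hU : 0 < discU A - ‖discD A‖ := by
            refine lt_of_le_of_ne (sub_nonneg.2 (norm_discD_le_discU A)) fun h0 => hA ?_
            rw [hD, sub_zero] at h0
            have := h.discE_sub
            rw [Complex.ofReal_im, zero_mul, hD, sub_zero] at this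
            exact (isRealScalar_iff A).2 ⟨h0.symm, this⟩
          exact main (c := 0) (d := 1) (η := 0) (by norm_num) (by simp) (by simp) (by simp)
            (Or.inr hU)
      · have hrs' : (r : ℂ) - s ≠ 0 := by
          rw [← Complex.ofReal_sub, Complex.ofReal_ne_zero]
          exact sub_ne_zero.2 hrs
        -- The affine map with `r ↦ 1` and `s ↦ -1`.
        obtain ⟨τ, hτ, -, hR⟩ := exists_realMoebiusEquiv_triangular (u := 1) (v := -1) h
          (a := 2) (b := -(r + s)) (c := 0) (d := r - s)
          (by
            rw [mul_zero, sub_zero]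
            exact mul_ne_zero two_ne_zero (sub_ne_zero.2 hrs))
          (by simpa using hrs') (by simpa using hrs') (by push_cast; ring) (by push_cast; ring)
        refine ⟨_, _, _, ?_, .LPlus 0 (τ / 2) ⟨le_rfl, by positivity⟩ (by positivity)⟩
        convert hR using 1
        ext i j
        fin_cases i <;> fin_cases j <;> simp [canonLPlus]
        ring
    · obtain ⟨u, hu⟩ : ∃ u, u = y.re - r := ⟨_, rfl⟩
      have hn : 0 < u ^ 2 + y.im ^ 2 := by positivity
      -- With `w = y - r`, the map `w ↦ w/(1 - qw) = 1/(1/w - q)` has a purely imaginary value at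
      -- `w` for `q = Re (1/w)`; that value is `iη`.
      obtain ⟨q, hq⟩ : ∃ q, q = u / (u ^ 2 + y.im ^ 2) := ⟨_, rfl⟩
      obtain ⟨η, hη⟩ : ∃ η, η = (u ^ 2 + y.im ^ 2) / y.im := ⟨_, rfl⟩
      have hyre : y.re = u + r := by rw [hu]; ring
      have e1 : η * (q * y.im) = u := by
        rw [hη, hq]
        field_simp
      have e2 : η * (1 - q * u) = y.im := by
        rw [hη, hq]
        field_simp
        ring
      have e : y - r = (Complex.I * (η : ℂ)) * (((-q : ℝ) : ℂ) * y + ((1 + q * r : ℝ) : ℂ)) := by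
        apply Complex.ext
        · simp [hyre]
          linarith
        · simp [hyre]
          linarith
      have hΔ : (1 : ℝ) * (1 + q * r) - -r * -q ≠ 0 := by
        rw [show (1 : ℝ) * (1 + q * r) - -r * -q = 1 by ring]
        exact one_ne_zero
      refine main hΔ ?_ (ofReal_mul_add_ne_zero hΔ hy) e (Or.inl (by rw [hη]; positivity))
      push_cast
      rw [show -(q : ℂ) * r + (1 + q * r) = 1 by ring]
      exact one_ne_zero
  · have hx : x.im ≠ 0 := left_ne_zero_of_mul hpos.ne'
    have hy : y.im ≠ 0 := right_ne_zero_of_mul hpos.ne'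
    obtain ⟨a, b, c, d, C, S, hΔ, hC, hS, hCS, e1, e2⟩ := exists_moebius_unit hpos
    obtain ⟨τ, hτ, -, hR⟩ := exists_realMoebiusEquiv_triangular h hΔ
      (ofReal_mul_add_ne_zero hΔ hx) (ofReal_mul_add_ne_zero hΔ hy) e1 e2
    have hs1 : S ≤ 1 := by nlinarith [sq_nonneg C]
    have es : Real.sin (Real.arcsin S) = S := Real.sin_arcsin (by linarith) hs1
    have ec : Real.cos (Real.arcsin S) = C := by
      rw [Real.cos_arcsin, ← hCS, add_sub_cancel_right, Real.sqrt_sq hC]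
    refine ⟨_, _, _, ?_, .LPlus (Real.arcsin S) (τ / 2)
      ⟨Real.arcsin_nonneg.2 hS, Real.arcsin_le_pi_div_two _⟩ (by positivity)⟩
    rw [canonLPlus, es, ec]
    convert hR using 4
    push_cast
    ring_nf

/-! ### Characteristic values as invariants -/

/-- The major characteristic value in terms of the invariants. -/
noncomputable def majorChar (A : Matrix (Fin 2) (Fin 2) ℂ) : ℝ :=
  √((discU A - ‖discD A‖ + 2 * min (discE A) ‖discD A‖) /
    (discU A - ‖discD A‖ + 2 * max (discE A) ‖discD A‖))

/-- The minor characteristic value in terms of the invariants. -/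
noncomputable def minorChar (A : Matrix (Fin 2) (Fin 2) ℂ) : ℝ :=
  √((discU A - ‖discD A‖) / (discU A - ‖discD A‖ + 2 * max (discE A) ‖discD A‖))

theorem RealMoebiusEquiv.majorChar_eq {A B : Matrix (Fin 2) (Fin 2) ℂ}
    (h : RealMoebiusEquiv A B) : majorChar B = majorChar A ∧ minorChar B = minorChar A := by
  obtain ⟨μ, hμ, hU, hD, hE⟩ := h.invariants
  unfold majorChar minorChar
  rw [hU, hD, hE, ← mul_min_of_nonneg _ _ hμ.le, ← mul_max_of_nonneg _ _ hμ.le, ← mul_sub,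
    mul_left_comm 2, mul_left_comm 2, ← mul_add, ← mul_add, mul_div_mul_left _ _ hμ.ne',
    mul_div_mul_left _ _ hμ.ne']
  exact ⟨rfl, rfl⟩

/-- For `L^±` one has `U - |D| = 2t²`, and `E`, `|D|` are `1` and `cos² α`, in this order for `L⁺`
and reversed for `L⁻`. For `S_β` one has `E = |D| = sin² β / 4` and `U - |D| = cos² β / 2`. For the
zero matrix the values rest on `0 / 0 = 0`. -/
theorem CanonicalBCK.eq_majorChar {B : Matrix (Fin 2) (Fin 2) ℂ} {p m : ℝ}
    (h : CanonicalBCK B p m) : p = majorChar B ∧ m = minorChar B := by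
  have hL : ∀ (c t : ℝ), √(c ^ 2 + t ^ 2) / √(1 + t ^ 2) =
      √(((2 * t) ^ 2 / 2 + 2 * c ^ 2) / ((2 * t) ^ 2 / 2 + 2 * 1)) := by
    intro c t
    rw [← Real.sqrt_div (by positivity)]
    congr 1
    field_simp
    ring
  have hM : ∀ {t : ℝ}, 0 ≤ t → t / √(1 + t ^ 2) = √((2 * t) ^ 2 / 2 / ((2 * t) ^ 2 / 2 + 2 * 1)) := by
    intro t ht
    nth_rw 1 [← Real.sqrt_sq ht]
    rw [← Real.sqrt_div (by positivity)]
    congr 1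
    field_simp
    ring
  cases h with
  | zero =>
    have h := (isRealScalar_iff 0).1 ⟨0, by simp⟩
    have hD : ‖discD 0‖ = 0 := le_antisymm ((norm_discD_le_discU 0).trans_eq h.1) (norm_nonneg _)
    unfold majorChar minorChar
    rw [h.1, h.2, hD]
    simp
  | S β hβ =>
    have h := eigenvaluesAre_triangular 0 (Complex.I * (Real.sin β : ℂ)) (Real.cos β)
    have hU := discU_triangular 0 (Complex.I * (Real.sin β : ℂ)) (Real.cos β)
    have hE := h.discE_sub
    have hD := h.norm_discD
    simp only [Complex.zero_im, Complex.zero_re, zero_mul, Complex.mul_re, Complex.mul_im,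
      Complex.I_re, Complex.I_im, Complex.ofReal_re, Complex.ofReal_im] at hE hD
    have hc : 0 ≤ Real.cos β := Real.cos_nonneg_of_mem_Icc ⟨by linarith [hβ.1, Real.pi_pos], hβ.2⟩
    have hsc := Real.sin_sq_add_cos_sq β
    unfold majorChar minorChar canonS
    rw [sub_eq_zero.1 hE, hU, min_self, max_self, hD, add_sub_cancel_left,
      show Real.cos β ^ 2 / 2 + 2 * (((0 - (0 - 1 * 0)) ^ 2 +
        (0 - (0 + 1 * Real.sin β)) ^ 2) / 4) = 1 / 2 by linarith]
    refine ⟨by norm_num, ?_⟩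
    rw [div_div_div_cancel_right₀ two_ne_zero, div_one, Real.sqrt_sq hc]
  | LPlus α t hα ht =>
    have e : (2 : ℂ) * (t : ℂ) = ((2 * t : ℝ) : ℂ) := by push_cast; rfl
    have h := eigenvaluesAre_triangular ((Real.cos α : ℂ) + Complex.I * (Real.sin α : ℂ))
      (-(Real.cos α : ℂ) + Complex.I * (Real.sin α : ℂ)) ((2 * t : ℝ) : ℂ)
    have hU := discU_triangular ((Real.cos α : ℂ) + Complex.I * (Real.sin α : ℂ))
      (-(Real.cos α : ℂ) + Complex.I * (Real.sin α : ℂ)) (2 * t)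
    have hE := h.discE_sub
    have hD := h.norm_discD
    simp only [Complex.add_re, Complex.add_im, Complex.neg_re, Complex.neg_im, Complex.mul_re,
      Complex.mul_im, Complex.I_re, Complex.I_im, Complex.ofReal_re, Complex.ofReal_im] at hE hD
    have hsc := Real.sin_sq_add_cos_sq α
    have hD' : ‖discD (canonLPlus α t)‖ = Real.cos α ^ 2 := by
      rw [canonLPlus, e, hD]
      ring
    have hE' : discE (canonLPlus α t) = 1 := by
      rw [canonLPlus, e, eq_add_of_sub_eq hE, hD]
      linear_combination hsc
    have hU' : discU (canonLPlus α t) = Real.cos α ^ 2 + (2 * t) ^ 2 / 2 := by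
      rw [← hD', canonLPlus, e, hU]
    unfold majorChar minorChar
    rw [hU', hE', hD', min_eq_right (Real.cos_sq_le_one α), max_eq_left (Real.cos_sq_le_one α),
      add_sub_cancel_left]
    exact ⟨hL _ _, hM ht⟩
  | LMinus α t hα ht =>
    have e : (2 : ℂ) * (t : ℂ) = ((2 * t : ℝ) : ℂ) := by push_cast; rfl
    have h := eigenvaluesAre_triangular ((Real.cos α : ℂ) + Complex.I * (Real.sin α : ℂ))
      (-(Real.cos α : ℂ) - Complex.I * (Real.sin α : ℂ)) ((2 * t : ℝ) : ℂ)
    have hU := discU_triangular ((Real.cos α : ℂ) + Complex.I * (Real.sin α : ℂ))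
      (-(Real.cos α : ℂ) - Complex.I * (Real.sin α : ℂ)) (2 * t)
    have hE := h.discE_sub
    have hD := h.norm_discD
    simp only [Complex.add_re, Complex.add_im, Complex.neg_re, Complex.neg_im, Complex.mul_re,
      Complex.mul_im, Complex.I_re, Complex.I_im, Complex.ofReal_re, Complex.ofReal_im,
      Complex.sub_re, Complex.sub_im] at hE hD
    have hsc := Real.sin_sq_add_cos_sq α
    have hD' : ‖discD (canonLMinus α t)‖ = 1 := by
      rw [canonLMinus, e, hD]
      linear_combination hsc
    have hE' : discE (canonLMinus α t) = Real.cos α ^ 2 := by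
      rw [canonLMinus, e, eq_add_of_sub_eq hE, hD]
      ring
    have hU' : discU (canonLMinus α t) = 1 + (2 * t) ^ 2 / 2 := by
      rw [← hD', canonLMinus, e, hU]
    unfold majorChar minorChar
    rw [hU', hE', hD', min_eq_left (Real.cos_sq_le_one α), max_eq_right (Real.cos_sq_le_one α),
      add_sub_cancel_left]
    exact ⟨hL _ _, hM ht⟩

theorem isCharBCK_iff (A : Matrix (Fin 2) (Fin 2) ℂ) (p m : ℝ) :
    IsCharBCK A p m ↔ p = majorChar A ∧ m = minorChar A := by
  have key : ∀ {p m}, IsCharBCK A p m → p = majorChar A ∧ m = minorChar A := by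
    rintro p m ⟨B, hB, hc⟩
    have := hc.eq_majorChar
    rwa [hB.majorChar_eq.1, hB.majorChar_eq.2] at this
  refine ⟨key, ?_⟩
  rintro ⟨rfl, rfl⟩
  obtain ⟨p, m, h⟩ := exists_isCharBCK A
  obtain ⟨rfl, rfl⟩ := key h
  exact h

/-! ### The conformal ranges of the canonical forms -/

/-- Surjectivity of the Hopf map: unit vectors of `ℂ²` up to phase are points of the sphere. The
phase is fixed by taking `u` real and positive, except over `n₃ = -1`, where `u = 0`. -/
theorem exists_hopf {n₁ n₂ n₃ : ℝ} (h : n₁ ^ 2 + n₂ ^ 2 + n₃ ^ 2 = 1) :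
    ∃ u v : ℂ, ‖u‖ ^ 2 + ‖v‖ ^ 2 = 1 ∧ ‖u‖ ^ 2 - ‖v‖ ^ 2 = n₃ ∧
      2 * (conj u * v).re = n₁ ∧ 2 * (conj u * v).im = n₂ := by
  have h3 : n₃ ≤ 1 := by nlinarith [sq_nonneg n₁, sq_nonneg n₂]
  have h3' : -1 ≤ n₃ := by nlinarith [sq_nonneg n₁, sq_nonneg n₂]
  rcases h3'.eq_or_lt with h0 | h0
  · have h1 : n₁ = 0 := by nlinarith [sq_nonneg n₁, sq_nonneg n₂]
    have h2 : n₂ = 0 := by nlinarith [sq_nonneg n₁, sq_nonneg n₂]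
    exact ⟨0, 1, by simp, by simp [← h0], by simp [h1], by simp [h2]⟩
  · set r := √((1 + n₃) / 2) with hr
    have hr2 : r ^ 2 = (1 + n₃) / 2 := Real.sq_sqrt (by linarith)
    have hr0 : 0 < r := Real.sqrt_pos.2 (by linarith)
    have hv : ‖(⟨n₁ / (2 * r), n₂ / (2 * r)⟩ : ℂ)‖ ^ 2 = (1 - n₃) / 2 := by
      rw [Complex.sq_norm, Complex.normSq_mk]
      have : n₁ / (2 * r) * (n₁ / (2 * r)) + n₂ / (2 * r) * (n₂ / (2 * r)) =
          (n₁ ^ 2 + n₂ ^ 2) / (4 * r ^ 2) := by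
        field_simp
        ring
      rw [this, hr2, div_eq_iff (by linarith)]
      linear_combination h
    have hu : ‖(r : ℂ)‖ ^ 2 = (1 + n₃) / 2 := by
      rw [Complex.norm_real, Real.norm_eq_abs, sq_abs, hr2]
    refine ⟨r, ⟨n₁ / (2 * r), n₂ / (2 * r)⟩, ?_, ?_, ?_, ?_⟩
    · rw [hu, hv]
      ring
    · rw [hu, hv]
      ring
    · simp
      field_simp
    · simp
      field_simp

theorem hopf_identity (u v : ℂ) : (2 * (conj u * v).re) ^ 2 + (2 * (conj u * v).im) ^ 2 +
    (‖u‖ ^ 2 - ‖v‖ ^ 2) ^ 2 = (‖u‖ ^ 2 + ‖v‖ ^ 2) ^ 2 := by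
  simp only [Complex.sq_norm, Complex.normSq_apply, Complex.mul_re, Complex.mul_im,
    Complex.conj_re, Complex.conj_im]
  ring

/-- The conformal range of a triangular matrix as the image of the unit sphere. -/
theorem mem_conformalRange_triangular {x y : ℂ} {τ : ℝ} {p : ℝ × ℝ} :
    p ∈ conformalRange !![x, (τ : ℂ); 0, y] ↔
      ∃ n₁ n₂ n₃ : ℝ, n₁ ^ 2 + n₂ ^ 2 + n₃ ^ 2 = 1 ∧
        p = dehomog (x.re * (1 + n₃) + y.re * (1 - n₃) + τ * n₁,
          (‖x‖ ^ 2 * (1 + n₃) + (‖y‖ ^ 2 + τ ^ 2) * (1 - n₃)) / 2 +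
            τ * (x.re * n₁ + x.im * n₂) - 1,
          (‖x‖ ^ 2 * (1 + n₃) + (‖y‖ ^ 2 + τ ^ 2) * (1 - n₃)) / 2 +
            τ * (x.re * n₁ + x.im * n₂) + 1) := by
  have key : ∀ w : Fin 2 → ℂ, ∀ n₁ n₂ n₃ k : ℝ, ‖w 0‖ ^ 2 + ‖w 1‖ ^ 2 = k →
      ‖w 0‖ ^ 2 - ‖w 1‖ ^ 2 = k * n₃ → 2 * (conj (w 0) * w 1).re = k * n₁ →
      2 * (conj (w 0) * w 1).im = k * n₂ →
      shellVec w (!![x, (τ : ℂ); 0, y] *ᵥ w) = k • (x.re * (1 + n₃) + y.re * (1 - n₃) + τ * n₁,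
          (‖x‖ ^ 2 * (1 + n₃) + (‖y‖ ^ 2 + τ ^ 2) * (1 - n₃)) / 2 +
            τ * (x.re * n₁ + x.im * n₂) - 1,
          (‖x‖ ^ 2 * (1 + n₃) + (‖y‖ ^ 2 + τ ^ 2) * (1 - n₃)) / 2 +
            τ * (x.re * n₁ + x.im * n₂) + 1) := by
    intro w n₁ n₂ n₃ k h0 h3 h1 h2
    simp only [Complex.sq_norm, Complex.normSq_apply, Complex.mul_re, Complex.mul_im,
      Complex.conj_re, Complex.conj_im] at h0 h1 h2 h3 ⊢
    ext
    · simp [shellVec, dotProduct, Fin.sum_univ_two, Matrix.mulVec]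
      linear_combination x.re * (h0 + h3) + y.re * (h0 - h3) + τ * h1
    · simp [shellVec, dotProduct, Fin.sum_univ_two, Matrix.mulVec]
      linear_combination (x.re * x.re + x.im * x.im) / 2 * (h0 + h3) +
        (y.re * y.re + y.im * y.im + τ ^ 2) / 2 * (h0 - h3) + τ * x.re * h1 + τ * x.im * h2 - h0
    · simp [shellVec, dotProduct, Fin.sum_univ_two, Matrix.mulVec]
      linear_combination (x.re * x.re + x.im * x.im) / 2 * (h0 + h3) +
        (y.re * y.re + y.im * y.im + τ ^ 2) / 2 * (h0 - h3) + τ * x.re * h1 + τ * x.im * h2 + h0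
  rw [mem_conformalRange_iff]
  constructor
  · rintro ⟨w, hw, rfl⟩
    have hk : 0 < ‖w 0‖ ^ 2 + ‖w 1‖ ^ 2 := by
      have := shellVec_snd_snd_pos (y := 0) hw
      simp only [shellVec, star_dotProduct_self_re] at this
      simpa using this
    set k := ‖w 0‖ ^ 2 + ‖w 1‖ ^ 2 with hk'
    refine ⟨2 * (conj (w 0) * w 1).re / k, 2 * (conj (w 0) * w 1).im / k,
      (‖w 0‖ ^ 2 - ‖w 1‖ ^ 2) / k, ?_, ?_⟩
    · have := hopf_identity (w 0) (w 1)
      rw [div_pow, div_pow, div_pow, ← add_div, ← add_div, this, div_self (by positivity)]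
    · rw [key w (2 * (conj (w 0) * w 1).re / k) (2 * (conj (w 0) * w 1).im / k)
        ((‖w 0‖ ^ 2 - ‖w 1‖ ^ 2) / k) k rfl (mul_div_cancel₀ _ hk.ne').symm
        (mul_div_cancel₀ _ hk.ne').symm (mul_div_cancel₀ _ hk.ne').symm, dehomog_smul hk.ne']
  · rintro ⟨n₁, n₂, n₃, hn, rfl⟩
    obtain ⟨u, v, h0, h3, h1, h2⟩ := exists_hopf hn
    refine ⟨![u, v], ?_, ?_⟩
    · intro hz
      have hu := congrFun hz 0
      have hv := congrFun hz 1
      simp at hu hv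
      simp [hu, hv] at h0
    · rw [key ![u, v] n₁ n₂ n₃ 1 (by simpa using h0) (by simpa using h3) (by simpa using h1)
        (by simpa using h2), one_smul]

/-- The closed elliptical disk with semi-axes `p`, `m` on the coordinate axes. -/
def ellipticDisk (p m : ℝ) : Set (ℝ × ℝ) :=
  {q | ∃ u v : ℝ, u ^ 2 + v ^ 2 ≤ 1 ∧ q = (p * u, m * v)}

/-- The conformal range of the matrices `S_β`, with `c = cos β`. -/
def cuspDisk (c : ℝ) : Set (ℝ × ℝ) :=
  {q | -1 ≤ q.2 ∧ q.2 ≤ 0 ∧ q.1 ^ 2 ≤ c ^ 2 * ((1 + q.2) * (-2 * q.2))}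

theorem conformalRange_canonS (β : ℝ) : conformalRange (canonS β) = cuspDisk (Real.cos β) := by
  have hsc := Real.sin_sq_add_cos_sq β
  ext ⟨X, Z⟩
  rw [canonS, mem_conformalRange_triangular]
  have hn : ‖Complex.I * (Real.sin β : ℂ)‖ ^ 2 = Real.sin β ^ 2 := by
    rw [norm_mul, Complex.norm_I, one_mul, Complex.norm_real, Real.norm_eq_abs, sq_abs]
  rw [hn, hsc]
  simp only [cuspDisk, Set.mem_ofPred_eq, dehomog, Prod.mk.injEq]
  simp only [Complex.zero_re, Complex.zero_im, norm_zero, Complex.mul_re, Complex.I_re,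
    Complex.I_im, Complex.ofReal_re, Complex.ofReal_im]
  constructor
  · rintro ⟨n₁, n₂, n₃, h, rfl, rfl⟩
    have h3 : n₃ ≤ 1 := by nlinarith [sq_nonneg n₁, sq_nonneg n₂]
    have h3' : -1 ≤ n₃ := by nlinarith [sq_nonneg n₁, sq_nonneg n₂]
    have hW : 0 < 3 - n₃ := by linarith
    have eX : (0 * (1 + n₃) + (0 * Real.sin β - 1 * 0) * (1 - n₃) + Real.cos β * n₁) /
        ((0 ^ 2 * (1 + n₃) + 1 * (1 - n₃)) / 2 + Real.cos β * (0 * n₁ + 0 * n₂) + 1) =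
        2 * Real.cos β * n₁ / (3 - n₃) := by
      rw [div_eq_div_iff (by linarith) hW.ne']
      ring
    have eZ : ((0 ^ 2 * (1 + n₃) + 1 * (1 - n₃)) / 2 + Real.cos β * (0 * n₁ + 0 * n₂) - 1) /
        ((0 ^ 2 * (1 + n₃) + 1 * (1 - n₃)) / 2 + Real.cos β * (0 * n₁ + 0 * n₂) + 1) =
        -(1 + n₃) / (3 - n₃) := by
      rw [div_eq_div_iff (by linarith) hW.ne']
      ring
    rw [eX, eZ]
    refine ⟨?_, ?_, ?_⟩
    · rw [le_div_iff₀ hW]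
      linarith
    · exact div_nonpos_of_nonpos_of_nonneg (by linarith) hW.le
    · have : (1 + -(1 + n₃) / (3 - n₃)) * (-2 * (-(1 + n₃) / (3 - n₃))) =
          4 * (1 - n₃ ^ 2) / (3 - n₃) ^ 2 := by
        field_simp
        ring
      rw [this, div_pow, ← mul_div_assoc]
      refine div_le_div_of_nonneg_right ?_ (by positivity)
      nlinarith [mul_nonneg (sq_nonneg (Real.cos β)) (sq_nonneg n₂)]
  · rintro ⟨hZ, hZ', hX⟩
    have hW : 0 < 1 - Z := by linarith
    -- `n₃ = -(1+3Z)/(1-Z)` solves `Z = -(1+n₃)/(3-n₃)`. Then `n₁` is found from `X`, and `n₂`,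
    -- which does not influence the point, completes the unit vector.
    have e3 : 1 - (-(1 + 3 * Z) / (1 - Z)) ^ 2 = 4 * ((1 + Z) * (-2 * Z)) / (1 - Z) ^ 2 := by
      field_simp
      ring
    obtain ⟨n₁, hn1, hX1⟩ : ∃ n₁ : ℝ, n₁ ^ 2 ≤ 1 - (-(1 + 3 * Z) / (1 - Z)) ^ 2 ∧
        2 * X = Real.cos β * n₁ * (1 - Z) := by
      rw [e3]
      by_cases hc : Real.cos β = 0
      · rw [hc] at hX ⊢
        have hX0 : X = 0 := by nlinarith [sq_nonneg X]
        refine ⟨0, ?_, by rw [hX0]; ring⟩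
        rw [zero_pow two_ne_zero]
        refine div_nonneg (mul_nonneg (by norm_num) (mul_nonneg ?_ ?_)) (sq_nonneg _) <;> linarith
      · refine ⟨2 * X / (Real.cos β * (1 - Z)), ?_, by field_simp⟩
        rw [div_pow, mul_pow, mul_pow, div_le_div_iff₀ (by positivity) (by positivity)]
        nlinarith [mul_le_mul_of_nonneg_right hX (sq_nonneg (1 - Z))]
    refine ⟨n₁, √(1 - (-(1 + 3 * Z) / (1 - Z)) ^ 2 - n₁ ^ 2), -(1 + 3 * Z) / (1 - Z), ?_, ?_, ?_⟩
    · rw [Real.sq_sqrt (by linarith)]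
      ring
    · generalize √(1 - (-(1 + 3 * Z) / (1 - Z)) ^ 2 - n₁ ^ 2) = n₂
      rw [show (0 ^ 2 * (1 + -(1 + 3 * Z) / (1 - Z)) + 1 * (1 - -(1 + 3 * Z) / (1 - Z))) / 2 +
        Real.cos β * (0 * n₁ + 0 * n₂) + 1 = 2 / (1 - Z) by field_simp; ring,
        eq_div_iff (by positivity)]
      field_simp
      linear_combination hX1
    · generalize √(1 - (-(1 + 3 * Z) / (1 - Z)) ^ 2 - n₁ ^ 2) = n₂
      rw [show (0 ^ 2 * (1 + -(1 + 3 * Z) / (1 - Z)) + 1 * (1 - -(1 + 3 * Z) / (1 - Z))) / 2 +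
        Real.cos β * (0 * n₁ + 0 * n₂) + 1 = 2 / (1 - Z) by field_simp; ring,
        eq_div_iff (by positivity)]
      field_simp
      ring

/-- The projection of the unit sphere to the plane of two orthonormal vectors. -/
theorem exists_sphere_coordinates {g₁ g₂ g₃ f₁ f₂ f₃ : ℝ} (hg : g₁ ^ 2 + g₂ ^ 2 + g₃ ^ 2 = 1)
    (hf : f₁ ^ 2 + f₂ ^ 2 + f₃ ^ 2 = 1) (hgf : g₁ * f₁ + g₂ * f₂ + g₃ * f₃ = 0) {a b : ℝ} :
    (∃ n₁ n₂ n₃ : ℝ, n₁ ^ 2 + n₂ ^ 2 + n₃ ^ 2 = 1 ∧ g₁ * n₁ + g₂ * n₂ + g₃ * n₃ = a ∧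
      f₁ * n₁ + f₂ * n₂ + f₃ * n₃ = b) ↔ a ^ 2 + b ^ 2 ≤ 1 := by
  constructor
  · rintro ⟨n₁, n₂, n₃, hn, ha, hb⟩
    have h : (n₁ - a * g₁ - b * f₁) ^ 2 + (n₂ - a * g₂ - b * f₂) ^ 2 +
        (n₃ - a * g₃ - b * f₃) ^ 2 = 1 - a ^ 2 - b ^ 2 := by
      linear_combination hn - 2 * a * ha - 2 * b * hb + a ^ 2 * hg + b ^ 2 * hf + 2 * a * b * hgf
    have := add_nonneg (add_nonneg (sq_nonneg (n₁ - a * g₁ - b * f₁))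
      (sq_nonneg (n₂ - a * g₂ - b * f₂))) (sq_nonneg (n₃ - a * g₃ - b * f₃))
    linarith
  · intro h
    -- The missing length is supplied along the cross product of the two orthonormal vectors.
    set k := √(1 - a ^ 2 - b ^ 2) with hk
    have hk2 : k ^ 2 = 1 - a ^ 2 - b ^ 2 := Real.sq_sqrt (by linarith)
    refine ⟨a * g₁ + b * f₁ + k * (g₂ * f₃ - g₃ * f₂), a * g₂ + b * f₂ + k * (g₃ * f₁ - g₁ * f₃),
      a * g₃ + b * f₃ + k * (g₁ * f₂ - g₂ * f₁), ?_, ?_, ?_⟩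
    · have hh : (g₂ * f₃ - g₃ * f₂) ^ 2 + (g₃ * f₁ - g₁ * f₃) ^ 2 + (g₁ * f₂ - g₂ * f₁) ^ 2 = 1 := by
        linear_combination (f₁ ^ 2 + f₂ ^ 2 + f₃ ^ 2) * hg + hf -
          (g₁ * f₁ + g₂ * f₂ + g₃ * f₃) * hgf
      linear_combination a ^ 2 * hg + b ^ 2 * hf + 2 * a * b * hgf + k ^ 2 * hh + hk2
    · linear_combination a * hg + b * hgf
    · linear_combination a * hgf + b * hf

/-- This map is the Lorentz boost of velocity `m` along the first coordinate, with `r` its Lorentz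
factor; it preserves the disk. -/
theorem translation_sq_add_sq_le {m r a b : ℝ} (hr : 0 < r) (hm : r ^ 2 * (1 - m ^ 2) = 1)
    (hpos : 0 < 1 + m * a) (hab : a ^ 2 + b ^ 2 ≤ 1) :
    ((a + m) / (1 + m * a)) ^ 2 + (b / (r * (1 + m * a))) ^ 2 ≤ 1 := by
  have h1 : b ^ 2 + r ^ 2 * (a + m) ^ 2 ≤ r ^ 2 * (1 + m * a) ^ 2 := by
    have : r ^ 2 * (1 + m * a) ^ 2 - r ^ 2 * (a + m) ^ 2 = 1 - a ^ 2 := by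
      linear_combination (1 - a ^ 2) * hm
    linarith
  generalize 1 + m * a = k at *
  have e : ((a + m) / k) ^ 2 + (b / (r * k)) ^ 2 = (b ^ 2 + r ^ 2 * (a + m) ^ 2) / (r ^ 2 * k ^ 2) := by
    field_simp
    ring
  rw [e]
  exact div_le_one_of_le₀ h1 (by positivity)

/-- Only the coordinates `a`, `b` of a sphere point along `g = (C, S, -t)/r` and `f = (t, 0, C)/P`
enter. These fill the unit disk, and the point of the range is the boost of `(a, b)` by `m = t/r`
followed by scaling with the semi-axes. Both `L⁺` and `L⁻` are covered, since only `Re y` and `|y|`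
matter. -/
theorem conformalRange_eq_ellipticDisk {C S t : ℝ} {y : ℂ} (ht : 0 ≤ t) (hCS : C ^ 2 + S ^ 2 = 1)
    (hy : y.re = -C) (hy1 : ‖y‖ ^ 2 = 1) :
    conformalRange !![(C : ℂ) + Complex.I * (S : ℂ), 2 * (t : ℂ); 0, y] =
      ellipticDisk (√(C ^ 2 + t ^ 2) / √(1 + t ^ 2)) (t / √(1 + t ^ 2)) := by
  have hx1 : ‖(C : ℂ) + Complex.I * (S : ℂ)‖ ^ 2 = 1 := by
    rw [Complex.sq_norm, Complex.normSq_apply]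
    simp
    linear_combination hCS
  have hxre : ((C : ℂ) + Complex.I * (S : ℂ)).re = C := by simp
  have hxim : ((C : ℂ) + Complex.I * (S : ℂ)).im = S := by simp
  have h2t : (2 : ℂ) * (t : ℂ) = ((2 * t : ℝ) : ℂ) := by push_cast; rfl
  have hr0 : 0 < √(1 + t ^ 2) := Real.sqrt_pos.2 (by positivity)
  have hr2 : √(1 + t ^ 2) ^ 2 = 1 + t ^ 2 := Real.sq_sqrt (by positivity)
  have hP0 : 0 ≤ √(C ^ 2 + t ^ 2) := Real.sqrt_nonneg _
  have hP2 : √(C ^ 2 + t ^ 2) ^ 2 = C ^ 2 + t ^ 2 := Real.sq_sqrt (by positivity)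
  generalize √(1 + t ^ 2) = r at *
  generalize √(C ^ 2 + t ^ 2) = P at *
  obtain ⟨f₁, f₃, hf, hf1, hf3, hCf⟩ : ∃ f₁ f₃ : ℝ, f₁ ^ 2 + f₃ ^ 2 = 1 ∧ P * f₁ = t ∧
      P * f₃ = C ∧ C * f₁ = t * f₃ := by
    -- For `P = 0` also `C = t = 0`, and any unit vector orthogonal to `g` serves as `f`.
    rcases hP0.eq_or_lt with h0 | h0
    · rw [← h0] at hP2
      have hC : C = 0 := by nlinarith [sq_nonneg C, sq_nonneg t]
      have ht : t = 0 := by nlinarith [sq_nonneg C, sq_nonneg t]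
      exact ⟨1, 0, by norm_num, by rw [← h0, ht]; ring, by rw [hC]; ring, by rw [hC, ht]; ring⟩
    · refine ⟨t / P, C / P, ?_, by field_simp, by field_simp, by ring⟩
      rw [div_pow, div_pow, ← add_div, hP2, add_comm, div_self]
      rw [← hP2]
      positivity
  obtain ⟨m, hm⟩ : ∃ m, m = t / r := ⟨_, rfl⟩
  have hmr : m * r = t := by rw [hm]; field_simp
  have hm0 : 0 ≤ m := by rw [hm]; positivity
  have hm2 : r ^ 2 * (1 - m ^ 2) = 1 := by linear_combination hr2 - (m * r + t) * hmr
  have hm1 : m < 1 := by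
    have : 0 < 1 - m ^ 2 := pos_of_mul_pos_right (by rw [hm2]; exact one_pos) (sq_nonneg r)
    nlinarith
  have hg : (C / r) ^ 2 + (S / r) ^ 2 + (-t / r) ^ 2 = 1 := by
    field_simp
    linear_combination hCS - hr2
  have hgf : C / r * f₁ + S / r * 0 + -t / r * f₃ = 0 := by
    field_simp
    linear_combination hCf
  have hf' : f₁ ^ 2 + 0 ^ 2 + f₃ ^ 2 = 1 := by linear_combination hf
  have hpt : ∀ {n₁ n₂ n₃ a b : ℝ}, C / r * n₁ + S / r * n₂ + -t / r * n₃ = a →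
      f₁ * n₁ + 0 * n₂ + f₃ * n₃ = b → 0 < 1 + m * a →
      dehomog (C * (1 + n₃) + -C * (1 - n₃) + 2 * t * n₁,
          (1 * (1 + n₃) + (1 + (2 * t) ^ 2) * (1 - n₃)) / 2 + 2 * t * (C * n₁ + S * n₂) - 1,
          (1 * (1 + n₃) + (1 + (2 * t) ^ 2) * (1 - n₃)) / 2 + 2 * t * (C * n₁ + S * n₂) + 1) =
        (P / r * (b / (r * (1 + m * a))), m * ((a + m) / (1 + m * a))) := by
    intro n₁ n₂ n₃ a b ha hb hpos
    have ha' : C * n₁ + S * n₂ - t * n₃ = r * a := by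
      rw [← ha]
      field_simp
      ring
    have hW : (1 * (1 + n₃) + (1 + (2 * t) ^ 2) * (1 - n₃)) / 2 + 2 * t * (C * n₁ + S * n₂) + 1 =
        2 * (r ^ 2 * (1 + m * a)) := by
      linear_combination 2 * t * ha' - 2 * hr2 - 2 * a * r * hmr
    have hX : C * (1 + n₃) + -C * (1 - n₃) + 2 * t * n₁ = 2 * (P * b) := by
      linear_combination 2 * P * hb - 2 * n₁ * hf1 - 2 * n₃ * hf3
    have hZ : (1 * (1 + n₃) + (1 + (2 * t) ^ 2) * (1 - n₃)) / 2 + 2 * t * (C * n₁ + S * n₂) - 1 =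
        2 * (r ^ 2 * (m * (a + m))) := by
      linear_combination hW + 2 * hm2
    simp only [dehomog, hW, hX, hZ]
    ext
    · field_simp
    · field_simp
  ext q
  rw [h2t, mem_conformalRange_triangular, hxre, hxim, hx1, hy, hy1]
  have hden : ∀ {a b : ℝ}, a ^ 2 + b ^ 2 ≤ 1 → 0 < 1 + m * a := by
    intro a b hab
    have : -1 ≤ a := (abs_le.1 ((sq_le_one_iff_abs_le_one a).1 (by linarith [sq_nonneg b]))).1
    linarith [mul_le_mul_of_nonneg_left this hm0]
  rw [← hm]
  constructor
  · rintro ⟨n₁, n₂, n₃, hn, rfl⟩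
    obtain ⟨a, ha⟩ : ∃ a, C / r * n₁ + S / r * n₂ + -t / r * n₃ = a := ⟨_, rfl⟩
    obtain ⟨b, hb⟩ : ∃ b, f₁ * n₁ + 0 * n₂ + f₃ * n₃ = b := ⟨_, rfl⟩
    have hab := (exists_sphere_coordinates hg hf' hgf).1 ⟨n₁, n₂, n₃, hn, ha, hb⟩
    have hpos := hden hab
    refine ⟨b / (r * (1 + m * a)), (a + m) / (1 + m * a), ?_, hpt ha hb hpos⟩
    rw [add_comm]
    exact translation_sq_add_sq_le hr0 hm2 hpos hab
  · rintro ⟨u, v, huv, rfl⟩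
    have hv : v ≤ 1 := (abs_le.1 ((sq_le_one_iff_abs_le_one v).1 (by linarith [sq_nonneg u]))).2
    have hpos : 0 < 1 - m * v := by linarith [mul_le_mul_of_nonneg_left hv hm0]
    -- The inverse boost, of velocity `-m`, recovers the sphere coordinates.
    have hab : ((v - m) / (1 - m * v)) ^ 2 + (u / (r * (1 - m * v))) ^ 2 ≤ 1 := by
      have := translation_sq_add_sq_le (m := -m) (a := v) (b := u) hr0 (by rwa [neg_sq])
        (by linarith) (by linarith)
      rwa [← sub_eq_add_neg, neg_mul, ← sub_eq_add_neg] at this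
    have ea : (v - m) / (1 - m * v) * (1 - m * v) = v - m := div_mul_cancel₀ _ hpos.ne'
    have eb : u / (r * (1 - m * v)) * (r * (1 - m * v)) = u := div_mul_cancel₀ _ (by positivity)
    generalize (v - m) / (1 - m * v) = a at *
    generalize u / (r * (1 - m * v)) = b at *
    obtain ⟨n₁, n₂, n₃, hn, ha, hb⟩ := (exists_sphere_coordinates hg hf' hgf).2 hab
    refine ⟨n₁, n₂, n₃, hn, ?_⟩
    have hpos2 := hden hab
    rw [hpt ha hb hpos2]
    have e1 : b / (r * (1 + m * a)) = u := by
      rw [div_eq_iff (by positivity)]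
      linear_combination (-r ^ 2 * b * m) * ea + r * (1 + m * a) * eb - b * hm2
    have e2 : (a + m) / (1 + m * a) = v := by
      rw [div_eq_iff (by positivity)]
      linear_combination ea
    rw [e1, e2]

/-! ### Lengths of chords -/

theorem artanh_neg_eq {r : ℝ} (hr : r ∈ Set.Ioo (-1) 1) : Real.artanh (-r) = -Real.artanh r := by
  nth_rw 1 [← Real.tanh_artanh hr]
  rw [← Real.tanh_neg, Real.artanh_tanh]

/-- The hyperbolic cosine of the distance of two ordinary points. -/
noncomputable def coshDist (p q : ℝ × ℝ) : ℝ :=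
  (1 - p.1 * q.1 - p.2 * q.2) / (√(1 - p.1 ^ 2 - p.2 ^ 2) * √(1 - q.1 ^ 2 - q.2 ^ 2))

theorem sqrt_form_pos {p : ℝ × ℝ} (hp : IsOrdinary p) : 0 < √(1 - p.1 ^ 2 - p.2 ^ 2) := by
  have : p.1 ^ 2 + p.2 ^ 2 < 1 := hp
  exact Real.sqrt_pos.2 (by linarith)

theorem sq_sqrt_form {p : ℝ × ℝ} (hp : IsOrdinary p) :
    √(1 - p.1 ^ 2 - p.2 ^ 2) ^ 2 = 1 - p.1 ^ 2 - p.2 ^ 2 := by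
  have : p.1 ^ 2 + p.2 ^ 2 < 1 := hp
  exact Real.sq_sqrt (by linarith)

/-- Reversed Cauchy--Schwarz: `(1 - p·q)² - (1-|p|²)(1-|q|²) = (1-|p|²)|p-q|² + (p·(p-q))²`. -/
theorem one_le_coshDist {p q : ℝ × ℝ} (hp : IsOrdinary p) (hq : IsOrdinary q) :
    1 ≤ coshDist p q := by
  have h1 := sqrt_form_pos hp
  have h2 := sqrt_form_pos hq
  have hp' : p.1 ^ 2 + p.2 ^ 2 < 1 := hp
  have hq' : q.1 ^ 2 + q.2 ^ 2 < 1 := hq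
  rw [coshDist, one_le_div (by positivity)]
  refine (sq_le_sq₀ (by positivity) ?_).1 ?_
  swap
  · rw [mul_pow, sq_sqrt_form hp, sq_sqrt_form hq]
    have h3 := mul_nonneg (sub_nonneg.2 hp'.le)
      (add_nonneg (sq_nonneg (p.1 - q.1)) (sq_nonneg (p.2 - q.2)))
    have h4 := sq_nonneg (p.1 * (p.1 - q.1) + p.2 * (p.2 - q.2))
    linarith
  · nlinarith [sq_nonneg (p.1 - q.1), sq_nonneg (p.2 - q.2)]

theorem coshDist_self {p : ℝ × ℝ} (hp : IsOrdinary p) : coshDist p p = 1 := by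
  have h1 := sqrt_form_pos hp
  rw [coshDist, ← pow_two (√_), sq_sqrt_form hp, ← pow_two, ← pow_two, div_self]
  rw [← sq_sqrt_form hp]
  positivity

theorem hDist_of_isOrdinary {p q : ℝ × ℝ} (hp : IsOrdinary p) (hq : IsOrdinary q) :
    hDist p q = ENNReal.ofReal (Real.arcosh (coshDist p q)) := by
  unfold hDist
  split_ifs with h h2
  · subst h
    rw [coshDist_self hp]
    simp
  · rfl
  · exact absurd ⟨hp, hq⟩ h2

theorem hDist_le_iff {p q p' q' : ℝ × ℝ} (hp : IsOrdinary p) (hq : IsOrdinary q)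
    (hp' : IsOrdinary p') (hq' : IsOrdinary q') :
    hDist p q ≤ hDist p' q' ↔ coshDist p q ≤ coshDist p' q' := by
  have h1 := one_le_coshDist hp hq
  have h2 := one_le_coshDist hp' hq'
  rw [hDist_of_isOrdinary hp hq, hDist_of_isOrdinary hp' hq',
    ENNReal.ofReal_le_ofReal_iff (Real.arcosh_nonneg h2),
    Real.arcosh_le_arcosh (by linarith) (by linarith)]

theorem hDist_eq_iff {p q p' q' : ℝ × ℝ} (hp : IsOrdinary p) (hq : IsOrdinary q)
    (hp' : IsOrdinary p') (hq' : IsOrdinary q') :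
    hDist p q = hDist p' q' ↔ coshDist p q = coshDist p' q' := by
  rw [le_antisymm_iff, le_antisymm_iff, hDist_le_iff hp hq hp' hq', hDist_le_iff hp' hq' hp hq]

theorem hDist_eq_top {p q : ℝ × ℝ} (hp : IsAsymptotic p) (hpq : p ≠ q) : hDist p q = ⊤ := by
  unfold hDist
  rw [if_neg hpq, if_neg]
  rintro ⟨h, -⟩
  exact (ne_of_lt h) hp

theorem hLength_eq_top {S : Set (ℝ × ℝ)} {p q : ℝ × ℝ} (hp : p ∈ S) (hq : q ∈ S)
    (ha : IsAsymptotic p) (hpq : p ≠ q) : hLength S = ⊤ := by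
  rw [eq_top_iff, ← hDist_eq_top ha hpq]
  exact le_iSup₂_of_le p hp (le_iSup₂_of_le q hq le_rfl)

/-- A parametrization of a chord of direction `(a, b)` at signed distance `c` from the origin,
with half-length `k`. -/
def chordPoint (a b c k r : ℝ) : ℝ × ℝ := (-c * b + k * r * a, c * a + k * r * b)

theorem form_chordPoint {a b c k : ℝ} (hab : a ^ 2 + b ^ 2 = 1) (hck : c ^ 2 + k ^ 2 = 1)
    (r s : ℝ) : 1 - (chordPoint a b c k r).1 * (chordPoint a b c k s).1 -
      (chordPoint a b c k r).2 * (chordPoint a b c k s).2 = k ^ 2 * (1 - r * s) := by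
  simp only [chordPoint]
  linear_combination (-(c ^ 2) - k ^ 2 * r * s) * hab - hck

theorem isOrdinary_chordPoint {a b c k r : ℝ} (hab : a ^ 2 + b ^ 2 = 1) (hck : c ^ 2 + k ^ 2 = 1)
    (hk : 0 < k) (hr : r ∈ Set.Ioo (-1) 1) : IsOrdinary (chordPoint a b c k r) := by
  have h := form_chordPoint hab hck r r
  have h1 : 0 < 1 - r * r := by nlinarith [hr.1, hr.2]
  have h2 : 0 < k ^ 2 * (1 - r * r) := by positivity
  unfold IsOrdinary
  nlinarith

/-- On a chord the form is `k²(1 - rs)`, and `k²` cancels in the distance formula; what remains is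
the addition formula for `cosh (artanh r - artanh s)`. -/
theorem hDist_chordPoint {a b c k r s : ℝ} (hab : a ^ 2 + b ^ 2 = 1) (hck : c ^ 2 + k ^ 2 = 1)
    (hk : 0 < k) (hr : r ∈ Set.Ioo (-1) 1) (hs : s ∈ Set.Ioo (-1) 1) :
    hDist (chordPoint a b c k r) (chordPoint a b c k s) =
      ENNReal.ofReal |Real.artanh r - Real.artanh s| := by
  have hroot : ∀ {t : ℝ}, √(1 - (chordPoint a b c k t).1 ^ 2 - (chordPoint a b c k t).2 ^ 2) =
      k * √(1 - t ^ 2) := by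
    intro t
    rw [pow_two, pow_two, form_chordPoint hab hck, Real.sqrt_mul (sq_nonneg k), Real.sqrt_sq hk.le,
      pow_two]
  rw [hDist_of_isOrdinary (isOrdinary_chordPoint hab hck hk hr)
    (isOrdinary_chordPoint hab hck hk hs), coshDist, form_chordPoint hab hck, hroot, hroot]
  congr 1
  rw [← Real.arcosh_cosh (abs_nonneg (Real.artanh r - Real.artanh s)), Real.cosh_abs,
    Real.cosh_sub, Real.cosh_artanh hr, Real.cosh_artanh hs, Real.sinh_artanh hr,
    Real.sinh_artanh hs]
  congr 1
  have h1 : 0 < √(1 - r ^ 2) := Real.sqrt_pos.2 (by nlinarith [hr.1, hr.2])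
  have h2 : 0 < √(1 - s ^ 2) := Real.sqrt_pos.2 (by nlinarith [hs.1, hs.2])
  field_simp

theorem abs_le_mem_Ioo {r q : ℝ} (hq : q < 1) (hr : |r| ≤ q) : r ∈ Set.Ioo (-1) 1 := by
  have := abs_le.1 hr
  exact ⟨by linarith, by linarith⟩

theorem hLength_le_of_subset_chord {a b c k q : ℝ} (hab : a ^ 2 + b ^ 2 = 1)
    (hck : c ^ 2 + k ^ 2 = 1) (hk : 0 < k) (hq : q < 1) {S : Set (ℝ × ℝ)}
    (hS : ∀ x ∈ S, ∃ r, |r| ≤ q ∧ x = chordPoint a b c k r) :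
    hLength S ≤ ENNReal.ofReal (2 * Real.artanh q) := by
  refine iSup₂_le fun x hx => iSup₂_le fun y hy => ?_
  obtain ⟨r, hr, rfl⟩ := hS x hx
  obtain ⟨s, hs, rfl⟩ := hS y hy
  have hr' := abs_le_mem_Ioo hq hr
  have hs' := abs_le_mem_Ioo hq hs
  rw [hDist_chordPoint hab hck hk hr' hs']
  refine ENNReal.ofReal_le_ofReal ?_
  have hq0 : 0 ≤ q := (abs_nonneg r).trans hr
  have key : ∀ {t : ℝ}, |t| ≤ q → |Real.artanh t| ≤ Real.artanh q := by
    intro t ht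
    have ht' := abs_le_mem_Ioo hq ht
    obtain ⟨h1, h2⟩ := abs_le.1 ht
    rw [abs_le]
    refine ⟨?_, Real.artanh_le_artanh ht'.1 hq h2⟩
    rw [← artanh_neg_eq ⟨by linarith, hq⟩]
    exact Real.artanh_le_artanh (by linarith) ht'.2 h1
  calc |Real.artanh r - Real.artanh s| ≤ |Real.artanh r| + |Real.artanh s| := abs_sub _ _
    _ ≤ 2 * Real.artanh q := by linarith [key hr, key hs]

theorem le_hLength_of_chord_mem {a b c k q : ℝ} (hab : a ^ 2 + b ^ 2 = 1)
    (hck : c ^ 2 + k ^ 2 = 1) (hk : 0 < k) (hq0 : 0 ≤ q) (hq : q < 1) {S : Set (ℝ × ℝ)}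
    (h1 : chordPoint a b c k q ∈ S) (h2 : chordPoint a b c k (-q) ∈ S) :
    ENNReal.ofReal (2 * Real.artanh q) ≤ hLength S := by
  have hq' : q ∈ Set.Ioo (-1) 1 := ⟨by linarith, hq⟩
  have h := hDist_chordPoint hab hck hk hq' (s := -q) ⟨by linarith, by linarith⟩
  rw [artanh_neg_eq hq', sub_neg_eq_add, ← two_mul,
    abs_of_nonneg (mul_nonneg two_pos.le (Real.artanh_nonneg hq0))] at h
  rw [← h]
  exact le_iSup₂_of_le _ h1 (le_iSup₂_of_le _ h2 le_rfl)

theorem hLength_chord {a b c k q : ℝ} (hab : a ^ 2 + b ^ 2 = 1)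
    (hck : c ^ 2 + k ^ 2 = 1) (hk : 0 < k) (hq0 : 0 ≤ q) (hq : q < 1) :
    hLength {x | ∃ r, |r| ≤ q ∧ x = chordPoint a b c k r} = ENNReal.ofReal (2 * Real.artanh q) :=
  le_antisymm (hLength_le_of_subset_chord hab hck hk hq fun _ h => h)
    (le_hLength_of_chord_mem hab hck hk hq0 hq ⟨q, (abs_of_nonneg hq0).le, rfl⟩
      ⟨-q, by rw [abs_neg, abs_of_nonneg hq0], rfl⟩)

theorem ofReal_two_mul_div_two (x : ℝ) : ENNReal.ofReal (2 * x) / 2 = ENNReal.ofReal x := by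
  rw [ENNReal.ofReal_mul two_pos.le, ENNReal.ofReal_ofNat, mul_comm,
    ENNReal.mul_div_cancel_right two_ne_zero ENNReal.ofNat_ne_top]

theorem hLength_diameter {a b q : ℝ} (hab : a ^ 2 + b ^ 2 = 1) (hq0 : 0 ≤ q) (hq : q < 1)
    {S : Set (ℝ × ℝ)} (hS : ∀ x, x ∈ S ↔ ∃ r, |r| ≤ q ∧ x = (r * a, r * b)) :
    hLength S / 2 = ENNReal.ofReal (Real.artanh q) := by
  rw [← ofReal_two_mul_div_two,
    ← hLength_chord (c := 0) (k := 1) hab (by norm_num) one_pos hq0 hq]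
  congr 2
  ext x
  simp [hS, chordPoint]

/-! ### Semi-axes of elliptical disks centered at the origin -/

theorem sq_add_sq_le_of_mem_ellipticDisk {p m : ℝ} (hm : 0 ≤ m) (hmp : m ≤ p) {x : ℝ × ℝ}
    (hx : x ∈ ellipticDisk p m) : x.1 ^ 2 + x.2 ^ 2 ≤ p ^ 2 := by
  obtain ⟨u, v, huv, rfl⟩ := hx
  have h1 : m ^ 2 ≤ p ^ 2 := pow_le_pow_left₀ hm hmp 2
  show (p * u) ^ 2 + (m * v) ^ 2 ≤ p ^ 2
  nlinarith [mul_le_mul_of_nonneg_right h1 (sq_nonneg v), mul_le_mul_of_nonneg_left huv (sq_nonneg p)]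

theorem isOrdinary_of_mem_ellipticDisk {p m : ℝ} (hm : 0 ≤ m) (hmp : m ≤ p) (hp : p < 1)
    {x : ℝ × ℝ} (hx : x ∈ ellipticDisk p m) : IsOrdinary x := by
  have h1 := sq_add_sq_le_of_mem_ellipticDisk hm hmp hx
  have h2 : p ^ 2 < 1 := by nlinarith
  exact lt_of_le_of_lt h1 h2

/-- Uniqueness of the smallest disk. Let `N = √(1-|M|²)`, `g = √(1-p²)` and let `C` be the `cosh` of
the radius. Covering `(±p, 0)` forces `1 ≤ CNg`, while a center on the segment `PQ` forces `Cg ≤ N`.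
Together `N² ≥ 1`, so `M = 0`, and equality holds throughout. -/
theorem eq_zero_of_disk_bounds {p : ℝ} {P Q M : ℝ × ℝ} (hp1 : p < 1) (hp0 : 0 ≤ p)
    (hP : P.1 ^ 2 + P.2 ^ 2 ≤ p ^ 2) (hQ : Q.1 ^ 2 + Q.2 ^ 2 ≤ p ^ 2)
    (hM : M ∈ segment ℝ P Q) (hMo : IsOrdinary M) (hMPQ : coshDist M P = coshDist M Q)
    (h1 : coshDist M (p, 0) ≤ coshDist M P) (h2 : coshDist M (-p, 0) ≤ coshDist M P) :
    M = 0 ∧ P.1 ^ 2 + P.2 ^ 2 = p ^ 2 ∧ Q.1 ^ 2 + Q.2 ^ 2 = p ^ 2 := by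
  have hpp : p ^ 2 < 1 := by nlinarith
  have hPo : IsOrdinary P := lt_of_le_of_lt hP hpp
  have hQo : IsOrdinary Q := lt_of_le_of_lt hQ hpp
  obtain ⟨s, t, hs, ht, hst, rfl⟩ := hM
  set M := s • P + t • Q with hMdef
  have hM1 : M.1 = s * P.1 + t * Q.1 := by simp [hMdef]
  have hM2 : M.2 = s * P.2 + t * Q.2 := by simp [hMdef]
  obtain ⟨C, hC⟩ : ∃ C, C = coshDist M P := ⟨_, rfl⟩
  have hC1 : 1 ≤ C := hC ▸ one_le_coshDist hMo hPo
  have hg2 : √(1 - p ^ 2) ^ 2 = 1 - p ^ 2 := Real.sq_sqrt (by linarith)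
  have hg0 : 0 < √(1 - p ^ 2) := Real.sqrt_pos.2 (by linarith)
  have hgA : √(1 - p ^ 2) ≤ √(1 - P.1 ^ 2 - P.2 ^ 2) := Real.sqrt_le_sqrt (by linarith)
  have hgB : √(1 - p ^ 2) ≤ √(1 - Q.1 ^ 2 - Q.2 ^ 2) := Real.sqrt_le_sqrt (by linarith)
  have hA2 := sq_sqrt_form hPo
  have hB2 := sq_sqrt_form hQo
  have hN2 := sq_sqrt_form hMo
  have hA0 := sqrt_form_pos hPo
  have hB0 := sqrt_form_pos hQo
  have hN0 := sqrt_form_pos hMo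
  have eP := hC
  have eQ := hC.trans hMPQ
  rw [← hC] at h1 h2
  rw [coshDist] at eP eQ h1 h2
  simp only [mul_zero, sub_zero, zero_pow two_ne_zero, mul_neg, sub_neg_eq_add, neg_sq] at h1 h2
  generalize √(1 - p ^ 2) = g at *
  generalize √(1 - P.1 ^ 2 - P.2 ^ 2) = A at *
  generalize √(1 - Q.1 ^ 2 - Q.2 ^ 2) = B at *
  generalize √(1 - M.1 ^ 2 - M.2 ^ 2) = N at *
  rw [eq_div_iff (by positivity)] at eP eQ
  rw [div_le_iff₀ (by positivity)] at h1 h2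
  -- The average of the two bounds: the terms `±p M.1` cancel.
  have k1 : 1 ≤ C * (N * g) := by linarith
  -- Pair `M` with its own expression as a convex combination of `P` and `Q`, which have the same
  -- distance from `M`.
  have k2 : N = C * (s * A + t * B) := by
    have : N * N = N * (C * (s * A + t * B)) := by
      have e : N ^ 2 = s * (1 - M.1 * P.1 - M.2 * P.2) + t * (1 - M.1 * Q.1 - M.2 * Q.2) := by
        rw [hN2]
        linear_combination -M.1 * hM1 - M.2 * hM2 - hst
      rw [← eP, ← eQ] at e
      linear_combination e
    exact mul_left_cancel₀ hN0.ne' this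
  have k3 : g ≤ s * A + t * B := by
    have : g = s * g + t * g := by rw [← add_mul, hst, one_mul]
    rw [this]
    exact add_le_add (mul_le_mul_of_nonneg_left hgA hs) (mul_le_mul_of_nonneg_left hgB ht)
  have k4 : C * g ≤ N := by
    rw [k2]
    exact mul_le_mul_of_nonneg_left k3 (by linarith)
  have k5 : 1 ≤ N ^ 2 := by linarith [mul_le_mul_of_nonneg_left k4 hN0.le]
  have hM10 : M.1 = 0 := by
    refine pow_eq_zero_iff two_ne_zero |>.1 (le_antisymm ?_ (sq_nonneg _))
    linarith [sq_nonneg M.2]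
  have hM20 : M.2 = 0 := by
    refine pow_eq_zero_iff two_ne_zero |>.1 (le_antisymm ?_ (sq_nonneg _))
    linarith [sq_nonneg M.1]
  have hN1 : N = 1 := by
    rw [hM10, hM20] at hN2
    refine (pow_eq_one_iff_of_nonneg hN0.le two_ne_zero).1 ?_
    linarith
  rw [hN1, hM10, hM20] at eP eQ
  rw [hN1] at k1 k4
  have hCg : C * g = 1 := by linarith
  have hC0 : C ≠ 0 := by linarith
  have hAg : A = g := mul_left_cancel₀ hC0 (by linarith)
  have hBg : B = g := mul_left_cancel₀ hC0 (by linarith)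
  refine ⟨Prod.ext hM10 hM20, ?_, ?_⟩
  · rw [hAg] at hA2
    linarith
  · rw [hBg] at hB2
    linarith

theorem mem_ellipticDisk_self {p : ℝ} (hp : 0 < p) {x : ℝ × ℝ} :
    x ∈ ellipticDisk p p ↔ x.1 ^ 2 + x.2 ^ 2 ≤ p ^ 2 := by
  refine ⟨sq_add_sq_le_of_mem_ellipticDisk hp.le le_rfl, fun h => ?_⟩
  refine ⟨x.1 / p, x.2 / p, ?_, ?_⟩
  · rw [div_pow, div_pow, ← add_div]
    exact div_le_one_of_le₀ h (by positivity)
  · ext <;> field_simp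

theorem zero_mem_ellipticDisk (p m : ℝ) : (0 : ℝ × ℝ) ∈ ellipticDisk p m :=
  ⟨0, 0, by norm_num, by ext <;> simp⟩

/-- The bisector of two antipodal points is the perpendicular diameter. The direction `(a, b)` is
left arbitrary because for `m = p` every diameter is a major axis; for `m < p` membership of the
endpoint forces `b = 0`. -/
theorem hLength_inter_hBisector {p m a b : ℝ} (hm : 0 ≤ m) (hmp : m ≤ p) (hp : p < 1)
    (hab : a ^ 2 + b ^ 2 = 1) (hmem : (p * a, p * b) ∈ ellipticDisk p m) :
    hLength (ellipticDisk p m ∩ hBisector (p * a, p * b) (-(p * a), -(p * b))) / 2 =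
      ENNReal.ofReal (Real.artanh m) := by
  have hm1 : m < 1 := lt_of_le_of_lt hmp hp
  refine hLength_diameter (a := -b) (b := a) (by linarith) hm hm1 fun x => ?_
  have hp0 : 0 ≤ p := hm.trans hmp
  have hPo := isOrdinary_of_mem_ellipticDisk hm hmp hp hmem
  have hQo : IsOrdinary (-(p * a), -(p * b)) := by
    unfold IsOrdinary at *
    simpa using hPo
  have hbis : ∀ {y : ℝ × ℝ}, IsOrdinary y →
      (y ∈ hBisector (p * a, p * b) (-(p * a), -(p * b)) ↔ p * (y.1 * a + y.2 * b) = 0) := by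
    intro y hy
    simp only [hBisector, Set.mem_ofPred_eq, hy, true_and]
    rw [hDist_eq_iff hy hPo hy hQo, coshDist, coshDist]
    have h1 := sqrt_form_pos hy
    have h2 := sqrt_form_pos hPo
    simp only [neg_sq] at h2 ⊢
    rw [div_left_inj' (by positivity)]
    constructor <;> intro h <;> linarith
  rcases hp0.eq_or_lt with h0 | h0
  · have hm0 : m = 0 := by linarith
    subst hm0
    constructor
    · rintro ⟨⟨u, v, huv, rfl⟩, -⟩
      exact ⟨0, by simp, by simp [← h0]⟩
    · rintro ⟨r, hr, rfl⟩
      have hr0 : r = 0 := abs_nonpos_iff.1 hr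
      subst hr0
      have hz : ((0 * -b, 0 * a) : ℝ × ℝ) = 0 := by simp
      rw [hz]
      refine ⟨zero_mem_ellipticDisk _ _, (hbis ?_).2 (by simp [← h0])⟩
      simp [IsOrdinary]
  · have key : (x ∈ ellipticDisk p m ∧ x.1 * a + x.2 * b = 0) ↔
        ∃ r, |r| ≤ m ∧ x = (r * -b, r * a) := by
      rcases hmp.eq_or_lt with h1 | h1
      · subst h1
        rw [mem_ellipticDisk_self h0]
        constructor
        · rintro ⟨hx, hx2⟩
          refine ⟨x.2 * a - x.1 * b, ?_, ?_⟩
          · rw [← abs_of_nonneg hm, ← sq_le_sq]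
            nlinarith
          · ext
            · show x.1 = (x.2 * a - x.1 * b) * -b
              linear_combination a * hx2 - x.1 * hab
            · show x.2 = (x.2 * a - x.1 * b) * a
              linear_combination b * hx2 - x.2 * hab
        · rintro ⟨r, hr, rfl⟩
          rw [← abs_of_nonneg hm, ← sq_le_sq] at hr
          refine ⟨?_, by simp only; ring⟩
          simp only
          nlinarith
      · have hb : b = 0 := by
          obtain ⟨u, v, huv, e⟩ := hmem
          simp only [Prod.mk.injEq] at e
          obtain ⟨e1, e2⟩ := e
          have hua : a = u := mul_left_cancel₀ h0.ne' e1
          have hmp2 : m ^ 2 < p ^ 2 := pow_lt_pow_left₀ h1 hm two_ne_zero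
          have hbv : b ^ 2 ≥ v ^ 2 := by
            rw [hua] at hab
            linarith
          have e3 : p ^ 2 * b ^ 2 = m ^ 2 * v ^ 2 := by
            rw [← mul_pow, ← mul_pow, e2]
          have e4 : (p ^ 2 - m ^ 2) * b ^ 2 ≤ 0 := by
            nlinarith [mul_le_mul_of_nonneg_left hbv (sq_nonneg m)]
          by_contra hb
          have : 0 < b ^ 2 := by positivity
          nlinarith [mul_pos (sub_pos.2 hmp2) this]
        subst hb
        have ha2 : a * a = 1 := by linarith
        have ha0 : a ≠ 0 := left_ne_zero_of_mul (by rw [ha2]; exact one_ne_zero)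
        have ha1 : |a| = 1 := by
          have : |a| * |a| = 1 := by rw [← abs_mul, ha2, abs_one]
          nlinarith [abs_nonneg a]
        constructor
        · rintro ⟨⟨u, v, huv, rfl⟩, hx⟩
          simp only [mul_zero, add_zero, mul_eq_zero, ha0, or_false, h0.ne', false_or] at hx
          refine ⟨m * v * a, ?_, ?_⟩
          · rw [abs_mul, abs_mul, ha1, mul_one, abs_of_nonneg hm]
            refine mul_le_of_le_one_right hm ?_
            exact (sq_le_one_iff_abs_le_one v).1 (by linarith [sq_nonneg u])
          · ext
            · simp [hx]
            · show m * v = m * v * a * a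
              rw [mul_assoc, ha2, mul_one]
        · rintro ⟨r, hr, rfl⟩
          refine ⟨⟨0, r * a / m, ?_, ?_⟩, by simp⟩
          · have : |r * a / m| ≤ 1 := by
              rw [abs_div, abs_mul, ha1, mul_one, abs_of_nonneg hm]
              exact div_le_one_of_le₀ hr hm
            rw [zero_pow two_ne_zero, zero_add]
            exact (sq_le_one_iff_abs_le_one _).2 this
          · ext
            · simp
            · rcases hm.eq_or_lt with h2 | h2
              · rw [← h2] at hr
                have : r = 0 := abs_nonpos_iff.1 hr
                simp [this]
              · show r * a = m * (r * a / m)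
                field_simp
    rw [← key]
    constructor
    · rintro ⟨hx, hx2⟩
      have := (hbis (isOrdinary_of_mem_ellipticDisk hm hmp hp hx)).1 hx2
      exact ⟨hx, (mul_eq_zero.1 this).resolve_left h0.ne'⟩
    · rintro ⟨hx, hx2⟩
      exact ⟨hx, (hbis (isOrdinary_of_mem_ellipticDisk hm hmp hp hx)).2 (by rw [hx2, mul_zero])⟩

theorem mem_segment_neg {p a b : ℝ} (hp : 0 ≤ p) {x : ℝ × ℝ} :
    x ∈ segment ℝ (p * a, p * b) (-(p * a), -(p * b)) ↔ ∃ r, |r| ≤ p ∧ x = (r * a, r * b) := by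
  constructor
  · rintro ⟨s, t, hs, ht, hst, rfl⟩
    refine ⟨(s - t) * p, ?_, ?_⟩
    · rw [abs_mul, abs_of_nonneg hp]
      refine mul_le_of_le_one_left hp (abs_le.2 ⟨by linarith, by linarith⟩)
    · ext <;> simp <;> ring
  · rintro ⟨r, hr, rfl⟩
    rcases hp.eq_or_lt with h0 | h0
    · rw [← h0] at hr ⊢
      have : r = 0 := abs_nonpos_iff.1 hr
      simp [this]
    · obtain ⟨h1, h2⟩ := abs_le.1 hr
      refine ⟨(p + r) / (2 * p), (p - r) / (2 * p), ?_, ?_, ?_, ?_⟩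
      · exact div_nonneg (by linarith) (by linarith)
      · exact div_nonneg (by linarith) (by linarith)
      · field_simp
        ring
      · ext <;> simp <;> field_simp <;> ring

theorem hasSemiAxes_ellipticDisk_of_bounded {p m a b : ℝ} (hm : 0 ≤ m) (hmp : m ≤ p) (hp : p < 1)
    (hab : a ^ 2 + b ^ 2 = 1) (hmem : (p * a, p * b) ∈ ellipticDisk p m) :
    hLength (segment ℝ (p * a, p * b) (-(p * a), -(p * b))) / 2 =
        ENNReal.ofReal (Real.artanh p) ∧
      hLength (ellipticDisk p m ∩ hBisector (p * a, p * b) (-(p * a), -(p * b))) / 2 =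
        ENNReal.ofReal (Real.artanh m) :=
  ⟨hLength_diameter hab (hm.trans hmp) hp fun _ => mem_segment_neg (hm.trans hmp),
    hLength_inter_hBisector hm hmp hp hab hmem⟩

theorem hasSemiAxes_ellipticDisk_iff {p m : ℝ} (hm : 0 ≤ m) (hmp : m ≤ p) (hp : p < 1)
    {s t : ℝ≥0∞} : HasSemiAxes (ellipticDisk p m) s t ↔
      s = ENNReal.ofReal (Real.artanh p) ∧ t = ENNReal.ofReal (Real.artanh m) := by
  have hp0 : 0 ≤ p := hm.trans hmp
  have hord : ∀ x ∈ ellipticDisk p m, IsOrdinary x := fun x hx =>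
    isOrdinary_of_mem_ellipticDisk hm hmp hp hx
  have hnot : ∀ x ∈ ellipticDisk p m, ¬ IsAsymptotic x := fun x hx h => (ne_of_lt (hord x hx)) h
  have hvert : (p, 0) ∈ ellipticDisk p m := ⟨1, 0, by norm_num, by simp⟩
  have hvert' : (-p, 0) ∈ ellipticDisk p m := ⟨-1, 0, by norm_num, by simp⟩
  constructor
  · intro h
    cases h with
    | asymptoticPoint P hP hK => exact absurd hP (hnot P (by rw [hK]; rfl))
    | twoAsymptotic B C hB hC hBC hBK hCK l hl => exact absurd hB (hnot B hBK)
    | oneAsymptotic B hB hBK huniq hne l hl => exact absurd hB (hnot B hBK)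
    | bounded hK P Q M hPQ hM hMPQ hdisk =>
      have hPK := hPQ (left_mem_segment ℝ P Q)
      have hQK := hPQ (right_mem_segment ℝ P Q)
      have hMK := hPQ hM
      obtain ⟨hM0, hP2, hQ2⟩ := eq_zero_of_disk_bounds hp hp0
        (sq_add_sq_le_of_mem_ellipticDisk hm hmp hPK)
        (sq_add_sq_le_of_mem_ellipticDisk hm hmp hQK) hM (hK M hMK)
        ((hDist_eq_iff (hK M hMK) (hK P hPK) (hK M hMK) (hK Q hQK)).1 hMPQ)
        ((hDist_le_iff (hK M hMK) (hK _ hvert) (hK M hMK) (hK P hPK)).1 (hdisk hvert).2)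
        ((hDist_le_iff (hK M hMK) (hK _ hvert') (hK M hMK) (hK P hPK)).1 (hdisk hvert').2)
      obtain ⟨a, b, hab, rfl, rfl⟩ : ∃ a b : ℝ, a ^ 2 + b ^ 2 = 1 ∧ P = (p * a, p * b) ∧
          Q = (-(p * a), -(p * b)) := by
        rcases hp0.eq_or_lt with h0 | h0
        · rw [← h0] at hP2 hQ2 ⊢
          refine ⟨1, 0, by norm_num, ?_, ?_⟩
          · ext
            · simp
              nlinarith [sq_nonneg P.1, sq_nonneg P.2]
            · simp
              nlinarith [sq_nonneg P.1, sq_nonneg P.2]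
          · ext
            · simp
              nlinarith [sq_nonneg Q.1, sq_nonneg Q.2]
            · simp
              nlinarith [sq_nonneg Q.1, sq_nonneg Q.2]
        · obtain ⟨α, β, hα, hβ, hαβ, e⟩ := hM
          rw [hM0] at e
          have e1 := congrArg Prod.fst e
          have e2 := congrArg Prod.snd e
          simp at e1 e2
          -- From `αP + βQ = 0` and `|P| = |Q| = p`; thus the origin is the midpoint and `Q = -P`.
          have hsq : (α ^ 2 - β ^ 2) * p ^ 2 = 0 := by
            linear_combination (α * P.1 - β * Q.1) * e1 + (α * P.2 - β * Q.2) * e2 -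
              α ^ 2 * hP2 + β ^ 2 * hQ2
          have hα' : α ^ 2 - β ^ 2 = 0 := (mul_eq_zero.1 hsq).resolve_right (by positivity)
          have hαβ' : α = 1 / 2 := by
            have : (α - β) * (α + β) = 0 := by linear_combination hα'
            rw [hαβ, mul_one] at this
            linarith
          have hβ' : β = 1 / 2 := by linarith
          rw [hαβ', hβ'] at e1 e2
          refine ⟨P.1 / p, P.2 / p, ?_, ?_, ?_⟩
          · rw [div_pow, div_pow, ← add_div, hP2, div_self (by positivity)]
          · ext <;> field_simp
          · ext
            · field_simp
              linarith
            · field_simp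
              linarith
      exact hasSemiAxes_ellipticDisk_of_bounded hm hmp hp hab hPK
  · rintro ⟨rfl, rfl⟩
    have hmem : ((p * 1, p * 0) : ℝ × ℝ) ∈ ellipticDisk p m := by simpa using hvert
    obtain ⟨e1, e2⟩ := hasSemiAxes_ellipticDisk_of_bounded hm hmp hp (by norm_num) hmem
    rw [← e1, ← e2]
    have hMo : IsOrdinary 0 := hord 0 (zero_mem_ellipticDisk p m)
    have hPo := hord _ hmem
    have hQo : IsOrdinary (-(p * 1), -(p * 0)) := hord _ (by simpa using hvert')
    refine .bounded hord _ _ 0 ?_ ?_ ?_ ?_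
    · intro x hx
      obtain ⟨r, hr, rfl⟩ := (mem_segment_neg hp0).1 hx
      refine ⟨r / p, 0, ?_, ?_⟩
      · rw [zero_pow two_ne_zero, add_zero, sq_le_one_iff_abs_le_one, abs_div, abs_of_nonneg hp0]
        exact div_le_one_of_le₀ hr hp0
      · rcases hp0.eq_or_lt with h0 | h0
        · rw [← h0] at hr
          have : r = 0 := abs_nonpos_iff.1 hr
          simp [this]
        · ext
          · show r * 1 = p * (r / p)
            field_simp
          · simp
    · exact (mem_segment_neg hp0).2 ⟨0, by simpa using hp0, by ext <;> simp⟩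
    · rw [hDist_eq_iff hMo hPo hMo hQo]
      simp [coshDist]
    · intro x hx
      refine ⟨hord x hx, ?_⟩
      rw [hDist_le_iff hMo (hord x hx) hMo hPo, coshDist, coshDist]
      have h1 := sq_add_sq_le_of_mem_ellipticDisk hm hmp hx
      have hpp : p ^ 2 < 1 := by nlinarith
      simp only [Prod.fst_zero, Prod.snd_zero, zero_mul, sub_zero, zero_pow two_ne_zero,
        Real.sqrt_one, one_mul, mul_one, mul_zero]
      refine one_div_le_one_div_of_le (Real.sqrt_pos.2 (by linarith)) (Real.sqrt_le_sqrt ?_)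
      linarith

/-! ### Semi-axes of distance bands -/

theorem snd_eq_zero_of_isAsymptotic {m : ℝ} (hm : 0 ≤ m) (hm1 : m < 1) {x : ℝ × ℝ}
    (hx : x ∈ ellipticDisk 1 m) (ha : IsAsymptotic x) : x.2 = 0 := by
  obtain ⟨u, v, huv, rfl⟩ := hx
  have h1 : (1 * u) ^ 2 + (m * v) ^ 2 = 1 := ha
  have h2 : 0 < 1 - m ^ 2 := by nlinarith
  have h3 : (1 - m ^ 2) * v ^ 2 ≤ 0 := by linarith
  have h4 : v ^ 2 = 0 := le_antisymm (nonpos_of_mul_nonpos_right h3 h2) (sq_nonneg v)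
  show m * v = 0
  rw [(pow_eq_zero_iff two_ne_zero).1 h4, mul_zero]

/-- The asymptotic points of a line. -/
theorem HLine.exists_asymptotic (l : HLine) : ∃ w : ℝ, w ≠ 0 ∧ 0 < l.a ^ 2 + l.b ^ 2 ∧
    ∀ e : ℝ, e ^ 2 = 1 →
      IsAsymptotic ((l.a * l.c - e * l.b * w) / (l.a ^ 2 + l.b ^ 2),
        (l.b * l.c + e * l.a * w) / (l.a ^ 2 + l.b ^ 2)) ∧
      ((l.a * l.c - e * l.b * w) / (l.a ^ 2 + l.b ^ 2),
        (l.b * l.c + e * l.a * w) / (l.a ^ 2 + l.b ^ 2)) ∈ l.carrier := by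
  have hl := l.meets
  have hD : 0 < l.a ^ 2 + l.b ^ 2 := lt_of_le_of_lt (sq_nonneg _) hl
  have hw : 0 < √(l.a ^ 2 + l.b ^ 2 - l.c ^ 2) := Real.sqrt_pos.2 (by linarith)
  have hw2 : √(l.a ^ 2 + l.b ^ 2 - l.c ^ 2) ^ 2 = l.a ^ 2 + l.b ^ 2 - l.c ^ 2 :=
    Real.sq_sqrt (by linarith)
  refine ⟨_, hw.ne', hD, fun e he => ?_⟩
  generalize √(l.a ^ 2 + l.b ^ 2 - l.c ^ 2) = w at *
  have h1 : IsAsymptotic ((l.a * l.c - e * l.b * w) / (l.a ^ 2 + l.b ^ 2),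
      (l.b * l.c + e * l.a * w) / (l.a ^ 2 + l.b ^ 2)) := by
    show ((l.a * l.c - e * l.b * w) / (l.a ^ 2 + l.b ^ 2)) ^ 2 +
      ((l.b * l.c + e * l.a * w) / (l.a ^ 2 + l.b ^ 2)) ^ 2 = 1
    rw [div_pow, div_pow, ← add_div, div_eq_one_iff_eq (by positivity)]
    linear_combination (l.a ^ 2 + l.b ^ 2) * (w ^ 2 * he + hw2)
  refine ⟨h1, h1.mem, ?_⟩
  show l.a * ((l.a * l.c - e * l.b * w) / (l.a ^ 2 + l.b ^ 2)) +
    l.b * ((l.b * l.c + e * l.a * w) / (l.a ^ 2 + l.b ^ 2)) = l.c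
  field_simp
  ring

/-- Both ends of the line are asymptotic points of the band, hence have second coordinate `0`; so
the line is the horizontal diameter. -/
theorem HLine.eq_zero_of_carrier_subset {m : ℝ} (hm : 0 ≤ m) (hm1 : m < 1) {l : HLine}
    (hl : l.carrier ⊆ ellipticDisk 1 m) : l.a = 0 ∧ l.c = 0 ∧ l.b ≠ 0 := by
  obtain ⟨w, hw, hD, h⟩ := l.exists_asymptotic
  have key : ∀ e : ℝ, e ^ 2 = 1 → l.b * l.c + e * l.a * w = 0 := by
    intro e he
    have := snd_eq_zero_of_isAsymptotic hm hm1 (hl (h e he).2) (h e he).1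
    exact (div_eq_zero_iff.1 this).resolve_right hD.ne'
  have h1 := key 1 (by norm_num)
  have h2 := key (-1) (by norm_num)
  have ha : l.a = 0 := (mul_eq_zero.1 (show l.a * w = 0 by linarith)).resolve_right hw
  have hb : l.b ≠ 0 := by
    intro hb
    rw [ha, hb] at hD
    norm_num at hD
  exact ⟨ha, (mul_eq_zero.1 (show l.b * l.c = 0 by linarith)).resolve_left hb, hb⟩

/-- The perpendiculars are the vertical chords `x = c`. Such a chord has half-length `√(1-c²)`, and
the ellipse cuts out the fraction `m` of it, whatever `c` is. -/
theorem hWidthAlong_band {m : ℝ} (hm : 0 ≤ m) (hm1 : m < 1) {l : HLine} (ha : l.a = 0)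
    (hc : l.c = 0) (hb : l.b ≠ 0) :
    hWidthAlong (ellipticDisk 1 m) l = ENNReal.ofReal (2 * Real.artanh m) := by
  refine le_antisymm (iSup₂_le fun n hn => ?_) ?_
  · have hnb : n.b = 0 := by
      unfold HLine.Perp at hn
      rw [ha, hc, zero_mul, zero_mul, zero_add, sub_zero] at hn
      exact (mul_eq_zero.1 hn).resolve_left hb
    have hmeets := n.meets
    rw [hnb] at hmeets
    have hna : n.a ≠ 0 := by
      intro h0
      rw [h0] at hmeets
      nlinarith [sq_nonneg n.c]
    obtain ⟨c, hc'⟩ : ∃ c, c = n.c / n.a := ⟨_, rfl⟩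
    have hnc : n.c = n.a * c := by rw [hc']; field_simp
    have hc1 : 0 < 1 - c ^ 2 := by
      have : 0 < n.a ^ 2 * (1 - c ^ 2) := by
        rw [hnc] at hmeets
        linarith
      exact pos_of_mul_pos_right this (sq_nonneg _)
    have hk0 : 0 < √(1 - c ^ 2) := Real.sqrt_pos.2 hc1
    have hk2 : √(1 - c ^ 2) ^ 2 = 1 - c ^ 2 := Real.sq_sqrt hc1.le
    refine hLength_le_of_subset_chord (a := 0) (b := 1) (c := -c) (k := √(1 - c ^ 2)) (by norm_num)
      (by rw [hk2]; ring) hk0 hm1 ?_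
    generalize √(1 - c ^ 2) = k at *
    rintro _ ⟨⟨u, v, huv, rfl⟩, -, hu⟩
    simp only [hnb, one_mul, zero_mul, add_zero, hnc] at hu
    have huc : u = c := mul_left_cancel₀ hna hu
    subst huc
    refine ⟨m * v / k, ?_, ?_⟩
    · have hv : |v| ≤ k := by
        rw [← abs_of_nonneg hk0.le, ← sq_le_sq]
        linarith
      rw [abs_div, abs_mul, abs_of_nonneg hm, abs_of_pos hk0, div_le_iff₀ hk0]
      exact mul_le_mul_of_nonneg_left hv hm
    · ext
      · simp [chordPoint]
      · simp [chordPoint]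
        field_simp
  · refine le_iSup₂_of_le ⟨1, 0, 0, by norm_num⟩ (by simp [HLine.Perp, ha, hc]) ?_
    have hmm : m ^ 2 ≤ 1 := by nlinarith
    have hmem : ∀ e : ℝ, e ^ 2 = 1 → chordPoint 0 1 0 1 (m * e) ∈
        ellipticDisk 1 m ∩ (⟨1, 0, 0, by norm_num⟩ : HLine).carrier := by
      intro e he
      refine ⟨⟨0, e, by rw [he]; norm_num, by simp [chordPoint]⟩, ?_, by simp [chordPoint]⟩
      simpa [chordPoint, mul_pow, he] using hmm
    have h1 := hmem 1 (by norm_num)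
    have h2 := hmem (-1) (by norm_num)
    rw [mul_one] at h1
    rw [mul_neg_one] at h2
    exact le_hLength_of_chord_mem (by norm_num) (by norm_num) one_pos hm hm1 h1 h2

theorem hasSemiAxes_band_iff {m : ℝ} (hm : 0 ≤ m) (hm1 : m < 1) {s t : ℝ≥0∞} :
    HasSemiAxes (ellipticDisk 1 m) s t ↔ s = ⊤ ∧ t = ENNReal.ofReal (Real.artanh m) := by
  have hB : IsAsymptotic (1, 0) := by simp [IsAsymptotic]
  have hC : IsAsymptotic (-1, 0) := by simp [IsAsymptotic]
  have hBC : ((1, 0) : ℝ × ℝ) ≠ (-1, 0) := by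
    intro h
    have := congrArg Prod.fst h
    norm_num at this
  have hBK : ((1, 0) : ℝ × ℝ) ∈ ellipticDisk 1 m := ⟨1, 0, by norm_num, by simp⟩
  have hCK : ((-1, 0) : ℝ × ℝ) ∈ ellipticDisk 1 m := ⟨-1, 0, by norm_num, by simp⟩
  have key : ∀ {l : HLine}, l.a = 0 → l.c = 0 → l.b ≠ 0 → hLength l.carrier / 2 = ⊤ ∧
      hWidthAlong (ellipticDisk 1 m) l / 2 = ENNReal.ofReal (Real.artanh m) := by
    intro l h1 h2 h3
    refine ⟨?_, ?_⟩
    · rw [hLength_eq_top (S := l.carrier) (p := (1, 0)) (q := (-1, 0))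
        ⟨hB.mem, by simp [h1, h2]⟩ ⟨hC.mem, by simp [h1, h2]⟩ hB hBC]
      exact ENNReal.top_div_of_ne_top ENNReal.ofNat_ne_top
    · rw [hWidthAlong_band hm hm1 h1 h2 h3, ofReal_two_mul_div_two]
  constructor
  · intro h
    cases h with
    | asymptoticPoint P hP hK =>
      rw [hK] at hBK hCK
      exact absurd (hBK.trans hCK.symm) hBC
    | bounded hK => exact absurd hB (ne_of_lt (hK _ hBK))
    | oneAsymptotic B hB' hBK' huniq hne l hl =>
      exact absurd ((huniq _ hBK hB).trans (huniq _ hCK hC).symm) hBC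
    | twoAsymptotic B C _ _ _ _ _ l hl =>
      obtain ⟨h1, h2, h3⟩ := HLine.eq_zero_of_carrier_subset hm hm1 hl
      exact key h1 h2 h3
  · rintro ⟨rfl, rfl⟩
    obtain ⟨e1, e2⟩ := key (l := ⟨0, 1, 0, by norm_num⟩) rfl rfl one_ne_zero
    rw [← e1, ← e2]
    refine .twoAsymptotic (1, 0) (-1, 0) hB hC hBC hBK hCK _ ?_
    rintro ⟨x, z⟩ ⟨h1, h2⟩
    simp only [zero_mul, one_mul, zero_add] at h1 h2
    subst h2
    exact ⟨x, 0, h1, by simp⟩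

/-! ### Semi-axes of elliptic parabolic disks and horodisks -/

theorem cuspDisk_subset {c : ℝ} (hc : 0 ≤ c) (hc1 : c ≤ 1) : cuspDisk c ⊆ closedDisk := by
  rintro ⟨x, z⟩ ⟨h1, h2, h3⟩
  simp only at h1 h2 h3
  show x ^ 2 + z ^ 2 ≤ 1
  have h4 : c ^ 2 ≤ 1 := by nlinarith
  have h5 : 0 ≤ (1 + z) * (-2 * z) := mul_nonneg (by linarith) (by linarith)
  nlinarith [mul_le_mul_of_nonneg_right h4 h5, sq_nonneg (1 + z)]

theorem isAsymptotic_cuspDisk {c : ℝ} (hc : 0 ≤ c) (hc1 : c ≤ 1) {x : ℝ × ℝ} (hx : x ∈ cuspDisk c)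
    (ha : IsAsymptotic x) : x = (0, -1) := by
  obtain ⟨x, z⟩ := x
  obtain ⟨h1, h2, h3⟩ := hx
  have h0 : x ^ 2 + z ^ 2 = 1 := ha
  simp only at h1 h2 h3
  have h4 : c ^ 2 ≤ 1 := by nlinarith
  have h5 : 0 ≤ (1 + z) * (-2 * z) := mul_nonneg (by linarith) (by linarith)
  have h6 : (1 + z) ^ 2 = 0 := by
    refine le_antisymm ?_ (sq_nonneg _)
    linarith [mul_le_mul_of_nonneg_right h4 h5]
  have hz : z = -1 := by linarith [(pow_eq_zero_iff two_ne_zero).1 h6]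
  rw [hz] at h0
  have hx : x = 0 := (pow_eq_zero_iff two_ne_zero).1 (by linarith)
  rw [hx, hz]

theorem cusp_mem (c : ℝ) : ((0, -1) : ℝ × ℝ) ∈ cuspDisk c := by
  simp [cuspDisk]

theorem zero_mem_cuspDisk (c : ℝ) : ((0, 0) : ℝ × ℝ) ∈ cuspDisk c := by
  simp [cuspDisk]

theorem isAsymptotic_cusp : IsAsymptotic (0, -1) := by
  simp [IsAsymptotic]

/-- The perpendiculars are the horizontal chords `z = d`. Relative to the half-length `√(1-d²)`, the
section has squared size `c²(-2d)/(1-d)`, which is below `c²` and tends to it as `d → -1`. -/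
theorem hWidthAlong_cuspDisk_le {c : ℝ} (hc : 0 ≤ c) (hc1 : c < 1) {l : HLine} (hb : l.b = 0)
    (hlc : l.c = 0) (ha : l.a ≠ 0) :
    hWidthAlong (cuspDisk c) l ≤ ENNReal.ofReal (2 * Real.artanh c) := by
  refine iSup₂_le fun n hn => ?_
  have hna : n.a = 0 := by
    unfold HLine.Perp at hn
    rw [hb, hlc, zero_mul, zero_mul, add_zero, sub_zero] at hn
    exact (mul_eq_zero.1 hn).resolve_left ha
  have hmeets := n.meets
  rw [hna] at hmeets
  have hnb : n.b ≠ 0 := by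
    intro h0
    rw [h0] at hmeets
    nlinarith [sq_nonneg n.c]
  obtain ⟨d, hd⟩ : ∃ d, d = n.c / n.b := ⟨_, rfl⟩
  have hnc : n.c = n.b * d := by rw [hd]; field_simp
  have hd1 : 0 < 1 - d ^ 2 := by
    have : 0 < n.b ^ 2 * (1 - d ^ 2) := by
      rw [hnc] at hmeets
      linarith
    exact pos_of_mul_pos_right this (sq_nonneg _)
  have hk0 : 0 < √(1 - d ^ 2) := Real.sqrt_pos.2 hd1
  have hk2 : √(1 - d ^ 2) ^ 2 = 1 - d ^ 2 := Real.sq_sqrt hd1.le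
  refine hLength_le_of_subset_chord (a := 1) (b := 0) (c := d) (k := √(1 - d ^ 2)) (by norm_num)
    (by rw [hk2]; ring) hk0 hc1 ?_
  generalize √(1 - d ^ 2) = k at *
  rintro ⟨x, z⟩ ⟨⟨h1, h2, h3⟩, -, hz⟩
  simp only [hna, zero_mul, zero_add, hnc] at hz h1 h2 h3
  obtain rfl : z = d := mul_left_cancel₀ hnb hz
  refine ⟨x / k, ?_, ?_⟩
  · rw [abs_div, abs_of_pos hk0, div_le_iff₀ hk0, ← abs_of_nonneg (mul_nonneg hc hk0.le),
      ← sq_le_sq, mul_pow, hk2]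
    refine h3.trans (mul_le_mul_of_nonneg_left ?_ (sq_nonneg c))
    nlinarith [sq_nonneg (1 + z)]
  · ext
    · simp [chordPoint]
      field_simp
    · simp [chordPoint]

theorem le_hWidthAlong_cuspDisk {c y : ℝ} (hy : 0 ≤ y) (hyc : Real.tanh y < c) {l : HLine}
    (hb : l.b = 0) (hlc : l.c = 0) :
    ENNReal.ofReal (2 * y) ≤ hWidthAlong (cuspDisk c) l := by
  have hr0 : 0 ≤ Real.tanh y := by
    rw [Real.tanh_eq_sinh_div_cosh]
    exact div_nonneg (Real.sinh_nonneg_iff.2 hy) (Real.cosh_pos y).le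
  have hr1 := Real.tanh_lt_one y
  nth_rw 1 [← Real.artanh_tanh y]
  generalize Real.tanh y = r at *
  have hc0 : 0 < c := lt_of_le_of_lt hr0 hyc
  obtain ⟨φ, hφ⟩ : ∃ φ, φ = r ^ 2 / c ^ 2 := ⟨_, rfl⟩
  have hφr : c ^ 2 * φ = r ^ 2 := by rw [hφ]; field_simp
  have hφ0 : 0 ≤ φ := by rw [hφ]; positivity
  have hφ1 : φ < 1 := by
    rw [hφ, div_lt_one (by positivity)]
    exact pow_lt_pow_left₀ hyc hr0 two_ne_zero
  -- The height at which the fraction `-2z/(1-z)` equals `φ = r²/c²`, so that the section ends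
  -- exactly at the chord parameters `±r`.
  obtain ⟨z, hz⟩ : ∃ z, z = -φ / (2 - φ) := ⟨_, rfl⟩
  have h2φ : 0 < 2 - φ := by linarith
  have hzφ : z * (2 - φ) = -φ := by rw [hz, div_mul_cancel₀ _ h2φ.ne']
  have hz0 : z ≤ 0 := by
    rw [hz]
    exact div_nonpos_of_nonpos_of_nonneg (by linarith) h2φ.le
  have hz1 : -1 < z := by
    rw [hz, lt_div_iff₀ h2φ]
    linarith
  have hzz : 0 < 1 - z ^ 2 := by nlinarith
  have hk0 : 0 < √(1 - z ^ 2) := Real.sqrt_pos.2 hzz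
  have hk2 : √(1 - z ^ 2) ^ 2 = 1 - z ^ 2 := Real.sq_sqrt hzz.le
  generalize √(1 - z ^ 2) = k at *
  refine le_iSup₂_of_le ⟨0, 1, z, by linarith⟩ (by simp [HLine.Perp, hb, hlc]) ?_
  have hmem : ∀ s : ℝ, s ^ 2 = r ^ 2 → chordPoint 1 0 z k s ∈
      cuspDisk c ∩ (⟨0, 1, z, by linarith⟩ : HLine).carrier := by
    intro s hs
    refine ⟨⟨?_, ?_, ?_⟩, ?_, ?_⟩
    · simp [chordPoint, hz1.le]
    · simp [chordPoint, hz0]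
    · simp only [chordPoint, mul_zero, mul_one, add_zero, zero_add]
      rw [mul_pow, hk2, hs, ← hφr]
      refine le_of_eq ?_
      linear_combination (1 + z) * c ^ 2 * hzφ
    · simp only [chordPoint, mul_zero, mul_one, add_zero, zero_add]
      rw [mul_pow, hk2, hs]
      have hr2 : r ^ 2 ≤ 1 := pow_le_one₀ hr0 hr1.le
      linarith [mul_le_mul_of_nonneg_left hr2 hzz.le]
    · simp [chordPoint]
  exact le_hLength_of_chord_mem (by norm_num) (by rw [hk2]; ring) hk0 hr0 hr1 (hmem r rfl)
    (hmem (-r) (by ring))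

theorem hWidthAlong_cuspDisk {c : ℝ} (hc : 0 ≤ c) (hc1 : c ≤ 1) {l : HLine} (hb : l.b = 0)
    (hlc : l.c = 0) (ha : l.a ≠ 0) : hWidthAlong (cuspDisk c) l / 2 = extArtanh c := by
  unfold extArtanh
  split_ifs with h1
  · have htop : hWidthAlong (cuspDisk c) l = ⊤ := by
      by_contra htop
      -- For `c = 1` every real `y` satisfies `tanh y < c`, so a finite width is exceeded.
      have h := le_hWidthAlong_cuspDisk (c := c) (y := (hWidthAlong (cuspDisk c) l).toReal + 1)
        (by positivity) (by rw [h1]; exact Real.tanh_lt_one _) hb hlc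
      have h2 := (ENNReal.ofReal_le_iff_le_toReal htop).1 h
      linarith [ENNReal.toReal_nonneg (a := hWidthAlong (cuspDisk c) l)]
    rw [htop]
    exact ENNReal.top_div_of_ne_top ENNReal.ofNat_ne_top
  · have hc1' : c < 1 := lt_of_le_of_ne hc1 h1
    rw [← ofReal_two_mul_div_two]
    congr 1
    refine le_antisymm (hWidthAlong_cuspDisk_le hc hc1' hb hlc ha) ?_
    by_contra! hlt
    have hne := ne_top_of_lt hlt
    have h2 := (ENNReal.lt_ofReal_iff_toReal_lt hne).1 hlt
    set w := (hWidthAlong (cuspDisk c) l).toReal with hw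
    have hw0 : 0 ≤ w := ENNReal.toReal_nonneg
    -- The midpoint between the supposed half-width and `artanh c` is still attained by a section.
    have h := le_hWidthAlong_cuspDisk (c := c) (y := (w / 2 + Real.artanh c) / 2)
      (by linarith) (by
        by_contra! h3
        have := Real.artanh_le_artanh (by linarith) (Real.tanh_lt_one _) h3
        rw [Real.artanh_tanh] at this
        linarith) hb hlc
    have h4 := (ENNReal.ofReal_le_iff_le_toReal hne).1 h
    linarith

theorem hLength_inter_cuspDisk {c : ℝ} {l : HLine} (hb : l.b = 0) (hlc : l.c = 0) :
    hLength (cuspDisk c ∩ l.carrier) = ⊤ := by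
  refine hLength_eq_top (p := (0, -1)) (q := (0, 0)) ⟨cusp_mem c, ?_⟩ ⟨zero_mem_cuspDisk c, ?_⟩
    isAsymptotic_cusp (by simp)
  · simp [HLine.carrier, hb, hlc]
  · simp [HLine.carrier, hb, hlc]

/-- A symmetry axis of an elliptic parabolic disk passes through its asymptotic point, and it is
unique unless the disk is a horodisk. -/
theorem HLine.IsSymmetryAxis.cuspDisk {c : ℝ} (hc : 0 ≤ c) (hc1 : c ≤ 1) {l : HLine}
    (hl : l.IsSymmetryAxis (cuspDisk c)) : l.a ≠ 0 ∧ l.c = -l.b ∧ (l.b = 0 ∨ c = 1) := by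
  have hmeets := l.meets
  have hD : 0 < l.a ^ 2 + l.b ^ 2 - l.c ^ 2 := by linarith
  -- A symmetry must fix the only asymptotic point, so the axis passes through it.
  have h1 : l.reflect (0, -1) = (0, -1) := by
    refine isAsymptotic_cuspDisk hc hc1 ?_ (l.isAsymptotic_reflect isAsymptotic_cusp)
    rw [← hl]
    exact Set.mem_image_of_mem _ (cusp_mem c)
  have h2 := l.lorReflect_snd_snd_ne_zero isAsymptotic_cusp.mem
  have hcb : l.c = -l.b := by
    have h3 := congrArg Prod.fst h1
    have h4 := congrArg Prod.snd h1
    rw [l.reflect_eq] at h3 h4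
    simp only [dehomog, div_eq_zero_iff, h2, or_false] at h3
    simp only [dehomog, div_eq_iff h2] at h4
    simp only [lorReflect, HLine.normal, homog, lor, Prod.fst_sub, Prod.snd_sub, Prod.smul_fst,
      Prod.smul_snd, smul_eq_mul] at h3 h4
    have hD' : l.a * l.a + l.b * l.b - l.c * l.c ≠ 0 := by nlinarith
    by_contra hne
    have hbc : l.b + l.c ≠ 0 := fun h => hne (by linarith)
    have hk : 2 * (l.a * 0 + l.b * -1 - l.c * 1) / (l.a * l.a + l.b * l.b - l.c * l.c) ≠ 0 := by
      refine div_ne_zero ?_ hD'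
      intro h
      apply hbc
      linarith
    have h5 : 2 * (l.a * 0 + l.b * -1 - l.c * 1) / (l.a * l.a + l.b * l.b - l.c * l.c) *
        (l.b + l.c) = 0 := by linarith
    exact hbc ((mul_eq_zero.1 h5).resolve_left hk)
  have ha2 : 0 < l.a ^ 2 := by
    rw [hcb] at hD
    linarith
  have ha : l.a ≠ 0 := fun h => by rw [h] at ha2; norm_num at ha2
  refine ⟨ha, hcb, ?_⟩
  -- Since the axis passes through the asymptotic point, the reflected origin lies on the boundary
  -- of the horodisk `c = 1`. For `c < 1` it can belong to the smaller region only if its first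
  -- coordinate vanishes.
  have h6 : l.reflect (0, 0) ∈ _root_.cuspDisk c := by
    rw [← hl]
    exact Set.mem_image_of_mem _ (zero_mem_cuspDisk c)
  obtain ⟨-, -, h7⟩ := h6
  have hk : l.reflect (0, 0) = (-(2 * l.b * l.a) / (l.a ^ 2 + 2 * l.b ^ 2),
      -(2 * l.b ^ 2) / (l.a ^ 2 + 2 * l.b ^ 2)) := by
    have hpos : 0 < l.a ^ 2 + 2 * l.b ^ 2 := by positivity
    have e1 : 2 * (l.a * 0 + l.b * 0 - l.c) / (l.a ^ 2 + l.b ^ 2 - l.c ^ 2) =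
        2 * l.b / l.a ^ 2 := by
      rw [hcb]
      congr 1 <;> ring
    have e2 : 1 - 2 * l.b / l.a ^ 2 * l.c = (l.a ^ 2 + 2 * l.b ^ 2) / l.a ^ 2 := by
      rw [hcb]
      field_simp
      ring
    simp only [HLine.reflect]
    rw [e1, e2]
    ext
    · simp only
      field_simp
      ring
    · simp only
      field_simp
      ring
  rw [hk] at h7
  simp only at h7
  have hpos : 0 < l.a ^ 2 + 2 * l.b ^ 2 := by positivity
  by_contra! hcon
  obtain ⟨hb, hc1'⟩ := hcon
  have hc2 : c ^ 2 < 1 := by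
    have := lt_of_le_of_ne hc1 hc1'
    nlinarith
  have e3 : (1 + -(2 * l.b ^ 2) / (l.a ^ 2 + 2 * l.b ^ 2)) *
      (-2 * (-(2 * l.b ^ 2) / (l.a ^ 2 + 2 * l.b ^ 2))) =
      (2 * l.b * l.a) ^ 2 / (l.a ^ 2 + 2 * l.b ^ 2) ^ 2 := by
    field_simp
    ring
  rw [e3, div_pow, neg_sq] at h7
  have h8 : 0 < (2 * l.b * l.a) ^ 2 / (l.a ^ 2 + 2 * l.b ^ 2) ^ 2 := by positivity
  nlinarith

/-- The parabolic map `z ↦ z/(1 + κz)`, with `κ = -b/a`, carries the vertical axis to `l`. It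
preserves the horodisk, which is the range of the nilpotent matrix `canonS 0`, because `N(1 + κN)⁻¹
= N` when `N² = 0`. -/
theorem exists_parabolic_mapLine {l : HLine} (ha : l.a ≠ 0) (hcb : l.c = -l.b) :
    ∃ (G : LorentzSim) (l' : HLine), l'.a ≠ 0 ∧ l'.b = 0 ∧ l'.c = 0 ∧ G.mapLine l' = l ∧
      G.act '' cuspDisk 1 = cuspDisk 1 := by
  have hΔ : (1 : ℝ) * 1 - 0 * (-l.b / l.a) ≠ 0 := by norm_num
  refine ⟨moebiusSim 1 0 (-l.b / l.a) 1 hΔ, ⟨l.a, 0, 0, by have := sq_pos_of_ne_zero ha; linarith⟩, ha, rfl, rfl, ?_, ?_⟩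
  · obtain ⟨a, b, c, h⟩ := l
    simp only at ha hcb
    subst hcb
    rw [HLine.mk.injEq]
    show (moebiusFun 1 0 (-b / a) 1 (a, 0, 0)).1 = a ∧
      (moebiusFun 1 0 (-b / a) 1 (a, 0, 0)).2.1 = b ∧
      (moebiusFun 1 0 (-b / a) 1 (a, 0, 0)).2.2 = -b
    simp [moebiusFun]
    field_simp
    simp
  · have hN : EigenvaluesAre (canonS 0) 0 0 := by
      rw [eigenvaluesAre_iff]
      simp [canonS, Matrix.trace_fin_two]
    have hdet : (((-l.b / l.a : ℝ) : ℂ) • canonS 0 + ((1 : ℝ) : ℂ) • 1).det ≠ 0 := by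
      rw [det_smul_add_smul_one hN]
      simp
    have h := conformalRange_moebius hΔ hdet (V := 1) (Submonoid.one_mem _)
    have e : (1 : Matrix (Fin 2) (Fin 2) ℂ) * ((((1 : ℝ) : ℂ) • canonS 0 + ((0 : ℝ) : ℂ) • 1) *
        (((-l.b / l.a : ℝ) : ℂ) • canonS 0 + ((1 : ℝ) : ℂ) • 1)⁻¹) *
        (1 : Matrix (Fin 2) (Fin 2) ℂ)ᴴ = canonS 0 := by
      rw [moebius_eq_affine hN _ _ _ _ (by simp)]
      simp
    rw [e, conformalRange_canonS, Real.cos_zero] at h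
    exact h.symm

/-- For `c < 1` the axis is the vertical diameter; for a horodisk an arbitrary axis is first moved
there by an isometry preserving the set. -/
theorem hasSemiAxes_cuspDisk_iff {c : ℝ} (hc : 0 ≤ c) (hc1 : c ≤ 1) {s t : ℝ≥0∞} :
    HasSemiAxes (cuspDisk c) s t ↔ s = ⊤ ∧ t = extArtanh c := by
  have hK := cuspDisk_subset hc hc1
  have htop : (⊤ : ℝ≥0∞) / 2 = ⊤ := ENNReal.top_div_of_ne_top ENNReal.ofNat_ne_top
  have hne : ((0, 0) : ℝ × ℝ) ≠ (0, -1) := by simp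
  constructor
  · intro h
    cases h with
    | asymptoticPoint P hP hKP =>
      have h1 := cusp_mem c
      have h2 := zero_mem_cuspDisk c
      rw [hKP] at h1 h2
      exact absurd (h2.trans h1.symm) hne
    | bounded hord => exact absurd isAsymptotic_cusp (ne_of_lt (hord _ (cusp_mem c)))
    | twoAsymptotic B C hB hC hBC hBK hCK l hl =>
      exact absurd ((isAsymptotic_cuspDisk hc hc1 hBK hB).trans
        (isAsymptotic_cuspDisk hc hc1 hCK hC).symm) hBC
    | oneAsymptotic B hB hBK huniq hneB l hl =>
      obtain ⟨ha, hcb, h⟩ := hl.cuspDisk hc hc1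
      rcases h with hb | rfl
      · rw [hb, neg_zero] at hcb
        exact ⟨by rw [hLength_inter_cuspDisk hb hcb, htop], hWidthAlong_cuspDisk hc hc1 hb hcb ha⟩
      · obtain ⟨G, l', ha', hb', hc', hG, hGK⟩ := exists_parabolic_mapLine ha hcb
        have e1 : hLength (cuspDisk 1 ∩ l.carrier) = hLength (cuspDisk 1 ∩ l'.carrier) := by
          have := LorentzSim.hLength_image (G := G) (S := cuspDisk 1 ∩ l'.carrier)
            (fun p hp => hK hp.1)
          rwa [LorentzSim.image_inter_carrier hK, hG, hGK] at this
        have e2 : hWidthAlong (cuspDisk 1) l = hWidthAlong (cuspDisk 1) l' := by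
          have := LorentzSim.hWidthAlong_image (G := G) hK l'
          rwa [hG, hGK] at this
        rw [e1, e2, hLength_inter_cuspDisk hb' hc', htop]
        exact ⟨rfl, hWidthAlong_cuspDisk hc hc1 hb' hc' ha'⟩
  · rintro ⟨rfl, rfl⟩
    rw [← hWidthAlong_cuspDisk hc hc1 (l := ⟨1, 0, 0, by norm_num⟩) rfl rfl one_ne_zero, ← htop,
      ← hLength_inter_cuspDisk (c := c) (l := ⟨1, 0, 0, by norm_num⟩) rfl rfl]
    refine .oneAsymptotic (0, -1) isAsymptotic_cusp (cusp_mem c)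
      (fun p hp => isAsymptotic_cuspDisk hc hc1 hp) ?_ _ ?_
    · intro h
      have h2 := zero_mem_cuspDisk c
      rw [h] at h2
      exact hne h2
    · have href : ∀ p : ℝ × ℝ, HLine.reflect ⟨1, 0, 0, by norm_num⟩ p = (-p.1, p.2) := by
        intro p
        simp [HLine.reflect]
        ring
      have hmem : ∀ p : ℝ × ℝ, p ∈ cuspDisk c → (-p.1, p.2) ∈ cuspDisk c := by
        rintro p ⟨h1, h2, h3⟩
        exact ⟨h1, h2, by simpa using h3⟩
      unfold HLine.IsSymmetryAxis
      ext p
      simp only [Set.mem_image, href]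
      constructor
      · rintro ⟨q, hq, rfl⟩
        exact hmem q hq
      · intro hp
        exact ⟨(-p.1, p.2), hmem p hp, by simp⟩

/-! ### Semi-axes of conformal ranges -/

theorem hasSemiAxes_singleton_iff {P : ℝ × ℝ} (hP : IsAsymptotic P) {s t : ℝ≥0∞} :
    HasSemiAxes {P} s t ↔ s = 0 ∧ t = 0 := by
  constructor
  · intro h
    cases h with
    | asymptoticPoint Q hQ hK => exact ⟨rfl, rfl⟩
    | bounded hK => exact absurd hP (ne_of_lt (hK P rfl))
    | twoAsymptotic B C hB hC hBC hBK hCK l hl => exact absurd (hBK.trans hCK.symm) hBC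
    | oneAsymptotic B hB hBK huniq hne l hl =>
      exact absurd (congrArg _ (Set.mem_singleton_iff.1 hBK).symm) hne
  · rintro ⟨rfl, rfl⟩
    exact .asymptoticPoint P hP rfl

theorem conformalRange_zero : conformalRange 0 = {(0, -1)} := by
  have key : ∀ x : EuclideanSpace ℂ (Fin 2), x ≠ 0 →
      ((2 * (inner ℂ x (Matrix.toEuclideanLin 0 x)).re /
        (‖Matrix.toEuclideanLin (0 : Matrix (Fin 2) (Fin 2) ℂ) x‖ ^ 2 + ‖x‖ ^ 2),
      (‖Matrix.toEuclideanLin (0 : Matrix (Fin 2) (Fin 2) ℂ) x‖ ^ 2 - ‖x‖ ^ 2) /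
        (‖Matrix.toEuclideanLin (0 : Matrix (Fin 2) (Fin 2) ℂ) x‖ ^ 2 + ‖x‖ ^ 2)) : ℝ × ℝ) =
      (0, -1) := by
    intro x hx
    have : ‖x‖ ^ 2 ≠ 0 := pow_ne_zero 2 (norm_ne_zero_iff.2 hx)
    simp [this]
  ext p
  constructor
  · rintro ⟨x, _, hx, rfl, rfl⟩
    exact key x hx
  · rintro rfl
    obtain ⟨x, hx⟩ := exists_ne (0 : EuclideanSpace ℂ (Fin 2))
    exact ⟨x, _, hx, rfl, (key x hx).symm⟩

theorem extArtanh_zero : extArtanh 0 = 0 := by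
  simp [extArtanh]

theorem extArtanh_one : extArtanh 1 = ⊤ := if_pos rfl

theorem extArtanh_of_lt {q : ℝ} (hq : q < 1) : extArtanh q = ENNReal.ofReal (Real.artanh q) :=
  if_neg hq.ne

theorem extArtanh_mono {p m : ℝ} (hm : 0 ≤ m) (hmp : m ≤ p) (hp : p ≤ 1) :
    extArtanh m ≤ extArtanh p := by
  rcases hp.eq_or_lt with rfl | hp
  · rw [extArtanh_one]
    exact le_top
  · rw [extArtanh_of_lt hp, extArtanh_of_lt (hmp.trans_lt hp)]
    exact ENNReal.ofReal_le_ofReal (Real.artanh_le_artanh (by linarith) hp hmp)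

theorem hasSemiAxes_conformalRange_triangular {C S t : ℝ} {y : ℂ} (ht : 0 ≤ t)
    (hCS : C ^ 2 + S ^ 2 = 1) (hy : y.re = -C) (hy1 : ‖y‖ ^ 2 = 1) {s s' : ℝ≥0∞} :
    HasSemiAxes (conformalRange !![(C : ℂ) + Complex.I * (S : ℂ), 2 * (t : ℂ); 0, y]) s s' ↔
      s = extArtanh (√(C ^ 2 + t ^ 2) / √(1 + t ^ 2)) ∧ s' = extArtanh (t / √(1 + t ^ 2)) := by
  rw [conformalRange_eq_ellipticDisk ht hCS hy hy1]
  have hpos : 0 < √(1 + t ^ 2) := Real.sqrt_pos.2 (by positivity)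
  have hm : 0 ≤ t / √(1 + t ^ 2) := by positivity
  have hm1 : t / √(1 + t ^ 2) < 1 := by
    rw [div_lt_one hpos]
    exact Real.lt_sqrt_of_sq_lt (by linarith)
  have hmp : t / √(1 + t ^ 2) ≤ √(C ^ 2 + t ^ 2) / √(1 + t ^ 2) :=
    div_le_div_of_nonneg_right (Real.le_sqrt_of_sq_le (by nlinarith)) hpos.le
  have hp : √(C ^ 2 + t ^ 2) / √(1 + t ^ 2) ≤ 1 := by
    rw [div_le_one hpos]
    exact Real.sqrt_le_sqrt (by nlinarith)
  generalize √(C ^ 2 + t ^ 2) / √(1 + t ^ 2) = p at *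
  generalize t / √(1 + t ^ 2) = m at *
  rw [extArtanh_of_lt hm1]
  rcases hp.eq_or_lt with rfl | hp
  · rw [hasSemiAxes_band_iff hm hm1, extArtanh_one]
  · rw [hasSemiAxes_ellipticDisk_iff hm hmp hp, extArtanh_of_lt hp]

theorem CanonicalBCK.hasSemiAxes_iff {B : Matrix (Fin 2) (Fin 2) ℂ} {p m : ℝ}
    (h : CanonicalBCK B p m) {s s' : ℝ≥0∞} :
    HasSemiAxes (conformalRange B) s s' ↔ s = extArtanh p ∧ s' = extArtanh m := by
  have hn : ∀ α : ℝ, Real.cos α ^ 2 + Real.sin α ^ 2 = 1 := Real.cos_sq_add_sin_sq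
  cases h with
  | zero => rw [conformalRange_zero, hasSemiAxes_singleton_iff isAsymptotic_cusp, extArtanh_zero]
  | S β hβ =>
    rw [conformalRange_canonS, extArtanh_one]
    exact hasSemiAxes_cuspDisk_iff
      (Real.cos_nonneg_of_neg_pi_div_two_le_of_le (by linarith [hβ.1, Real.pi_pos]) hβ.2)
      (Real.cos_le_one β)
  | LPlus α t hα ht =>
    refine hasSemiAxes_conformalRange_triangular ht (hn α)
      (by simp [-Complex.ofReal_cos, -Complex.ofReal_sin]) ?_
    rw [Complex.sq_norm, Complex.normSq_apply]
    simp [-Complex.ofReal_cos, -Complex.ofReal_sin]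
    linarith [hn α]
  | LMinus α t hα ht =>
    refine hasSemiAxes_conformalRange_triangular ht (hn α)
      (by simp [-Complex.ofReal_cos, -Complex.ofReal_sin]) ?_
    rw [Complex.sq_norm, Complex.normSq_apply]
    simp [-Complex.ofReal_cos, -Complex.ofReal_sin]
    linarith [hn α]

theorem hasSemiAxes_conformalRange_iff (A : Matrix (Fin 2) (Fin 2) ℂ) (s s' : ℝ≥0∞) :
    HasSemiAxes (conformalRange A) s s' ↔
      s = extArtanh (majorChar A) ∧ s' = extArtanh (minorChar A) := by
  obtain ⟨p, m, h⟩ := exists_isCharBCK A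
  obtain ⟨rfl, rfl⟩ := (isCharBCK_iff A p m).1 h
  obtain ⟨B, hB, hc⟩ := h
  rw [← hB.hasSemiAxes_iff, hc.hasSemiAxes_iff]

theorem axisData (A : Matrix (Fin 2) (Fin 2) ℂ) : AxisData A (majorChar A) (minorChar A)
    (extArtanh (majorChar A)) (extArtanh (minorChar A)) := by
  have hU := norm_discD_le_discU A
  have hE := discE_nonneg A
  have hmin : 0 ≤ min (discE A) ‖discD A‖ := le_min hE (norm_nonneg _)
  have hle : min (discE A) ‖discD A‖ ≤ max (discE A) ‖discD A‖ := min_le_max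
  have h1 : minorChar A ≤ majorChar A := by
    unfold minorChar majorChar
    refine Real.sqrt_le_sqrt (div_le_div_of_nonneg_right ?_ ?_) <;> linarith
  have h2 : majorChar A ≤ 1 := by
    unfold majorChar
    rw [Real.sqrt_le_one]
    exact div_le_one_of_le₀ (by linarith) (by linarith)
  exact ⟨isCharBCK_iff A, hasSemiAxes_conformalRange_iff A, rfl, rfl, h1,
    extArtanh_mono (Real.sqrt_nonneg _) h1 h2⟩

/-! ### Formulas -/

/-- `cosh (2 artanh q) = (1+q²)/(1-q²)`, which is `u/v` for `q² = (u-v)/(u+v)`. At the boundary, `v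
= 0 < u` gives `q = 1` and `∞` on both sides, while `u = v = 0` gives `q = 0` and `arcosh 1 = 0`, in
accordance with the two conventions for `0/0`. -/
theorem extArtanh_sqrt_div {u v : ℝ} (hv : 0 ≤ v) (hvu : v ≤ u) :
    extArtanh (√((u - v) / (u + v))) = extArcosh (extDiv u v) / 2 := by
  rcases hv.eq_or_lt with rfl | hv0
  · rcases hvu.eq_or_lt with rfl | hu0
    · simp [extArtanh, extDiv, extArcosh]
    · have h : extDiv u 0 = ⊤ := by
        rw [extDiv, if_neg (fun h => hu0.ne' h.1), ENNReal.ofReal_zero,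
          ENNReal.div_zero (ENNReal.ofReal_pos.2 hu0).ne']
      rw [h, sub_zero, add_zero, div_self hu0.ne', Real.sqrt_one, extArtanh_one, extArcosh,
        if_pos rfl, ENNReal.top_div_of_ne_top ENNReal.ofNat_ne_top]
  · have h : extDiv u v = ENNReal.ofReal (u / v) := by
      rw [extDiv, if_neg (fun h => hv0.ne' h.2), ENNReal.ofReal_div_of_pos hv0]
    have hq2 : √((u - v) / (u + v)) ^ 2 = (u - v) / (u + v) :=
      Real.sq_sqrt (div_nonneg (by linarith) (by linarith))
    have hq0 : 0 ≤ √((u - v) / (u + v)) := Real.sqrt_nonneg _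
    have hq1 : √((u - v) / (u + v)) < 1 := by
      rw [Real.sqrt_lt' one_pos, one_pow, div_lt_one (by linarith)]
      linarith
    generalize √((u - v) / (u + v)) = q at *
    have hq : q ∈ Set.Ioo (-1) 1 := ⟨by linarith, hq1⟩
    have hq3 : 0 < 1 - q ^ 2 := by nlinarith
    have hcosh : Real.cosh (2 * Real.artanh q) = u / v := by
      rw [Real.cosh_two_mul, Real.cosh_artanh hq, Real.sinh_artanh hq, div_pow, div_pow,
        Real.sq_sqrt hq3.le, one_pow, ← add_div, div_eq_div_iff hq3.ne' hv0.ne']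
      have hq4 : q ^ 2 * (u + v) = u - v := by rw [hq2, div_mul_cancel₀ _ (by linarith)]
      linear_combination hq4
    rw [h, extArcosh, if_neg ENNReal.ofReal_ne_top,
      ENNReal.toReal_ofReal (div_nonneg (by linarith) hv), ← hcosh,
      Real.arcosh_cosh (mul_nonneg two_pos.le (Real.artanh_nonneg hq0)), ofReal_two_mul_div_two,
      extArtanh_of_lt hq1]

theorem axisData_of_le {A : Matrix (Fin 2) (Fin 2) ℂ} (h : ‖discD A‖ ≤ discE A) :
    AxisData A (√((discU A + ‖discD A‖) / (discU A - ‖discD A‖ + 2 * discE A)))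
      (√((discU A - ‖discD A‖) / (discU A - ‖discD A‖ + 2 * discE A)))
      (extArcosh (extDiv (discU A + discE A) (discE A - ‖discD A‖)) / 2)
      (extArcosh (extDiv (discU A - ‖discD A‖ + discE A) (discE A)) / 2) := by
  have hA := axisData A
  have hU := norm_discD_le_discU A
  have hD := norm_nonneg (discD A)
  -- Used with `(u, v) = (U + E, E - |D|)` for the major axis and `(U - |D| + E, E)` for the minor
  -- one.
  rw [← extArtanh_sqrt_div (by linarith) (by linarith),
    ← extArtanh_sqrt_div (by linarith) (by linarith)]
  unfold majorChar minorChar at hA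
  rw [min_eq_right h, max_eq_left h] at hA
  have e1 : discU A - ‖discD A‖ + 2 * ‖discD A‖ = discU A + ‖discD A‖ := by ring
  have e2 : discU A + discE A - (discE A - ‖discD A‖) = discU A + ‖discD A‖ := by ring
  have e3 : discU A + discE A + (discE A - ‖discD A‖) =
      discU A - ‖discD A‖ + 2 * discE A := by ring
  have e4 : discU A - ‖discD A‖ + discE A + discE A = discU A - ‖discD A‖ + 2 * discE A := by ring
  rwa [e2, e3, e4, add_sub_cancel_right, ← e1]

theorem axisData_of_ge {A : Matrix (Fin 2) (Fin 2) ℂ} (h : discE A ≤ ‖discD A‖) :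
    AxisData A (√((discU A - ‖discD A‖ + 2 * discE A) / (discU A + ‖discD A‖)))
      (√((discU A - ‖discD A‖) / (discU A + ‖discD A‖)))
      (extArcosh (extDiv (discU A + discE A) (‖discD A‖ - discE A)) / 2)
      (extArcosh (extDiv (discU A) ‖discD A‖) / 2) := by
  have hA := axisData A
  have hU := norm_discD_le_discU A
  have hE := discE_nonneg A
  -- Here `(u, v)` is `(U + E, |D| - E)`, respectively `(U, |D|)`.
  rw [← extArtanh_sqrt_div (by linarith) (by linarith),
    ← extArtanh_sqrt_div (by linarith) (by linarith)]
  unfold majorChar minorChar at hA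
  rw [min_eq_left h, max_eq_right h] at hA
  have e1 : discU A - ‖discD A‖ + 2 * ‖discD A‖ = discU A + ‖discD A‖ := by ring
  have e2 : discU A + discE A - (‖discD A‖ - discE A) =
      discU A - ‖discD A‖ + 2 * discE A := by ring
  have e3 : discU A + discE A + (‖discD A‖ - discE A) = discU A + ‖discD A‖ := by ring
  rwa [e2, e3, ← e1]

theorem axisData_of_eq {A : Matrix (Fin 2) (Fin 2) ℂ} (h : discE A = ‖discD A‖)
    (hA : ¬ IsRealScalar A) :
    AxisData A 1 (√((discU A - ‖discD A‖) / (discU A + ‖discD A‖)))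
      ⊤ (extArcosh (extDiv (discU A) ‖discD A‖) / 2) := by
  have hU := norm_discD_le_discU A
  have hD := norm_nonneg (discD A)
  -- Vanishing would force `U = E = 0`, that is, a real scalar matrix. This is the only place where
  -- the major value degenerates from `1` to `0/0`.
  have hne : discU A + ‖discD A‖ ≠ 0 := by
    intro h0
    exact hA ((isRealScalar_iff A).2 ⟨by linarith, by linarith⟩)
  have hp : √((discU A - ‖discD A‖ + 2 * discE A) / (discU A + ‖discD A‖)) = 1 := by
    rw [← Real.sqrt_one, h]
    congr 1
    rw [div_eq_one_iff_eq hne]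
    ring
  have key := axisData_of_ge h.le
  rw [hp] at key
  have htop := key.major_eq
  rw [extArtanh_one] at htop
  rwa [htop] at key

theorem IsRealScalar.axisData {A : Matrix (Fin 2) (Fin 2) ℂ} (h : IsRealScalar A) :
    discE A = ‖discD A‖ ∧ AxisData A 0 0 0 0 := by
  obtain ⟨hU, hE⟩ := (isRealScalar_iff A).1 h
  have hD : ‖discD A‖ = 0 :=
    le_antisymm (hU ▸ norm_discD_le_discU A) (norm_nonneg _)
  refine ⟨hE.trans hD.symm, ?_⟩
  have key := _root_.axisData A
  unfold majorChar minorChar at key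
  simpa [hU, hE, hD, extArtanh_zero] using key

theorem mainTheorem7 (A : Matrix (Fin 2) (Fin 2) ℂ) :
    -- (a)
    ((‖discD A‖ ≤ discE A →
        AxisData A
          (√((discU A + ‖discD A‖) / (discU A - ‖discD A‖ + 2 * discE A)))
          (√((discU A - ‖discD A‖) / (discU A - ‖discD A‖ + 2 * discE A)))
          (extArcosh (extDiv (discU A + discE A) (discE A - ‖discD A‖)) / 2)
          (extArcosh (extDiv (discU A - ‖discD A‖ + discE A) (discE A)) / 2)) ∧
      (‖discD A‖ < discE A ↔ IsNonrealParabolic A ∨ IsQuasihyperbolic A)) ∧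
    -- (b)
    ((discE A ≤ ‖discD A‖ →
        AxisData A
          (√((discU A - ‖discD A‖ + 2 * discE A) / (discU A + ‖discD A‖)))
          (√((discU A - ‖discD A‖) / (discU A + ‖discD A‖)))
          (extArcosh (extDiv (discU A + discE A) (‖discD A‖ - discE A)) / 2)
          (extArcosh (extDiv (discU A) ‖discD A‖) / 2)) ∧
      (discE A < ‖discD A‖ ↔ IsRealElliptic A ∨ IsQuasielliptic A)) ∧
    -- (c)
    ((discE A = ‖discD A‖ → ¬ IsRealScalar A →
        AxisData A 1 (√((discU A - ‖discD A‖) / (discU A + ‖discD A‖)))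
          ⊤ (extArcosh (extDiv (discU A) ‖discD A‖) / 2)) ∧
      (discE A = ‖discD A‖ →
        √((discU A - ‖discD A‖) / (discU A + ‖discD A‖)) =
            √((discU A - discE A) / (discU A + discE A)) ∧
          extArcosh (extDiv (discU A) ‖discD A‖) / 2 =
            extArcosh (extDiv (discU A) (discE A)) / 2) ∧
      (IsRealScalar A → discE A = ‖discD A‖ ∧ AxisData A 0 0 0 0) ∧
      (discE A = ‖discD A‖ ↔ IsRealParabolic A ∨ IsRealHyperbolic A ∨ IsSemiRealType A)) := by
  refine ⟨⟨axisData_of_le, lt_discE_iff A⟩, ⟨axisData_of_ge, discE_lt_iff A⟩, axisData_of_eq,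
    fun h => ?_, fun h => h.axisData, discE_eq_iff A⟩
  rw [h]
  exact ⟨rfl, rfl⟩
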